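/- **Conventions.** A *normal $j$-algebra* is a triple $(\mathfrak g,\alpha,j)$ where $\mathfrak g$ is a finite-dimensional real solvable Lie algebra such that every $\mathrm{ad}_X$ has only real eigenvalues; $j$ is an endomorphism of $\mathfrak g$ with $j^2=-\mathrm{Id}$ and $[X,Y]+j[jX,Y]+j[X,jY]-[jX,jY]=0$; and $\alpha$ is a linear form on $\mathfrak g$ with $\alpha([jX,X])>0$ for $X\neq 0$ and $\alpha([jX,jY])=\alpha([X,Y])$. A *normal $j$-group* is a connected, simply connected real Lie group whose Lie algebra underlies a normal $j$-algebra. For a finite-dimensional symplectic vector space $(V_2,\omega_0)$ the *elementary normal $j$-group* $\mathbb S_2=\mathbb R H_2\times V_2\times\mathbb R E_2=\{(a,x,\ell)\}$ has the group law $$(a,x,\ell)(a',x',\ell')=\big(a+a',\,e^{-a'}x+x',\,e^{-2a'}\ell+\ell'+\tfrac12e^{-a'}\omega_0(x,x')\big);$$ ${}^\flat E_2$ is the linear form on its Lie algebra $\mathfrak s_2=\mathbb R H_2\oplus V_2\oplus\mathbb R E_2$ that vanishes on $\mathbb R H_2\oplus V_2$ and is $1$ at $E_2$. The coadjoint action of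 a Lie group is $\mathrm{Ad}^*_g\xi=\xi\circ\mathrm{Ad}_{g^{-1}}$, and the Kirillov–Kostant–Souriau (KKS) form of a coadjoint orbit at $\xi$ is $\omega_\xi(X^*_\xi,Y^*_\xi)=\langle\xi,[X,Y]\rangle$, where $X^*_\xi=\frac{d}{dt}\big|_{0}\mathrm{Ad}^*_{\exp(-tX)}\xi=\xi\circ\mathrm{ad}_X$. **Proposition.** Let $G_1$ be a normal $j$-group with Lie algebra $\mathfrak g_1$, let $\mathbb S_2$ be the elementary normal $j$-group of $(V_2,\omega_0)$, let $\rho:G_1\to Sp(V_2,\omega_0)$ be a homomorphism of Lie groups, acting on $\mathbb S_2$ by $\rho(g_1)(a,x,\ell)=(a,\rho(g_1)x,\ell)$, and let $G=G_1\ltimes_\rho\mathbb S_2$, with group law $(g_1,g_2)(g_1',g_2')=(g_1g_1',\,g_2\,\rho(g_1)g_2')$ and Lie algebra $\mathfrak g=\mathfrak g_1\oplus\mathfrak s_2$. Then: 1. There is $o_1\in\mathfrak g_1^*$ whose coadjoint orbit under $G_1$ is open in $\mathfrak g_1^*$ and is acted on simply transitively by $G_1$. Moreover, let $o_1\in\mathfrak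 g_1^*$ be any element with these two properties, let $\mathcal O_1$ be its orbit, let $\varepsilon_2\in\{1,-1\}$, and let $o=o_1+\varepsilon_2\,{}^\flat E_2\in\mathfrak g^*$, where $o_1$ and ${}^\flat E_2$ are extended by $0$ to $\mathfrak s_2$ and to $\mathfrak g_1$ respectively. Then: 2. The coadjoint orbit $\mathcal O$ of $G$ through $o$ is open in $\mathfrak g^*$. 3. Let $\mathcal O_2$ be the coadjoint orbit of $\mathbb S_2$ through $\varepsilon_2\,{}^\flat E_2$ (it is open in $\mathfrak s_2^*$). The map $$\phi:\mathcal O_1\times\mathcal O_2\to\mathcal O,\qquad(\mathrm{Ad}^*_{g_1}o_1,\ \varepsilon_2\,\mathrm{Ad}^*_{g_2}{}^\flat E_2)\mapsto\mathrm{Ad}^*_{(g_1,g_2)}(o)$$ is well defined and is a symplectomorphism when each orbit is endowed with its KKS two-form: $\phi$ is a smooth bijection with smooth inverse, and it pulls the KKS form of $\mathcal O$ back to the sum of the KKS forms of $\mathcal O_1$ and $\mathcal O_2$. -/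

import Mathlib

open scoped Manifold ContDiff

/-! ### Normal `j`-algebras -/

/-- `(L, α, j)` is a normal `j`-algebra: `L` is a (finite-dimensional real) solvable Lie algebra,
split over the reals (all the eigenvalues of each `ad X` are real), `j` is an integrable complex
structure on `L`, and `α` is a linear form whose coboundary is `j`-invariant and positive. -/
structure IsNormalJAlgebra (L : Type*) [LieRing L] [LieAlgebra ℝ L] [Module.Finite ℝ L]
    (α : Module.Dual ℝ L) (j : Module.End ℝ L) : Prop where
  solvable : LieAlgebra.IsSolvable L
  split : ∀ X : L, (LieAlgebra.ad ℝ L X).charpoly.Splits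
  j_sq : ∀ X : L, j (j X) = -X
  integrable : ∀ X Y : L, ⁅X, Y⁆ + j ⁅j X, Y⁆ + j ⁅X, j Y⁆ - ⁅j X, j Y⁆ = 0
  pos : ∀ X : L, X ≠ 0 → 0 < α ⁅j X, X⁆
  invariant : ∀ X Y : L, α ⁅j X, j Y⁆ = α ⁅X, Y⁆

section General

variable {E : Type*} [NormedAddCommGroup E] [NormedSpace ℝ E]
  {H : Type*} [TopologicalSpace H] (I : ModelWithCorners ℝ E H)
  (G : Type*) [TopologicalSpace G] [ChartedSpace H G] [Group G]

/-- A normal `j`-group: a connected and simply connected real Lie group whose Lie algebra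
underlies a normal `j`-algebra. -/
def IsNormalJGroup [FiniteDimensional ℝ E] [LieGroup I ∞ G] : Prop :=
  haveI : CompleteSpace E := FiniteDimensional.complete ℝ E
  haveI : LieGroup I (minSmoothness ℝ 3) G :=
    LieGroup.of_le (n := ∞) (by
      rw [minSmoothness_of_isRCLikeNormedField]
      exact ENat.LEInfty.out)
  haveI : Module.Finite ℝ (GroupLieAlgebra I G) := inferInstanceAs (Module.Finite ℝ E)
  SimplyConnectedSpace G ∧
    ∃ (α : Module.Dual ℝ (GroupLieAlgebra I G)) (j : Module.End ℝ (GroupLieAlgebra I G)),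
      IsNormalJAlgebra (GroupLieAlgebra I G) α j

/-! ### Coadjoint orbits and their Kirillov-Kostant-Souriau forms

The Lie algebra of `G` is the tangent space `GroupLieAlgebra I G` of `G` at `1`, which is by
definition a copy of the model space `E`; its dual is `E →L[ℝ] ℝ`, with the norm topology. -/

variable {G}

/-- The adjoint action: the derivative at `1` of the conjugation by `g`. -/
noncomputable def lieAd (g : G) : E →L[ℝ] E :=
  mfderiv I I (fun h : G => g * h * g⁻¹) 1

/-- The coadjoint action `Ad*_g ξ = ξ ∘ Ad_{g⁻¹}`. -/
noncomputable def coAd (g : G) (ξ : E →L[ℝ] ℝ) : E →L[ℝ] ℝ :=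
  ξ.comp (lieAd I g⁻¹)

variable (G)

/-- The coadjoint orbit of `G` through `ξ`. -/
def coadjointOrbit (ξ : E →L[ℝ] ℝ) : Set (E →L[ℝ] ℝ) :=
  Set.range fun g : G => coAd I g ξ

/-- `G` acts simply transitively, by the coadjoint action, on the set `O`. -/
def CoadjointSimplyTransitiveOn (O : Set (E →L[ℝ] ℝ)) : Prop :=
  ∀ ξ ∈ O, ∀ η ∈ O, ∃! g : G, coAd I g ξ = η

/-- The vector `u` is tangent at `ξ` to the coadjoint orbit, and is the value at `ξ` of the
fundamental vector field of `X`, that is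
`u = (d/dt) Ad*_{exp (-tX)} ξ = ξ ∘ ad X` (derivative at `t = 0`). -/
def IsFundamentalVector (ξ : E →L[ℝ] ℝ) (X : GroupLieAlgebra I G) (u : E →L[ℝ] ℝ) : Prop :=
  ∀ Z : GroupLieAlgebra I G, u Z = ξ (⁅X, Z⁆ : GroupLieAlgebra I G)

open Classical in
/-- The Kirillov-Kostant-Souriau two-form, at the point `ξ` of a coadjoint orbit:
`ω_ξ (X*_ξ, Y*_ξ) = ⟨ξ, [X, Y]⟩`. It takes the value zero by convention if one of the two vectors
is not tangent to the orbit. -/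
noncomputable def kksForm (ξ u v : E →L[ℝ] ℝ) : ℝ :=
  if h : (∃ X, IsFundamentalVector I G ξ X u) ∧ (∃ Y, IsFundamentalVector I G ξ Y v) then
    ξ (⁅h.1.choose, h.2.choose⁆ : GroupLieAlgebra I G)
  else 0

/-- The form is well defined: it does not depend on the elements `X`, `Y` that represent the two
tangent vectors. -/
theorem kksForm_eq {ξ u v : E →L[ℝ] ℝ} {X Y : GroupLieAlgebra I G}
    (hX : IsFundamentalVector I G ξ X u) (hY : IsFundamentalVector I G ξ Y v) :
    kksForm I G ξ u v = ξ (⁅X, Y⁆ : GroupLieAlgebra I G) := by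
  have skew : ∀ A B : GroupLieAlgebra I G, 
      ξ (⁅A, B⁆ : GroupLieAlgebra I G) = - ξ (⁅B, A⁆ : GroupLieAlgebra I G) := by
    intro A B
    have h : ⁅A, B⁆ = -⁅B, A⁆ := VectorField.mlieBracket_swap_apply
    rw [h]
    exact map_neg ξ _
  have h : (∃ X, IsFundamentalVector I G ξ X u) ∧ (∃ Y, IsFundamentalVector I G ξ Y v) :=
    ⟨⟨X, hX⟩, ⟨Y, hY⟩⟩
  rw [kksForm, dif_pos h, ← h.1.choose_spec, hX, skew, ← h.2.choose_spec, hY, ← skew]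

end General

/-- `φ` is a symplectomorphism from the open set `A` with the two-form `ωA` onto the open set `B`
with the two-form `ωB`: a smooth bijection with smooth inverse that pulls `ωB` back to `ωA`. -/
structure IsSymplectomorphismOn {M N : Type*} [NormedAddCommGroup M] [NormedSpace ℝ M]
    [NormedAddCommGroup N] [NormedSpace ℝ N] (A : Set M) (B : Set N)
    (ωA : M → M → M → ℝ) (ωB : N → N → N → ℝ) (φ : M → N) : Prop where
  isOpen_source : IsOpen A
  isOpen_target : IsOpen B
  bijOn : Set.BijOn φ A B
  contDiffOn : ContDiffOn ℝ ∞ φ A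
  contDiffOn_inv : ContDiffOn ℝ ∞ (Function.invFunOn φ A) B
  pullback : ∀ x ∈ A, ∀ u v : M, ωB (φ x) (fderiv ℝ φ x u) (fderiv ℝ φ x v) = ωA x u v

/-! ### Elementary normal `j`-groups -/

/-- A linear symplectic form on `V`. -/
structure SymplecticForm (V : Type*) [NormedAddCommGroup V] [NormedSpace ℝ V] where
  /-- The underlying bilinear form. -/
  form : V →L[ℝ] V →L[ℝ] ℝ
  alt : ∀ x, form x x = 0
  nondegenerate : ∀ x, (∀ y, form x y = 0) → x = 0

section Elementary

variable {V : Type*} [NormedAddCommGroup V] [NormedSpace ℝ V]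

/-- The elementary normal `j`-group `ℝ H × V × ℝ E` of the symplectic vector space `V`, whose
points are written `(a, x, ℓ)`. -/
def ElementaryGroup (_Ω : SymplecticForm V) : Type _ := ℝ × V × ℝ

variable (Ω : SymplecticForm V)

instance : TopologicalSpace (ElementaryGroup Ω) := inferInstanceAs (TopologicalSpace (ℝ × V × ℝ))

instance : ChartedSpace (ℝ × V × ℝ) (ElementaryGroup Ω) :=
  inferInstanceAs (ChartedSpace (ℝ × V × ℝ) (ℝ × V × ℝ))

instance : IsManifold 𝓘(ℝ, ℝ × V × ℝ) ∞ (ElementaryGroup Ω) :=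
  inferInstanceAs (IsManifold 𝓘(ℝ, ℝ × V × ℝ) ∞ (ℝ × V × ℝ))

variable {Ω}

/-- The group law
`(a, x, ℓ) (a', x', ℓ') = (a + a', e^{-a'} x + x', e^{-2a'} ℓ + ℓ' + (1/2) e^{-a'} Ω (x, x'))`. -/
noncomputable def ElementaryGroup.mul (g g' : ElementaryGroup Ω) : ElementaryGroup Ω :=
  (g.1 + g'.1, Real.exp (-g'.1) • g.2.1 + g'.2.1,
    Real.exp (-2 * g'.1) * g.2.2 + g'.2.2
      + 1 / 2 * Real.exp (-g'.1) * Ω.form g.2.1 g'.2.1)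

/-- The inverse `(a, x, ℓ)⁻¹ = (-a, -e^a x, -e^{2a} ℓ)`. -/
noncomputable def ElementaryGroup.inv (g : ElementaryGroup Ω) : ElementaryGroup Ω :=
  (-g.1, -(Real.exp g.1 • g.2.1), -(Real.exp (2 * g.1) * g.2.2))

noncomputable instance : Group (ElementaryGroup Ω) where
  mul := ElementaryGroup.mul
  one := ((0 : ℝ), (0 : V), (0 : ℝ))
  inv := ElementaryGroup.inv
  mul_assoc := by
    rintro ⟨a, x, l⟩ ⟨a', x', l'⟩ ⟨a'', x'', l''⟩
    have h1 : Real.exp (-(a' + a'')) = Real.exp (-a') * Real.exp (-a'') := by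
      rw [← Real.exp_add]; ring_nf
    have h2 : ∀ t : ℝ, Real.exp (-2 * t) = Real.exp (-t) ^ 2 := by
      intro t; rw [← Real.exp_nat_mul]; ring_nf
    refine Prod.ext (add_assoc _ _ _) (Prod.ext ?_ ?_)
    · change Real.exp (-a'') • (Real.exp (-a') • x + x') + x''
        = Real.exp (-(a' + a'')) • x + (Real.exp (-a'') • x' + x'')
      rw [h1, smul_add, smul_smul, add_assoc, mul_comm]
    · change Real.exp (-2 * a'') * (Real.exp (-2 * a') * l + l'
          + 1 / 2 * Real.exp (-a') * Ω.form x x') + l''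
          + 1 / 2 * Real.exp (-a'') * Ω.form (Real.exp (-a') • x + x') x''
        = Real.exp (-2 * (a' + a'')) * l + (Real.exp (-2 * a'') * l' + l''
          + 1 / 2 * Real.exp (-a'') * Ω.form x' x'')
          + 1 / 2 * Real.exp (-(a' + a'')) * Ω.form x (Real.exp (-a'') • x' + x'')
      simp only [h2, h1, map_add, map_smul, add_apply, smul_apply, smul_eq_mul]
      ring
  one_mul := by
    rintro ⟨a, x, l⟩
    refine Prod.ext (zero_add _) (Prod.ext ?_ ?_)
    · change Real.exp (-a) • (0 : V) + x = x
      simp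
    · change Real.exp (-2 * a) * 0 + l + 1 / 2 * Real.exp (-a) * Ω.form 0 x = l
      simp
  mul_one := by
    rintro ⟨a, x, l⟩
    refine Prod.ext (add_zero _) (Prod.ext ?_ ?_)
    · change Real.exp (-0) • x + 0 = x
      simp
    · change Real.exp (-2 * 0) * l + 0 + 1 / 2 * Real.exp (-0) * Ω.form x 0 = l
      simp
  inv_mul_cancel := by
    rintro ⟨a, x, l⟩
    refine Prod.ext (neg_add_cancel _) (Prod.ext ?_ ?_)
    · change Real.exp (-a) • -(Real.exp a • x) + x = 0
      rw [smul_neg, smul_smul, ← Real.exp_add]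
      simp
    · change Real.exp (-2 * a) * -(Real.exp (2 * a) * l) + l
        + 1 / 2 * Real.exp (-a) * Ω.form (-(Real.exp a • x)) x = 0
      have h : Real.exp (-2 * a) * Real.exp (2 * a) = 1 := by
        rw [← Real.exp_add]; simp
      simp only [map_neg, map_smul, neg_apply, smul_apply, Ω.alt]
      linear_combination (-l) * h

instance : LieGroup 𝓘(ℝ, ℝ × V × ℝ) ∞ (ElementaryGroup Ω) where
  contMDiff_mul := by
    rw [← modelWithCornersSelf_prod]
    have : ContDiff ℝ ∞ (fun p : (ℝ × V × ℝ) × (ℝ × V × ℝ) =>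
        ((p.1.1 + p.2.1, Real.exp (-p.2.1) • p.1.2.1 + p.2.2.1,
          Real.exp (-2 * p.2.1) * p.1.2.2 + p.2.2.2
            + 1 / 2 * Real.exp (-p.2.1) * Ω.form p.1.2.1 p.2.2.1) : ℝ × V × ℝ)) := by
      fun_prop
    have h := this.contMDiff
    rw [← chartedSpaceSelf_prod] at h
    exact h
  contMDiff_inv := by
    have : ContDiff ℝ ∞ (fun p : ℝ × V × ℝ =>
        ((-p.1, -(Real.exp p.1 • p.2.1), -(Real.exp (2 * p.1) * p.2.2)) : ℝ × V × ℝ)) := by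
      fun_prop
    exact this.contMDiff

variable (V) in
/-- The linear form `♭E` on the Lie algebra `ℝ H ⊕ V ⊕ ℝ E` of the elementary group: it vanishes on
`ℝ H ⊕ V` and takes the value `1` at `E`. -/
def flatE : (ℝ × V × ℝ) →L[ℝ] ℝ :=
  (ContinuousLinearMap.snd ℝ V ℝ).comp (ContinuousLinearMap.snd ℝ ℝ (V × ℝ))

end Elementary

/-! ### Semidirect products with an elementary normal `j`-group -/

section Semidirect

variable {E₁ : Type*} [NormedAddCommGroup E₁] [NormedSpace ℝ E₁]
  {H₁ : Type*} [TopologicalSpace H₁]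
  {V : Type*} [NormedAddCommGroup V] [NormedSpace ℝ V]

/-- A homomorphism of Lie groups `ρ : G₁ → Sp(V, Ω)`. -/
structure SymplecticRep (I₁ : ModelWithCorners ℝ E₁ H₁) (G₁ : Type*) [TopologicalSpace G₁]
    [ChartedSpace H₁ G₁] [Group G₁] (Ω : SymplecticForm V) where
  /-- The underlying homomorphism of groups. -/
  hom : G₁ →* (V ≃L[ℝ] V)
  symplectic : ∀ g x y, Ω.form (hom g x) (hom g y) = Ω.form x y
  smooth : ContMDiff I₁ 𝓘(ℝ, V →L[ℝ] V) ∞ fun g : G₁ => (hom g : V →L[ℝ] V)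

variable {I₁ : ModelWithCorners ℝ E₁ H₁} {G₁ : Type*} [TopologicalSpace G₁]
  [ChartedSpace H₁ G₁] [Group G₁] {Ω : SymplecticForm V}

/-- The action of `G₁` on the elementary group by `ρ(g₁) (a, x, ℓ) = (a, ρ(g₁) x, ℓ)`. -/
def SymplecticRep.act (ρ : SymplecticRep I₁ G₁ Ω) (g : G₁) (s : ElementaryGroup Ω) :
    ElementaryGroup Ω :=
  (s.1, ρ.hom g s.2.1, s.2.2)

theorem SymplecticRep.act_one (ρ : SymplecticRep I₁ G₁ Ω) (s : ElementaryGroup Ω) :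
    ρ.act 1 s = s := by
  change (s.1, ρ.hom 1 s.2.1, s.2.2) = s
  rw [map_one]
  rfl

theorem SymplecticRep.act_mul (ρ : SymplecticRep I₁ G₁ Ω) (g h : G₁) (s : ElementaryGroup Ω) :
    ρ.act (g * h) s = ρ.act g (ρ.act h s) := by
  change (s.1, ρ.hom (g * h) s.2.1, s.2.2) = (s.1, ρ.hom g (ρ.hom h s.2.1), s.2.2)
  rw [map_mul]
  rfl

theorem SymplecticRep.act_map_mul (ρ : SymplecticRep I₁ G₁ Ω) (g : G₁)
    (s t : ElementaryGroup Ω) : ρ.act g (s * t) = ρ.act g s * ρ.act g t := by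
  refine Prod.ext rfl (Prod.ext ?_ ?_)
  · change ρ.hom g (Real.exp (-t.1) • s.2.1 + t.2.1)
      = Real.exp (-t.1) • ρ.hom g s.2.1 + ρ.hom g t.2.1
    rw [map_add, map_smul]
  · change Real.exp (-2 * t.1) * s.2.2 + t.2.2
        + 1 / 2 * Real.exp (-t.1) * Ω.form s.2.1 t.2.1
      = Real.exp (-2 * t.1) * s.2.2 + t.2.2
        + 1 / 2 * Real.exp (-t.1) * Ω.form (ρ.hom g s.2.1) (ρ.hom g t.2.1)
    rw [ρ.symplectic]

/-- The semidirect product `G = G₁ ⋉_ρ S₂`, on the product manifold `G₁ × S₂`. -/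
def SemidirectGroup (_ρ : SymplecticRep I₁ G₁ Ω) : Type _ := G₁ × ElementaryGroup Ω

variable (ρ : SymplecticRep I₁ G₁ Ω)

instance : TopologicalSpace (SemidirectGroup ρ) :=
  inferInstanceAs (TopologicalSpace (G₁ × ElementaryGroup Ω))

instance : ChartedSpace (ModelProd H₁ (ℝ × V × ℝ)) (SemidirectGroup ρ) :=
  inferInstanceAs (ChartedSpace (ModelProd H₁ (ℝ × V × ℝ)) (G₁ × ElementaryGroup Ω))

/-- The element `(g₁, g₂)` of the semidirect product. -/
def SemidirectGroup.mk (g₁ : G₁) (g₂ : ElementaryGroup Ω) : SemidirectGroup ρ := (g₁, g₂)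

variable {ρ}

/-- The group law `(g₁, g₂) (g₁', g₂') = (g₁ g₁', g₂ (ρ(g₁) g₂'))`. -/
noncomputable instance : Group (SemidirectGroup ρ) where
  mul g g' := SemidirectGroup.mk ρ (g.1 * g'.1) (g.2 * ρ.act g.1 g'.2)
  one := SemidirectGroup.mk ρ 1 1
  inv g := SemidirectGroup.mk ρ g.1⁻¹ (ρ.act g.1⁻¹ g.2⁻¹)
  mul_assoc g g' g'' := by
    refine Prod.ext (mul_assoc _ _ _) ?_
    change (g.2 * ρ.act g.1 g'.2) * ρ.act (g.1 * g'.1) g''.2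
      = g.2 * ρ.act g.1 (g'.2 * ρ.act g'.1 g''.2)
    rw [ρ.act_map_mul, ρ.act_mul, mul_assoc]
  one_mul g := by
    refine Prod.ext (one_mul _) ?_
    change 1 * ρ.act 1 g.2 = g.2
    rw [ρ.act_one, one_mul]
  mul_one g := by
    refine Prod.ext (mul_one _) ?_
    change g.2 * ρ.act g.1 1 = g.2
    have h : ρ.act g.1 1 * ρ.act g.1 1 = ρ.act g.1 1 := by rw [← ρ.act_map_mul, one_mul]
    rw [mul_eq_left.mp h, mul_one]
  inv_mul_cancel g := by
    refine Prod.ext (inv_mul_cancel _) ?_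
    change ρ.act g.1⁻¹ g.2⁻¹ * ρ.act g.1⁻¹ g.2 = 1
    have h : ρ.act g.1⁻¹ 1 * ρ.act g.1⁻¹ 1 = ρ.act g.1⁻¹ 1 := by
      rw [← ρ.act_map_mul, one_mul]
    rw [← ρ.act_map_mul, inv_mul_cancel, mul_eq_left.mp h]

theorem SymplecticRep.contMDiff_act :
    ContMDiff (I₁.prod 𝓘(ℝ, ℝ × V × ℝ)) 𝓘(ℝ, ℝ × V × ℝ) ∞
      (fun p : G₁ × ElementaryGroup Ω => ρ.act p.1 p.2) := by
  have hs : ContMDiff (I₁.prod 𝓘(ℝ, ℝ × V × ℝ)) 𝓘(ℝ, ℝ × V × ℝ) ∞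
      (fun p : G₁ × ElementaryGroup Ω => (p.2 : ℝ × V × ℝ)) := contMDiff_snd
  have hr : ContMDiff (I₁.prod 𝓘(ℝ, ℝ × V × ℝ)) 𝓘(ℝ, V →L[ℝ] V) ∞
      (fun p : G₁ × ElementaryGroup Ω => (ρ.hom p.1 : V →L[ℝ] V)) :=
    ρ.smooth.comp contMDiff_fst
  have hc : ContDiff ℝ ∞ (fun q : (V →L[ℝ] V) × (ℝ × V × ℝ) =>
      ((q.2.1, q.1 q.2.2.1, q.2.2.2) : ℝ × V × ℝ)) := by
    fun_prop
  exact hc.contMDiff.comp (hr.prodMk_space hs)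

instance [LieGroup I₁ ∞ G₁] :
    LieGroup (I₁.prod 𝓘(ℝ, ℝ × V × ℝ)) ∞ (SemidirectGroup ρ) :=
  haveI : IsManifold (I₁.prod 𝓘(ℝ, ℝ × V × ℝ)) ∞ (SemidirectGroup ρ) :=
    inferInstanceAs (IsManifold (I₁.prod 𝓘(ℝ, ℝ × V × ℝ)) ∞ (G₁ × ElementaryGroup Ω))
  { contMDiff_mul := by
      have hf : ContMDiff ((I₁.prod 𝓘(ℝ, ℝ × V × ℝ)).prod (I₁.prod 𝓘(ℝ, ℝ × V × ℝ)))
          I₁ ∞ (fun p : (G₁ × ElementaryGroup Ω) × (G₁ × ElementaryGroup Ω) =>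
            p.1.1 * p.2.1) :=
        (contMDiff_fst.comp contMDiff_fst).mul (contMDiff_fst.comp contMDiff_snd)
      have ha : ContMDiff ((I₁.prod 𝓘(ℝ, ℝ × V × ℝ)).prod (I₁.prod 𝓘(ℝ, ℝ × V × ℝ)))
          𝓘(ℝ, ℝ × V × ℝ) ∞ (fun p : (G₁ × ElementaryGroup Ω) × (G₁ × ElementaryGroup Ω) =>
            ρ.act p.1.1 p.2.2) :=
        SymplecticRep.contMDiff_act.comp
          ((contMDiff_fst.comp contMDiff_fst).prodMk (contMDiff_snd.comp contMDiff_snd))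
      have hs : ContMDiff ((I₁.prod 𝓘(ℝ, ℝ × V × ℝ)).prod (I₁.prod 𝓘(ℝ, ℝ × V × ℝ)))
          𝓘(ℝ, ℝ × V × ℝ) ∞ (fun p : (G₁ × ElementaryGroup Ω) × (G₁ × ElementaryGroup Ω) =>
            p.1.2 * ρ.act p.1.1 p.2.2) :=
        (contMDiff_snd.comp contMDiff_fst).mul ha
      exact hf.prodMk hs
    contMDiff_inv := by
      have hf : ContMDiff (I₁.prod 𝓘(ℝ, ℝ × V × ℝ)) I₁ ∞
          (fun p : G₁ × ElementaryGroup Ω => p.1⁻¹) := contMDiff_fst.inv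
      have hg : ContMDiff (I₁.prod 𝓘(ℝ, ℝ × V × ℝ)) 𝓘(ℝ, ℝ × V × ℝ) ∞
          (fun p : G₁ × ElementaryGroup Ω => p.2⁻¹) := contMDiff_snd.inv
      have hs : ContMDiff (I₁.prod 𝓘(ℝ, ℝ × V × ℝ)) 𝓘(ℝ, ℝ × V × ℝ) ∞
          (fun p : G₁ × ElementaryGroup Ω => ρ.act p.1⁻¹ p.2⁻¹) :=
        SymplecticRep.contMDiff_act.comp (hf.prodMk hg)
      exact hf.prodMk hs }

end Semidirect

/-!
The first assertion. The linear form `α` of the normal `j`-algebra has a nondegenerate coboundary,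
since `α [j X, X] > 0`; so its orbit is open and its stabilizer discrete
(`NondegenerateAt.isOpen_coadjointOrbit`, `NondegenerateAt.eventually_eq_one`). The orbit map is
then a covering of the orbit, and as the group is connected the stabilizer is trivial as soon as the
orbit is simply connected (`NondegenerateAt.eq_one_of_coAd_eq`). In fact the orbit is contractible.
By Lie's theorem a split solvable algebra `L` has a full flag of ideals, and the connected group
acts on each one-dimensional quotient by positive scalars. Restrict the forms of the orbit to the
members `N ⊂ N'` of the flag: a fibre of the restriction from `N'` to `N` is an open subset of a
line on which increasing affine bijections act transitively, so it is an interval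
(`Real.convex_of_affine_transitive`), and the contractibility of the image in `N*` passes to the
image in `N'*` (`contractibleSpace_of_triangular_orbit`).

The other assertions. By Sard's lemma a form with an open orbit is nondegenerate
(`NondegenerateAt.of_isOpen_coadjointOrbit`). The coadjoint action of `(g₁, g₂)` on
`o = o₁ + ε ♭E` can be computed explicitly (`SemidirectGroup.coAd_coprod`): its component in `𝔰₂*`
is `Ad*_{g₂} (ε ♭E)`, and its component in `𝔤₁*` is `Ad*_{g₁} o₁` minus a quadratic term that
depends on `η = Ad*_{g₂} (ε ♭E)` only. With `τ = η E` and `w` the vector of `V` such that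
`η = Ω (w, ·)` on `V`, this term is `X ↦ Ω (w, dρ(X) w) / (2 τ)`. So the map of the theorem is the
shear `(ξ, η) ↦ (ξ - Ω (w, dρ(·) w) / (2 τ), η)`, smooth with a smooth inverse wherever `τ ≠ 0`.

At the base point `(o₁, ε ♭E)` one has `w = 0`, so the derivative of the shear is the direct sum
map; differentiating the orbit map of `o` at `1` gives `o [X, Y] = o₁ [X₁, Y₁] + ε ♭E [X₂, Y₂]`
(`SymplecticRep.coprod_adDeriv`). Hence `o` is nondegenerate, its orbit is open, and the two forms
agree at the base point. Since the shear intertwines the action of `(g₁, g₂)` on the product of the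
orbits with its coadjoint action, up to the symplectic automorphism `ρ(g₁)` of the second factor,
they agree everywhere (`SymplecticRep.kksForm_fderiv_orbitMap`).
-/

/-! ### The adjoint representation -/

section Adjoint

open Filter Set
open scoped Topology

variable {E : Type*} [NormedAddCommGroup E] [NormedSpace ℝ E]
  {H : Type*} [TopologicalSpace H] {I : ModelWithCorners ℝ E H}
  {G : Type*} [TopologicalSpace G] [ChartedSpace H G] [Group G] [LieGroup I ∞ G]

theorem contMDiff_conj (g : G) : ContMDiff I I ∞ (fun h : G => g * h * g⁻¹) :=
  (contMDiff_const.mul contMDiff_id).mul contMDiff_const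

theorem mdifferentiableAt_conj (g h : G) : MDifferentiableAt I I (fun h : G => g * h * g⁻¹) h :=
  (contMDiff_conj g).mdifferentiableAt (by simp)

theorem mdifferentiableAt_mul_left' (g h : G) : MDifferentiableAt I I (fun h : G => g * h) h :=
  (contMDiff_mul_left (I := I) (n := ∞)).mdifferentiableAt (by simp)

theorem mdifferentiableAt_mul_right' (g h : G) : MDifferentiableAt I I (fun h : G => h * g) h :=
  (contMDiff_mul_right (I := I) (n := ∞)).mdifferentiableAt (by simp)

theorem hasMFDerivAt_conj (g : G) :
    HasMFDerivAt I I (fun h : G => g * h * g⁻¹) 1 (lieAd I g : E →L[ℝ] E) :=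
  (mdifferentiableAt_conj g 1).hasMFDerivAt

omit [LieGroup I ∞ G] in
theorem lieAd_one : lieAd I (1 : G) = ContinuousLinearMap.id ℝ E := by
  have : (fun h : G => 1 * h * 1⁻¹) = id := by ext; simp
  rw [lieAd, this, mfderiv_id]
  rfl

theorem lieAd_mul (g h : G) : lieAd I (g * h) = (lieAd I g).comp (lieAd I h) := by
  have h1 : (fun k : G => g * h * k * (g * h)⁻¹)
      = (fun k : G => g * k * g⁻¹) ∘ (fun k : G => h * k * h⁻¹) := by
    ext k; simp [mul_assoc]
  have h2 : HasMFDerivAt I I (fun k : G => g * k * g⁻¹) (h * 1 * h⁻¹) (lieAd I g : E →L[ℝ] E) := by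
    have h3 : h * 1 * h⁻¹ = 1 := by simp
    rw [h3]
    exact hasMFDerivAt_conj g
  have h4 := h2.comp (1 : G) (hasMFDerivAt_conj h)
  rw [← h1] at h4
  exact h4.mfderiv

variable (I G) in
/-- The adjoint representation, as a homomorphism of monoids. -/
noncomputable def adRep : G →* (E →L[ℝ] E) where
  toFun := lieAd I
  map_one' := lieAd_one
  map_mul' := lieAd_mul

omit [LieGroup I ∞ G] in
theorem coAd_apply (g : G) (ξ : E →L[ℝ] ℝ) (X : E) : coAd I g ξ X = ξ (lieAd I g⁻¹ X) := rfl

omit [LieGroup I ∞ G] in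
theorem coAd_one (ξ : E →L[ℝ] ℝ) : coAd I (1 : G) ξ = ξ := by
  ext X
  simp [coAd_apply, lieAd_one]

theorem coAd_mul (g h : G) (ξ : E →L[ℝ] ℝ) : coAd I (g * h) ξ = coAd I g (coAd I h ξ) := by
  ext X
  simp [coAd_apply, lieAd_mul]

/-- The adjoint representation is smooth at `1`: it is the partial derivative of the smooth map
`(g, h) ↦ g h g⁻¹`, and each conjugation fixes `1`, so that a single chart suffices. -/
theorem contMDiffAt_lieAd_one :
    ContMDiffAt I 𝓘(ℝ, E →L[ℝ] E) ∞ (lieAd I : G → E →L[ℝ] E) 1 := by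
  have hf : ContMDiff (I.prod I) I ∞ (Function.uncurry fun g h : G => g * h * g⁻¹) :=
    (contMDiff_fst.mul contMDiff_snd).mul contMDiff_fst.inv
  have : IsManifold I 1 G := IsManifold.of_le (n := ∞) (by simp)
  have h := ContMDiffAt.mfderiv (I := I) (m := ∞) (x₀ := (1 : G)) (fun g h : G => g * h * g⁻¹)
    (fun _ => 1) hf.contMDiffAt contMDiffAt_const (by rfl)
  refine h.congr_of_eventuallyEq (Eventually.of_forall fun g => ?_)
  rw [inTangentCoordinates_eq_mfderiv_comp (by simp) (by simp), mfderivWithin_range_extChartAt_symm]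
  have h3 : g * 1 * g⁻¹ = 1 := by simp
  have h4 : (1 : G) * 1 * 1⁻¹ = 1 := by simp
  rw [h4, h3, mfderiv_extChartAt_self]
  rfl

end Adjoint

/-! ### The derivative of the adjoint representation -/

section AdjointDerivative

open Filter Set
open scoped Topology

variable {E : Type*} [NormedAddCommGroup E] [NormedSpace ℝ E]
  {H : Type*} [TopologicalSpace H] {I : ModelWithCorners ℝ E H} [I.Boundaryless]
  {G : Type*} [TopologicalSpace G] [ChartedSpace H G]

theorem hasMFDerivAt_extChartAt_symm_self [IsManifold I 1 G] (p : G) :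
    HasMFDerivAt 𝓘(ℝ, E) I (extChartAt I p).symm (extChartAt I p p)
      (ContinuousLinearMap.id ℝ E) := by
  have h := (mdifferentiableWithinAt_extChartAt_symm (I := I)
    (mem_extChartAt_target (I := I) p)).hasMFDerivWithinAt
  rw [mfderivWithin_range_extChartAt_symm, ModelWithCorners.Boundaryless.range_eq_univ] at h
  exact hasMFDerivWithinAt_univ.1 h

/-- A manifold derivative at `p` is an ordinary derivative in the preferred chart at `p`. -/
theorem HasMFDerivAt.hasFDerivAt_comp_extChartAt_symm [IsManifold I 1 G]
    {F : Type*} [NormedAddCommGroup F] [NormedSpace ℝ F] {f : G → F} {p : G} {f' : E →L[ℝ] F}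
    (h : HasMFDerivAt I 𝓘(ℝ, F) f p f') :
    HasFDerivAt (f ∘ (extChartAt I p).symm) f' (extChartAt I p p) := by
  refine hasMFDerivAt_iff_hasFDerivAt.1 ?_
  have h1 : HasMFDerivAt I 𝓘(ℝ, F) f ((extChartAt I p).symm (extChartAt I p p)) f' := by
    rwa [extChartAt_to_inv]
  exact h1.comp _ (hasMFDerivAt_extChartAt_symm_self p)

variable [Group G] [LieGroup I ∞ G]

/-- The multiplication is smooth in the preferred chart at `1`. -/
theorem contDiffAt_mul_extChartAt :
    ContDiffAt ℝ ∞ (fun p : E × E => extChartAt I (1 : G)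
      ((extChartAt I (1 : G)).symm p.1 * (extChartAt I (1 : G)).symm p.2))
      (extChartAt I (1 : G) 1, extChartAt I (1 : G) 1) := by
  rw [← contMDiffAt_iff_contDiffAt]
  have hs : ContMDiffAt 𝓘(ℝ, E) I ∞ (extChartAt I (1 : G)).symm (extChartAt I (1 : G) 1) :=
    (contMDiffOn_extChartAt_symm (1 : G)).contMDiffAt (extChartAt_target_mem_nhds 1)
  have h1 : ContMDiffAt 𝓘(ℝ, E × E) I ∞ (fun p : E × E => (extChartAt I (1 : G)).symm p.1)
      (extChartAt I (1 : G) 1, extChartAt I (1 : G) 1) :=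
    ContMDiffAt.comp _ hs contDiff_fst.contMDiff.contMDiffAt
  have h2 : ContMDiffAt 𝓘(ℝ, E × E) I ∞ (fun p : E × E => (extChartAt I (1 : G)).symm p.2)
      (extChartAt I (1 : G) 1, extChartAt I (1 : G) 1) :=
    ContMDiffAt.comp _ hs contDiff_snd.contMDiff.contMDiffAt
  have h3 : ContMDiffAt I 𝓘(ℝ, E) ∞ (extChartAt I (1 : G))
      ((extChartAt I (1 : G)).symm (extChartAt I (1 : G) 1)
        * (extChartAt I (1 : G)).symm (extChartAt I (1 : G) 1)) := by
    simp only [extChartAt_to_inv, mul_one]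
    exact contMDiffAt_extChartAt
  exact ContMDiffAt.comp _ h3 (h1.mul h2)

omit [LieGroup I ∞ G] in
/-- The derivative at `1` of a map `f` of `G`, read in the preferred chart at `1`. -/
theorem HasMFDerivAt.hasFDerivAt_extChartAt_one [IsManifold I 1 G] {f : G → G} {f' : E →L[ℝ] E}
    {g : G} (h : HasMFDerivAt I I f 1 f') (hg : f 1 = g)
    (hs : g ∈ (chartAt H (1 : G)).source) :
    HasFDerivAt (fun y => extChartAt I (1 : G) (f ((extChartAt I (1 : G)).symm y)))
      ((mfderiv I 𝓘(ℝ, E) (extChartAt I (1 : G)) g : E →L[ℝ] E).comp f')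
      (extChartAt I (1 : G) 1) := by
  subst hg
  have h1 : HasMFDerivAt I 𝓘(ℝ, E) (extChartAt I (1 : G)) (f 1)
      (mfderiv I 𝓘(ℝ, E) (extChartAt I (1 : G)) (f 1)) :=
    (mdifferentiableAt_extChartAt hs).hasMFDerivAt
  have h2 := h1.comp (1 : G) h
  exact h2.hasFDerivAt_comp_extChartAt_symm

omit [I.Boundaryless] in
/-- Left translation by `g` is conjugation by `g` followed by right translation. -/
theorem mfderiv_mul_left_eq_comp_lieAd (g : G) :
    (show E →L[ℝ] E from mfderiv I I (fun h : G => g * h) 1)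
      = (show E →L[ℝ] E from mfderiv I I (fun h : G => h * g) 1).comp (lieAd I g) := by
  have h2 : HasMFDerivAt I I (fun h : G => h * g) (g * 1 * g⁻¹)
      (mfderiv I I (fun h : G => h * g) 1 : E →L[ℝ] E) := by
    have h3 : g * 1 * g⁻¹ = 1 := by simp
    rw [h3]
    exact (mdifferentiableAt_mul_right' g 1).hasMFDerivAt
  have h4 := h2.comp (1 : G) (hasMFDerivAt_conj g)
  have h1 : (fun h : G => h * g) ∘ (fun k : G => g * k * g⁻¹) = fun h => g * h := by
    ext k; simp
  rw [h1] at h4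
  exact h4.mfderiv

variable (I G) in
/-- The derivative at `1` of the adjoint representation, as a bilinear map on the model space. It is
the bracket of the Lie algebra, in a form that does not mention `GroupLieAlgebra`. -/
noncomputable def adDeriv : E →L[ℝ] E →L[ℝ] E :=
  mfderiv I 𝓘(ℝ, E →L[ℝ] E) (lieAd I : G → E →L[ℝ] E) 1

omit [I.Boundaryless] in
theorem hasMFDerivAt_lieAd_one :
    HasMFDerivAt I 𝓘(ℝ, E →L[ℝ] E) (lieAd I : G → E →L[ℝ] E) 1 (adDeriv I G :) :=
  (contMDiffAt_lieAd_one.mdifferentiableAt (by simp)).hasMFDerivAt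

/-- The derivative of the adjoint representation is the bracket of the Lie algebra. With `m` the
multiplication in a chart, differentiate `∂₂ m (x, e) Y = ∂₁ m (e, x) (Ad_x Y)` at `x = e`: the
symmetry of the second derivative of `m` turns the result into the formula in coordinates for the
bracket of left-invariant vector fields. -/
theorem adDeriv_apply (X Y : GroupLieAlgebra I G) :
    adDeriv I G X Y = (⁅X, Y⁆ : GroupLieAlgebra I G) := by
  have : IsManifold I 1 G := IsManifold.of_le (n := ∞) (by simp)
  set ψ := extChartAt I (1 : G) with hψ
  set e : E := ψ 1 with he
  set m : E × E → E := fun p => ψ (ψ.symm p.1 * ψ.symm p.2) with hm_def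
  set A' : E →L[ℝ] E →L[ℝ] E := adDeriv I G with hA'
  have hm : ContDiffAt ℝ 2 m (e, e) := contDiffAt_mul_extChartAt.of_le (by exact ENat.LEInfty.out)
  have hA : HasFDerivAt ((lieAd I : G → E →L[ℝ] E) ∘ ψ.symm) A' e :=
    hasMFDerivAt_lieAd_one.hasFDerivAt_comp_extChartAt_symm
  have hsymm : IsSymmSndFDerivAt ℝ m (e, e) := hm.isSymmSndFDerivAt (by simp)
  set B : E × E →L[ℝ] E × E →L[ℝ] E := fderiv ℝ (fderiv ℝ m) (e, e) with hB
  have hB' : HasFDerivAt (fderiv ℝ m) B (e, e) :=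
    ((hm.fderiv_right (m := 1) (by norm_num)).differentiableAt (by simp)).hasFDerivAt
  -- the two partial derivatives of `m` on the axes, as functions of the other variable
  have hP : HasFDerivAt (fun x => fderiv ℝ m (x, e)) (B.comp (.inl ℝ E E)) e :=
    HasFDerivAt.comp e hB' (hasFDerivAt_prodMk_left e e)
  have hQ : HasFDerivAt (fun x => fderiv ℝ m (e, x)) (B.comp (.inr ℝ E E)) e :=
    HasFDerivAt.comp e hB' (hasFDerivAt_prodMk_right e e)
  have hev : ∀ᶠ p in 𝓝 (e, e), DifferentiableAt ℝ m p :=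
    (hm.eventually (by simp)).mono fun p hp => hp.differentiableAt (by simp)
  have hevl : ∀ᶠ x in 𝓝 e, DifferentiableAt ℝ m (x, e) :=
    (Continuous.prodMk_left e).continuousAt.eventually hev
  have hevr : ∀ᶠ x in 𝓝 e, DifferentiableAt ℝ m (e, x) :=
    (Continuous.prodMk_right e).continuousAt.eventually hev
  have htar : ∀ᶠ x in 𝓝 e, x ∈ ψ.target := extChartAt_target_mem_nhds 1
  have hsrc : ∀ x ∈ ψ.target, ψ.symm x ∈ (chartAt H (1 : G)).source := fun x hx => by
    rw [← extChartAt_source I]; exact ψ.map_target hx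
  have he1 : ψ.symm e = 1 := extChartAt_to_inv 1
  have hl : ∀ᶠ x in 𝓝 e, (fderiv ℝ m (x, e)).comp (.inr ℝ E E)
      = (show E →L[ℝ] E from mfderiv I 𝓘(ℝ, E) ψ (ψ.symm x)).comp
        (show E →L[ℝ] E from mfderiv I I (fun h : G => ψ.symm x * h) 1) := by
    filter_upwards [hevl, htar] with x hx hxt
    have h1 : HasFDerivAt (fun y => m (x, y)) ((fderiv ℝ m (x, e)).comp (.inr ℝ E E)) e :=
      HasFDerivAt.comp e hx.hasFDerivAt (hasFDerivAt_prodMk_right x e)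
    exact h1.unique (HasMFDerivAt.hasFDerivAt_extChartAt_one
      (mdifferentiableAt_mul_left' (I := I) (ψ.symm x) 1).hasMFDerivAt (mul_one _) (hsrc x hxt))
  have hr : ∀ᶠ x in 𝓝 e, (fderiv ℝ m (e, x)).comp (.inl ℝ E E)
      = (show E →L[ℝ] E from mfderiv I 𝓘(ℝ, E) ψ (ψ.symm x)).comp
        (show E →L[ℝ] E from mfderiv I I (fun h : G => h * ψ.symm x) 1) := by
    filter_upwards [hevr, htar] with x hx hxt
    have h1 : HasFDerivAt (fun y => m (y, x)) ((fderiv ℝ m (e, x)).comp (.inl ℝ E E)) e :=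
      HasFDerivAt.comp (f := fun y => (y, x)) e hx.hasFDerivAt (hasFDerivAt_prodMk_left e x)
    exact h1.unique (HasMFDerivAt.hasFDerivAt_extChartAt_one
      (mdifferentiableAt_mul_right' (I := I) (ψ.symm x) 1).hasMFDerivAt (one_mul _) (hsrc x hxt))
  have hrel : ∀ Z : E, ∀ᶠ x in 𝓝 e, fderiv ℝ m (x, e) (0, Z)
      = fderiv ℝ m (e, x) (lieAd I (ψ.symm x) Z, 0) := by
    intro Z
    filter_upwards [hl, hr] with x h1 h2
    have h3 := DFunLike.congr_fun h1 Z
    have h4 := DFunLike.congr_fun h2 (lieAd I (ψ.symm x) Z)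
    rw [mfderiv_mul_left_eq_comp_lieAd] at h3
    exact h3.trans h4.symm
  have hQe : ∀ Z : E, fderiv ℝ m (e, e) (Z, 0) = Z := by
    intro Z
    have h1 : HasFDerivAt (fun y => m (y, e)) ((fderiv ℝ m (e, e)).comp (.inl ℝ E E)) e :=
      HasFDerivAt.comp (f := fun y => (y, e)) e (hm.differentiableAt (by simp)).hasFDerivAt
        (hasFDerivAt_prodMk_left e e)
    have h2 : HasFDerivAt (fun y => m (y, e)) (ContinuousLinearMap.id ℝ E) e := by
      refine (hasFDerivAt_id e).congr_of_eventuallyEq ?_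
      filter_upwards [htar] with x hx
      simp only [hm_def, he1, mul_one, id]
      exact ψ.right_inv hx
    exact DFunLike.congr_fun (h1.unique h2) Z
  -- the derivative of the relation between left and right translations
  have key : ∀ X Y : E, B (X, 0) (0, Y) = B (0, X) (Y, 0) + A' X Y := by
    intro X Y
    have h1 : HasFDerivAt (fun x => fderiv ℝ m (x, e) (0, Y))
        ((B.comp (.inl ℝ E E)).flip (0, Y)) e := by
      simpa using hP.clm_apply (hasFDerivAt_const (0, Y) e)
    have h2 : HasFDerivAt (fun x => (lieAd I (ψ.symm x) Y, (0 : E)))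
        ((ContinuousLinearMap.inl ℝ E E).comp (A'.flip Y)) e := by
      have h3 : HasFDerivAt (fun x => lieAd I (ψ.symm x) Y) (A'.flip Y) e := by
        simpa using hA.clm_apply (hasFDerivAt_const Y e)
      exact (ContinuousLinearMap.inl ℝ E E).hasFDerivAt.comp e h3
    have h4 := hQ.clm_apply h2
    have h5 := (h1.congr_of_eventuallyEq (EventuallyEq.symm (hrel Y))).unique h4
    have h6 := DFunLike.congr_fun h5 X
    simp only [he1, lieAd_one] at h6
    simpa [hQe, add_comm] using h6
  -- left-invariant vector fields in the chart
  have hV : ∀ Z : GroupLieAlgebra I G, ∀ᶠ x in 𝓝 e,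
      VectorField.mpullbackWithin 𝓘(ℝ, E) I ψ.symm (mulInvariantVectorField Z) (range I) x
        = fderiv ℝ m (x, e) (0, Z) := by
    intro Z
    filter_upwards [hl, htar] with x h1 hxt
    rw [VectorField.mpullbackWithin_apply, ContinuousLinearMap.inverse_eq
      (mfderivWithin_extChartAt_symm_comp_mfderiv_extChartAt hxt)
      (mfderiv_extChartAt_comp_mfderivWithin_extChartAt_symm hxt)]
    exact (DFunLike.congr_fun h1 Z).symm
  have hVd : ∀ Z : E, HasFDerivAt (fun x => fderiv ℝ m (x, e) (0, Z))
      ((B.comp (.inl ℝ E E)).flip (0, Z)) e := fun Z => by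
    simpa using hP.clm_apply (hasFDerivAt_const (0, Z) e)
  have hPe : ∀ Z : E, fderiv ℝ m (e, e) (0, Z) = Z := by
    intro Z
    have := (hrel Z).self_of_nhds
    rw [he1, lieAd_one] at this
    rw [this]; exact hQe Z
  have hfin : ∀ X Y : E, A' X Y = VectorField.lieBracket ℝ
      (fun x => fderiv ℝ m (x, e) (0, X)) (fun x => fderiv ℝ m (x, e) (0, Y)) e := by
    intro X Y
    rw [VectorField.lieBracket, (hVd X).fderiv, (hVd Y).fderiv, hPe, hPe]
    have h9 := hsymm (Y, 0) (0, X)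
    rw [← hB] at h9
    simp only [ContinuousLinearMap.flip_apply, ContinuousLinearMap.comp_apply,
      ContinuousLinearMap.inl_apply]
    rw [key X Y, h9]
    abel
  rw [GroupLieAlgebra.bracket_def, VectorField.mlieBracket, VectorField.mlieBracketWithin_apply,
    mfderiv_extChartAt_self]
  have hinv : ∀ v : E, (ContinuousLinearMap.id ℝ E).inverse v = v := by simp
  refine Eq.trans ?_ (hinv _).symm
  have hset : (ψ.symm ⁻¹' univ ∩ range I) = univ := by
    rw [ModelWithCorners.Boundaryless.range_eq_univ]; simp
  change _ = VectorField.lieBracketWithin ℝ _ _ (ψ.symm ⁻¹' univ ∩ range I) e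
  rw [hset]
  have h7 := Filter.EventuallyEq.lieBracket_vectorField_eq (𝕜 := ℝ) (hV X) (hV Y)
  exact (hfin X Y).trans (h7.symm.trans (congrFun VectorField.lieBracketWithin_univ.symm e))

end AdjointDerivative

/-! ### The derivative of the coadjoint action -/

section CoadjointDerivative

open Filter Set
open scoped Topology

variable {E : Type*} [NormedAddCommGroup E] [NormedSpace ℝ E]
  {H : Type*} [TopologicalSpace H] {I : ModelWithCorners ℝ E H}
  {G : Type*} [TopologicalSpace G] [ChartedSpace H G] [Group G] [LieGroup I ∞ G]

theorem contMDiff_lieAd : ContMDiff I 𝓘(ℝ, E →L[ℝ] E) ∞ (lieAd I : G → E →L[ℝ] E) := by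
  intro g
  have h1 : ContMDiffAt I 𝓘(ℝ, E →L[ℝ] E) ∞ (lieAd I : G → E →L[ℝ] E) (g⁻¹ * g) := by
    rw [inv_mul_cancel]; exact contMDiffAt_lieAd_one
  have h2 : ContMDiffAt I 𝓘(ℝ, E →L[ℝ] E) ∞ (fun k : G => lieAd I (g⁻¹ * k)) g :=
    h1.comp g contMDiff_mul_left.contMDiffAt
  have h3 := (ContinuousLinearMap.compL ℝ E E E (lieAd I g)).contDiff (n := ∞)
    |>.contMDiff.contMDiffAt.comp g h2
  refine h3.congr_of_eventuallyEq (Eventually.of_forall fun k => ?_)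
  change lieAd I k = (lieAd I g).comp (lieAd I (g⁻¹ * k))
  rw [← lieAd_mul, mul_inv_cancel_left]

theorem contMDiff_coAd (ξ : E →L[ℝ] ℝ) :
    ContMDiff I 𝓘(ℝ, E →L[ℝ] ℝ) ∞ (fun g : G => coAd I g ξ) :=
  (ContinuousLinearMap.compL ℝ E E ℝ ξ).contDiff.contMDiff.comp
    (contMDiff_lieAd.comp (contMDiff_inv I ∞))

theorem lieAd_inv_comp (g : G) : (lieAd I g⁻¹).comp (lieAd I g) = ContinuousLinearMap.id ℝ E := by
  rw [← lieAd_mul, inv_mul_cancel, lieAd_one]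

theorem lieAd_comp_inv (g : G) : (lieAd I g).comp (lieAd I g⁻¹) = ContinuousLinearMap.id ℝ E := by
  rw [← lieAd_mul, mul_inv_cancel, lieAd_one]

theorem lieAd_inv_apply (g : G) (X : E) : lieAd I g⁻¹ (lieAd I g X) = X :=
  DFunLike.congr_fun (lieAd_inv_comp g) X

theorem coAd_inv_coAd (g : G) (ξ : E →L[ℝ] ℝ) : coAd I g⁻¹ (coAd I g ξ) = ξ := by
  rw [← coAd_mul, inv_mul_cancel, coAd_one]

variable (I G) in
/-- The infinitesimal coadjoint action `X ↦ -ξ ∘ ad X`: the derivative at `1` of the orbit map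
of `ξ`. -/
noncomputable def coadDeriv (ξ : E →L[ℝ] ℝ) :
    E →L[ℝ] E →L[ℝ] ℝ :=
  -(ContinuousLinearMap.compL ℝ E E ℝ ξ).comp (adDeriv I G)

omit [LieGroup I ∞ G] in
theorem coadDeriv_apply (ξ : E →L[ℝ] ℝ) (X Y : E) :
    coadDeriv I G ξ X Y = -ξ (adDeriv I G X Y) := rfl

/-- The image of an element of the Lie algebra under `Ad_g` acts by the conjugate operator. -/
theorem adDeriv_lieAd (g : G) (X Y : E) :
    adDeriv I G (lieAd I g X) Y = lieAd I g (adDeriv I G X (lieAd I g⁻¹ Y)) := by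
  have h1 : HasMFDerivAt I 𝓘(ℝ, E →L[ℝ] E) (lieAd I : G → E →L[ℝ] E) (g * 1 * g⁻¹)
      (adDeriv I G :) := by
    have h3 : g * 1 * g⁻¹ = 1 := by simp
    rw [h3]; exact hasMFDerivAt_lieAd_one
  have h2 := h1.comp (1 : G) (hasMFDerivAt_conj g)
  set C : (E →L[ℝ] E) →L[ℝ] (E →L[ℝ] E) :=
    (ContinuousLinearMap.compL ℝ E E E (lieAd I g)).comp
      ((ContinuousLinearMap.compL ℝ E E E).flip (lieAd I g⁻¹)) with hC
  have h4 : HasMFDerivAt I 𝓘(ℝ, E →L[ℝ] E) (C ∘ (lieAd I : G → E →L[ℝ] E)) 1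
      (C.comp (adDeriv I G) :) :=
    C.hasFDerivAt.hasMFDerivAt.comp (1 : G) hasMFDerivAt_lieAd_one
  have h5 : (lieAd I : G → E →L[ℝ] E) ∘ (fun h : G => g * h * g⁻¹)
      = C ∘ (lieAd I : G → E →L[ℝ] E) := by
    ext1 h
    simp only [Function.comp_apply, lieAd_mul, hC]
    rfl
  rw [h5] at h2
  have h6 : (adDeriv I G).comp (lieAd I g) = C.comp (adDeriv I G) := hasMFDerivAt_unique h2 h4
  exact DFunLike.congr_fun (DFunLike.congr_fun h6 X) Y

variable [I.Boundaryless]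

theorem isFundamentalVector_iff (ξ u : E →L[ℝ] ℝ) (X : E) :
    IsFundamentalVector I G ξ X u ↔ u = -coadDeriv I G ξ X := by
  constructor
  · intro h
    ext Z
    have : u Z = ξ (adDeriv I G X Z) := (h Z).trans (congrArg ξ (adDeriv_apply X Z).symm)
    simpa [coadDeriv_apply] using this
  · rintro rfl Z
    refine Eq.trans ?_ (congrArg ξ (adDeriv_apply X Z))
    exact neg_neg (ξ (adDeriv I G X Z))

/-- The vector tangent to the orbit that `coadDeriv` assigns to `X` is the value of the fundamental
field of `-X`; the two signs cancel in the two-form. -/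
theorem kksForm_coadDeriv (ξ : E →L[ℝ] ℝ) (X Y : E) :
    kksForm I G ξ (coadDeriv I G ξ X) (coadDeriv I G ξ Y) = ξ (adDeriv I G X Y) := by
  have hX : IsFundamentalVector I G ξ (-X : E) (coadDeriv I G ξ X) :=
    (isFundamentalVector_iff _ _ _).2 (by simp)
  have hY : IsFundamentalVector I G ξ (-Y : E) (coadDeriv I G ξ Y) :=
    (isFundamentalVector_iff _ _ _).2 (by simp)
  refine (kksForm_eq I G hX hY).trans ((congrArg ξ (adDeriv_apply (-X : E) (-Y : E)).symm).trans ?_)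
  simp

theorem hasMFDerivAt_coAd_one (ξ : E →L[ℝ] ℝ) :
    HasMFDerivAt I 𝓘(ℝ, E →L[ℝ] ℝ) (fun g : G => coAd I g ξ) 1 (coadDeriv I G ξ :) := by
  have : IsManifold I 1 G := IsManifold.of_le (n := ∞) (by simp)
  have h0 : MDifferentiableAt I 𝓘(ℝ, E →L[ℝ] ℝ) (fun g : G => coAd I g ξ) 1 :=
    (contMDiff_coAd ξ).mdifferentiableAt (by simp)
  set D : E →L[ℝ] E →L[ℝ] ℝ :=
    (mfderiv I 𝓘(ℝ, E →L[ℝ] ℝ) (fun g : G => coAd I g ξ) 1 :) with hD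
  have h1 : HasMFDerivAt I 𝓘(ℝ, E →L[ℝ] ℝ) (fun g : G => coAd I g ξ) 1 D := h0.hasMFDerivAt
  have h2 := h1.hasFDerivAt_comp_extChartAt_symm
  have h3 := (hasMFDerivAt_lieAd_one (I := I) (G := G)).hasFDerivAt_comp_extChartAt_symm
  -- differentiate `coAd g ξ ∘ Ad g = ξ`
  have h4 := h2.clm_comp h3
  have h5 : (fun y => ((fun g : G => coAd I g ξ) ∘ (extChartAt I (1 : G)).symm) y ∘L
      ((lieAd I : G → E →L[ℝ] E) ∘ (extChartAt I (1 : G)).symm) y) = fun _ => ξ := by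
    ext y Z
    simp [coAd_apply, lieAd_inv_apply]
  rw [h5] at h4
  have h6 := h4.unique (hasFDerivAt_const ξ _)
  have h7 : D = coadDeriv I G ξ := by
    ext X Y
    have h8 := DFunLike.congr_fun (DFunLike.congr_fun h6 X) Y
    simp [lieAd_one, coAd_one] at h8
    rw [coadDeriv_apply]
    linarith
  rw [← h7]
  exact h1

theorem hasStrictFDerivAt_coAd_extChartAt_symm (ξ : E →L[ℝ] ℝ) :
    HasStrictFDerivAt ((fun g : G => coAd I g ξ) ∘ (extChartAt I (1 : G)).symm)
      (coadDeriv I G ξ) (extChartAt I (1 : G) 1) := by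
  have : IsManifold I 1 G := IsManifold.of_le (n := ∞) (by simp)
  have h1 := (hasMFDerivAt_coAd_one (I := I) (G := G) ξ).hasFDerivAt_comp_extChartAt_symm
  have h2 : ContDiffAt ℝ ∞ ((fun g : G => coAd I g ξ) ∘ (extChartAt I (1 : G)).symm)
      (extChartAt I (1 : G) 1) := by
    rw [← contMDiffAt_iff_contDiffAt]
    exact ContMDiffAt.comp _ (contMDiff_coAd ξ).contMDiffAt
      ((contMDiffOn_extChartAt_symm (1 : G)).contMDiffAt (extChartAt_target_mem_nhds 1))
  exact h2.hasStrictFDerivAt' h1 (by simp)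

variable (I G) in
/-- The bilinear form `ξ [X, Y]` on the Lie algebra is nondegenerate; equivalently, the orbit map of
`ξ` is infinitesimally injective. -/
def NondegenerateAt (ξ : E →L[ℝ] ℝ) : Prop :=
  ∀ X : E, (∀ Y : E, ξ (adDeriv I G X Y) = 0) → X = 0

variable [FiniteDimensional ℝ E]

omit [LieGroup I ∞ G] [I.Boundaryless] in
theorem NondegenerateAt.exists_equiv {ξ : E →L[ℝ] ℝ} (h : NondegenerateAt I G ξ) :
    ∃ e : E ≃L[ℝ] (E →L[ℝ] ℝ), (e : E →L[ℝ] E →L[ℝ] ℝ) = coadDeriv I G ξ := by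
  have hinj : Function.Injective (coadDeriv I G ξ : E →ₗ[ℝ] E →L[ℝ] ℝ) := by
    rw [injective_iff_map_eq_zero]
    intro X hX
    refine h X fun Y => ?_
    have := DFunLike.congr_fun hX Y
    change coadDeriv I G ξ X Y = 0 at this
    rw [coadDeriv_apply] at this
    linarith
  have hdim : Module.finrank ℝ E = Module.finrank ℝ (E →L[ℝ] ℝ) := by
    rw [← (LinearMap.toContinuousLinearMap : (E →ₗ[ℝ] ℝ) ≃ₗ[ℝ] E →L[ℝ] ℝ).finrank_eq]
    exact (Subspace.dual_finrank_eq (K := ℝ) (V := E)).symm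
  refine ⟨(LinearEquiv.ofInjectiveOfFinrankEq _ hinj hdim).toContinuousLinearEquiv, ?_⟩
  ext X Y
  rfl

/-- The orbit map of a nondegenerate form is open at `1`, by the inverse function theorem. -/
theorem NondegenerateAt.map_nhds_one {ξ : E →L[ℝ] ℝ} (h : NondegenerateAt I G ξ) :
    map (fun g : G => coAd I g ξ) (𝓝 1) = 𝓝 ξ := by
  obtain ⟨e, he⟩ := h.exists_equiv
  have h1 := hasStrictFDerivAt_coAd_extChartAt_symm (I := I) (G := G) ξ
  rw [← he] at h1
  have h2 := h1.map_nhds_eq_of_equiv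
  rw [← map_extChartAt_nhds_of_boundaryless, Filter.map_map] at h2
  simp only [Function.comp_apply, extChartAt_to_inv, coAd_one] at h2
  rw [← h2]
  refine Filter.map_congr ?_
  filter_upwards [extChartAt_source_mem_nhds (I := I) (1 : G)] with g hg
  simp only [Function.comp_apply, (extChartAt I (1 : G)).left_inv hg]

/-- A nondegenerate form has a discrete stabilizer. -/
theorem NondegenerateAt.eventually_eq_one {ξ : E →L[ℝ] ℝ} (h : NondegenerateAt I G ξ) :
    ∀ᶠ g : G in 𝓝 1, coAd I g ξ = ξ → g = 1 := by
  obtain ⟨e, he⟩ := h.exists_equiv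
  have h1 := hasStrictFDerivAt_coAd_extChartAt_symm (I := I) (G := G) ξ
  rw [← he] at h1
  set Φ := h1.toOpenPartialHomeomorph with hΦ
  have hs : Φ.source ∈ 𝓝 (extChartAt I (1 : G) 1) :=
    Φ.open_source.mem_nhds h1.mem_toOpenPartialHomeomorph_source
  filter_upwards [extChartAt_source_mem_nhds (I := I) (1 : G),
    (continuousAt_extChartAt (I := I) (1 : G)) hs] with g hg hgs hgξ
  have h2 : extChartAt I (1 : G) g = extChartAt I (1 : G) 1 := by
    refine Φ.injOn hgs h1.mem_toOpenPartialHomeomorph_source ?_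
    simp only [hΦ, HasStrictFDerivAt.toOpenPartialHomeomorph_coe, Function.comp_apply,
      extChartAt_to_inv, (extChartAt I (1 : G)).left_inv hg, hgξ, coAd_one]
  exact (extChartAt I (1 : G)).injOn hg (mem_extChartAt_source 1) h2

theorem NondegenerateAt.isOpenMap {ξ : E →L[ℝ] ℝ} (h : NondegenerateAt I G ξ) :
    IsOpenMap (fun g : G => coAd I g ξ) := by
  have : IsTopologicalGroup G := topologicalGroup_of_lieGroup I ∞
  rw [isOpenMap_iff_nhds_le]
  intro g
  have hc : Continuous fun η : E →L[ℝ] ℝ => coAd I g⁻¹ η :=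
    (ContinuousLinearMap.compL ℝ E E ℝ).flip (lieAd I g⁻¹⁻¹) |>.continuous
  -- translate the statement at `1` by `g`
  intro s hs
  have h1 : (fun k : G => g * k) ⁻¹' ((fun g : G => coAd I g ξ) ⁻¹' s) ∈ 𝓝 (1 : G) :=
    (continuous_const_mul g).continuousAt.preimage_mem_nhds (by simpa using hs)
  have h2 : (fun η => coAd I g η) ⁻¹' s ∈ 𝓝 ξ := by
    rw [← h.map_nhds_one]
    simpa [Filter.mem_map, preimage_preimage, coAd_mul] using h1
  have h3 := hc.continuousAt.preimage_mem_nhds (x := coAd I g ξ)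
    (by rw [coAd_inv_coAd]; exact h2)
  refine Filter.mem_of_superset h3 fun η hη => ?_
  have : coAd I g (coAd I g⁻¹ η) = η := by
    rw [← coAd_mul, mul_inv_cancel, coAd_one]
  simpa [this] using hη

theorem NondegenerateAt.isOpen_coadjointOrbit {ξ : E →L[ℝ] ℝ} (h : NondegenerateAt I G ξ) :
    IsOpen (coadjointOrbit I G ξ) :=
  h.isOpenMap.isOpen_range

end CoadjointDerivative

/-! ### Invariant subspaces of a connected group -/

section InvariantSubspace

open Filter Set
open scoped Topology

variable {E : Type*} [NormedAddCommGroup E] [NormedSpace ℝ E] [FiniteDimensional ℝ E]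
  {H : Type*} [TopologicalSpace H] {I : ModelWithCorners ℝ E H}
  {G : Type*} [TopologicalSpace G] [ChartedSpace H G] [Group G] [LieGroup I ∞ G]

omit [FiniteDimensional ℝ E] in
/-- A closed subspace that is invariant under the group is invariant under its Lie algebra. -/
theorem adDeriv_mem_of_forall_lieAd_mem {N : Submodule ℝ E} (hcl : IsClosed (N : Set E))
    (hN : ∀ g : G, ∀ w ∈ N, lieAd I g w ∈ N) (X : E) {w : E} (hw : w ∈ N) :
    adDeriv I G X w ∈ N := by
  by_contra hX
  obtain ⟨ℓ, u, hlt, hgt⟩ := geometric_hahn_banach_closed_point N.convex hcl hX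
  have hℓ : ∀ v ∈ N, ℓ v = 0 := by
    intro v hv
    by_contra hne
    have := hlt (((u + 1) / ℓ v) • v) (N.smul_mem _ hv)
    rw [map_smul, smul_eq_mul, div_mul_cancel₀ _ hne] at this
    linarith
  have hu : 0 < u := by simpa using hlt 0 N.zero_mem
  set T : (E →L[ℝ] E) →L[ℝ] ℝ := ℓ.comp ((ContinuousLinearMap.apply ℝ E) w) with hT
  have h1 : HasMFDerivAt I 𝓘(ℝ, ℝ) (T ∘ (lieAd I : G → E →L[ℝ] E)) 1 (T.comp (adDeriv I G) :) :=
    T.hasFDerivAt.hasMFDerivAt.comp (1 : G) hasMFDerivAt_lieAd_one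
  have h2 : T ∘ (lieAd I : G → E →L[ℝ] E) = fun _ => (0 : ℝ) := by
    ext g
    exact hℓ _ (hN g w hw)
  rw [h2] at h1
  have h3 : T.comp (adDeriv I G) = 0 := hasMFDerivAt_unique h1 (hasMFDerivAt_const _ _)
  have h4 : ℓ (adDeriv I G X w) = 0 := DFunLike.congr_fun h3 X
  linarith

omit [FiniteDimensional ℝ E] in
/-- The derivative of the adjoint representation at a point, by left translation. -/
theorem exists_hasFDerivAt_lieAd_extChartAt_symm [I.Boundaryless] {y : E}
    (hy : y ∈ (extChartAt I (1 : G)).target) :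
    ∃ Θ : E →L[ℝ] E, HasFDerivAt ((lieAd I : G → E →L[ℝ] E) ∘ (extChartAt I (1 : G)).symm)
      ((ContinuousLinearMap.compL ℝ E E E (lieAd I ((extChartAt I (1 : G)).symm y))).comp
        ((adDeriv I G).comp Θ)) y := by
  have : IsManifold I 1 G := IsManifold.of_le (n := ∞) (by simp)
  set g : G := (extChartAt I (1 : G)).symm y with hg
  set C : (E →L[ℝ] E) →L[ℝ] (E →L[ℝ] E) := ContinuousLinearMap.compL ℝ E E E (lieAd I g) with hC
  have h1 : HasMFDerivAt I 𝓘(ℝ, E →L[ℝ] E) (lieAd I : G → E →L[ℝ] E) (g⁻¹ * g)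
      (adDeriv I G :) := by
    rw [inv_mul_cancel]; exact hasMFDerivAt_lieAd_one
  have h2 := h1.comp g (mdifferentiableAt_mul_left' (I := I) g⁻¹ g).hasMFDerivAt
  have h3 := C.hasFDerivAt.hasMFDerivAt.comp g h2
  have h4 : C ∘ ((lieAd I : G → E →L[ℝ] E) ∘ fun h => g⁻¹ * h) = lieAd I := by
    ext1 k
    change (lieAd I g).comp (lieAd I (g⁻¹ * k)) = _
    rw [← lieAd_mul, mul_inv_cancel_left]
  rw [h4] at h3
  have h5 : MDifferentiableAt 𝓘(ℝ, E) I (extChartAt I (1 : G)).symm y := by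
    have := mdifferentiableWithinAt_extChartAt_symm hy
    rwa [ModelWithCorners.Boundaryless.range_eq_univ, mdifferentiableWithinAt_univ] at this
  have h6 := h3.comp y h5.hasMFDerivAt
  refine ⟨(show E →L[ℝ] E from mfderiv I I (fun h => g⁻¹ * h) g).comp
    (show E →L[ℝ] E from mfderiv 𝓘(ℝ, E) I (extChartAt I (1 : G)).symm y), ?_⟩
  exact hasMFDerivAt_iff_hasFDerivAt.1 h6

/-- If `T' = T ∘ D` and `D` preserves `N`, then `T` preserves `N` at time `1` when it does at time
`0`: with a projection `p` onto `N`, the operator `(1 - p) ∘ T ∘ p` solves a homogeneous linear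
differential equation. -/
theorem mem_of_hasDerivAt_comp {N : Submodule ℝ E} {T D : ℝ → E →L[ℝ] E} {K : ℝ}
    (hT : ∀ t ∈ Icc (0 : ℝ) 1, HasDerivAt T ((T t).comp (D t)) t)
    (hD : ∀ t ∈ Icc (0 : ℝ) 1, ∀ w ∈ N, D t w ∈ N) (hK : ∀ t ∈ Icc (0 : ℝ) 1, ‖D t‖ ≤ K)
    (h0 : ∀ w ∈ N, T 0 w ∈ N) {w : E} (hw : w ∈ N) : T 1 w ∈ N := by
  obtain ⟨f, hf⟩ := Submodule.ClosedComplemented.of_finiteDimensional N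
  set p : E →L[ℝ] E := N.subtypeL.comp f with hp
  set q : E →L[ℝ] E := ContinuousLinearMap.id ℝ E - p with hq
  have hpN : ∀ w ∈ N, p w = w := fun w hw => by
    simp [hp, hf ⟨w, hw⟩]
  have hqN : ∀ w, q w = 0 ↔ w ∈ N := by
    intro w
    constructor
    · intro h
      have h1 : w = p w := by simpa [hq, sub_eq_zero] using h
      rw [h1]
      exact (f w).2
    · intro h
      simp [hq, hpN w h]
  set C : (E →L[ℝ] E) →L[ℝ] (E →L[ℝ] E) :=
    (ContinuousLinearMap.compL ℝ E E E q).comp ((ContinuousLinearMap.compL ℝ E E E).flip p) with hC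
  have hCa : ∀ S, C S = q.comp (S.comp p) := fun S => rfl
  have hF : ∀ t ∈ Icc (0 : ℝ) 1, HasDerivAt (fun t => C (T t)) (C ((T t).comp (D t))) t :=
    fun t ht => C.hasFDerivAt.comp_hasDerivAt t (hT t ht)
  have hb : ∀ t ∈ Icc (0 : ℝ) 1, ‖C ((T t).comp (D t))‖ ≤ (K * ‖p‖) * ‖C (T t)‖ := by
    intro t ht
    have h1 : C ((T t).comp (D t)) = (C (T t)).comp ((D t).comp p) := by
      ext w
      simp only [hCa, ContinuousLinearMap.comp_apply]
      rw [hpN (D t (p w)) (hD t ht _ (f w).2)]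
    rw [h1, mul_comm]
    refine (ContinuousLinearMap.opNorm_comp_le _ _).trans ?_
    refine mul_le_mul_of_nonneg_left ?_ (norm_nonneg _)
    exact (ContinuousLinearMap.opNorm_comp_le _ _).trans
      (mul_le_mul_of_nonneg_right (hK t ht) (norm_nonneg _))
  have hC0 : C (T 0) = 0 := by
    ext w
    exact (hqN _).2 (h0 _ (f w).2)
  have h1 := eq_zero_of_abs_deriv_le_mul_abs_self_of_eq_zero_right
    (fun t ht => (hF t ht).continuousAt.continuousWithinAt)
    (fun t ht => (hF t (Ico_subset_Icc_self ht)).hasDerivWithinAt) hC0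
    (fun t ht => hb t (Ico_subset_Icc_self ht)) 1 (by simp)
  have h2 := DFunLike.congr_fun h1 w
  simp only [hCa, ContinuousLinearMap.comp_apply, hpN w hw] at h2
  exact (hqN _).1 h2

/-- Near `1`, a subspace that is invariant under `ad` is invariant under `Ad`: along a segment in
the chart, `Ad` solves a differential equation of the form `T' = T ∘ ad θ`. -/
theorem eventually_lieAd_mem_of_forall_adDeriv_mem [I.Boundaryless] {N : Submodule ℝ E}
    (hN : ∀ X : E, ∀ w ∈ N, adDeriv I G X w ∈ N) :
    ∀ᶠ g : G in 𝓝 1, ∀ w ∈ N, lieAd I g w ∈ N := by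
  set ψ := extChartAt I (1 : G) with hψ
  set A : E → E →L[ℝ] E := (lieAd I : G → E →L[ℝ] E) ∘ ψ.symm with hA_def
  obtain ⟨r, hr, hball⟩ := Metric.mem_nhds_iff.1 (extChartAt_target_mem_nhds (I := I) (1 : G))
  have hA : ContDiffOn ℝ ∞ A (Metric.ball (ψ 1) r) := by
    rw [← contMDiffOn_iff_contDiffOn]
    exact contMDiff_lieAd.comp_contMDiffOn ((contMDiffOn_extChartAt_symm (1 : G)).mono hball)
  have hAi : ContinuousOn (fun y => lieAd I (ψ.symm y)⁻¹) (Metric.ball (ψ 1) r) := by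
    have := ((contMDiff_lieAd (I := I) (G := G)).comp
      (contMDiff_inv I ∞)).continuous.comp_continuousOn
      ((continuousOn_extChartAt_symm (I := I) (1 : G)).mono hball)
    exact this
  have hA' : ContinuousOn (fderiv ℝ A) (Metric.ball (ψ 1) r) :=
    hA.continuousOn_fderiv_of_isOpen Metric.isOpen_ball (by simp)
  have hnhds : ∀ᶠ g : G in 𝓝 1, ψ g ∈ Metric.ball (ψ 1) r :=
    (continuousAt_extChartAt (I := I) (1 : G)).eventually_mem (Metric.ball_mem_nhds _ hr)
  filter_upwards [hnhds, extChartAt_source_mem_nhds (I := I) (1 : G)] with g hg hgs w hw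
  set c : ℝ → E := fun t => ψ 1 + t • (ψ g - ψ 1) with hc
  have hcball : ∀ t ∈ Icc (0 : ℝ) 1, c t ∈ Metric.ball (ψ 1) r := fun t ht =>
    (convex_ball (ψ 1) r).add_smul_sub_mem (Metric.mem_ball_self hr) hg ht
  have hcd : ∀ t, HasDerivAt c (ψ g - ψ 1) t := by
    intro t
    simpa [hc] using ((hasDerivAt_id t).smul_const (ψ g - ψ 1)).const_add (ψ 1)
  have hcc : Continuous c := by fun_prop
  set D : ℝ → E →L[ℝ] E := fun t => (lieAd I (ψ.symm (c t))⁻¹).comp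
    (fderiv ℝ A (c t) (ψ g - ψ 1)) with hD
  have hcont : ContinuousOn D (Icc 0 1) :=
    (hAi.comp hcc.continuousOn hcball).clm_comp
      ((hA'.comp hcc.continuousOn hcball).clm_apply continuousOn_const)
  obtain ⟨K, hK⟩ := isCompact_Icc.exists_bound_of_continuousOn hcont
  have hDad : ∀ t ∈ Icc (0 : ℝ) 1, ∃ X, D t = adDeriv I G X := by
    intro t ht
    obtain ⟨Θ, hΘ⟩ := exists_hasFDerivAt_lieAd_extChartAt_symm (hball (hcball t ht))
    refine ⟨Θ (ψ g - ψ 1), ?_⟩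
    simp only [hD, hA_def, hψ, hΘ.fderiv]
    change (lieAd I (ψ.symm (c t))⁻¹).comp
      ((lieAd I (ψ.symm (c t))).comp (adDeriv I G (Θ (ψ g - ψ 1)))) = _
    rw [← ContinuousLinearMap.comp_assoc, lieAd_inv_comp, ContinuousLinearMap.id_comp]
  have hT : ∀ t ∈ Icc (0 : ℝ) 1, HasDerivAt (fun t => A (c t)) ((A (c t)).comp (D t)) t := by
    intro t ht
    have h1 : DifferentiableAt ℝ A (c t) :=
      (hA.contDiffAt (Metric.isOpen_ball.mem_nhds (hcball t ht))).differentiableAt (by simp)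
    have h2 := h1.hasFDerivAt.comp_hasDerivAt t (hcd t)
    have h3 : (A (c t)).comp (D t) = fderiv ℝ A (c t) (ψ g - ψ 1) := by
      simp only [hD, hA_def, Function.comp_apply]
      rw [← ContinuousLinearMap.comp_assoc, lieAd_comp_inv, ContinuousLinearMap.id_comp]
    rw [h3]
    exact h2
  have h1 := mem_of_hasDerivAt_comp (N := N) hT (fun t ht w hw => by
    obtain ⟨X, hX⟩ := hDad t ht
    rw [hX]
    exact hN X w hw) hK (fun w hw => by
      simp only [hA_def, hc, zero_smul, add_zero, Function.comp_apply]
      rw [hψ, extChartAt_to_inv, lieAd_one]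
      exact hw) hw
  simp only [hA_def, hc, one_smul, add_sub_cancel, Function.comp_apply] at h1
  rwa [hψ, (extChartAt I (1 : G)).left_inv hgs] at h1

/-- A subspace that is invariant under the Lie algebra is invariant under the connected group: the
elements that preserve it form an open subgroup. -/
theorem lieAd_mem_of_forall_adDeriv_mem [I.Boundaryless] [PreconnectedSpace G]
    {N : Submodule ℝ E} (hN : ∀ X : E, ∀ w ∈ N, adDeriv I G X w ∈ N) (g : G) {w : E}
    (hw : w ∈ N) : lieAd I g w ∈ N := by
  have : IsTopologicalGroup G := topologicalGroup_of_lieGroup I ∞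
  let S : Subgroup G :=
    { carrier := {g | ∀ w ∈ N, lieAd I g w ∈ N ∧ lieAd I g⁻¹ w ∈ N}
      one_mem' := by
        intro w hw
        simpa [lieAd_one] using hw
      mul_mem' := by
        intro a b ha hb w hw
        rw [mul_inv_rev, lieAd_mul, lieAd_mul]
        exact ⟨(ha _ (hb w hw).1).1, (hb _ (ha w hw).2).2⟩
      inv_mem' := by
        intro a ha w hw
        rw [inv_inv]
        exact (ha w hw).symm }
  have h1 := eventually_lieAd_mem_of_forall_adDeriv_mem hN
  have h2 : ∀ᶠ g : G in 𝓝 1, ∀ w ∈ N, lieAd I g⁻¹ w ∈ N := by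
    have : Tendsto (fun g : G => g⁻¹) (𝓝 1) (𝓝 1) := by
      simpa using (continuous_inv (G := G)).tendsto 1
    exact this.eventually h1
  have hS : IsOpen (S : Set G) := S.isOpen_of_mem_nhds (g := 1) (by
    filter_upwards [h1, h2] with g hg hg' w hw using ⟨hg w hw, hg' w hw⟩)
  have hu := IsClopen.eq_univ ⟨S.isClosed_of_isOpen hS, hS⟩ ⟨1, S.one_mem⟩
  have hg : g ∈ (S : Set G) := hu ▸ mem_univ g
  exact (hg w hw).1

end InvariantSubspace

/-! ### Split solvable Lie algebras -/

section SplitSolvable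

open Polynomial

theorem Module.End.iSup_maxGenEigenspace_eq_top_of_splits {K V : Type*} [Field K] [AddCommGroup V]
    [Module K V] [FiniteDimensional K V] (f : Module.End K V) (hf : f.charpoly.Splits) :
    ⨆ μ, f.maxGenEigenspace μ = ⊤ := by
  classical
  have key : ∀ s : Finset K, ∀ n : K → ℕ,
      LinearMap.ker (aeval f (∏ a ∈ s, (X - C a) ^ n a)) ≤ ⨆ μ, f.maxGenEigenspace μ := by
    intro s n
    induction s using Finset.induction_on with
    | empty =>
      intro v hv
      have hv0 : v = 0 := by simpa using hv
      simp [hv0]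
    | insert a s ha ih =>
      rw [Finset.prod_insert ha, ← sup_ker_aeval_eq_ker_aeval_mul_of_coprime]
      · refine sup_le ?_ ih
        refine le_trans ?_ (le_iSup _ a)
        intro v hv
        rw [Module.End.mem_maxGenEigenspace]
        refine ⟨n a, ?_⟩
        simpa [Algebra.algebraMap_eq_smul_one] using hv
      · refine IsCoprime.prod_right fun b hb => IsCoprime.pow ?_
        exact isCoprime_X_sub_C_of_isUnit_sub
          (sub_ne_zero.2 (by rintro rfl; exact ha hb)).isUnit
  have h1 : f.charpoly = ∏ a ∈ f.charpoly.roots.toFinset, (X - C a) ^ f.charpoly.roots.count a := by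
    conv_lhs => rw [hf.eq_prod_roots_of_monic f.charpoly_monic]
    rw [Finset.prod_multiset_map_count]
  have h2 := key f.charpoly.roots.toFinset fun a => f.charpoly.roots.count a
  rw [← h1, LinearMap.aeval_self_charpoly] at h2
  simpa using h2

/-- Lie's theorem on the quotient by a proper ideal of a split solvable Lie algebra. -/
theorem LieIdeal.exists_notMem_forall_lie_sub_smul_mem {L : Type*} [LieRing L] [LieAlgebra ℝ L]
    [Module.Finite ℝ L] [LieAlgebra.IsSolvable L]
    (hs : ∀ X : L, (LieAlgebra.ad ℝ L X).charpoly.Splits) (N : LieIdeal ℝ L) (hN : N ≠ ⊤) :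
    ∃ v ∉ N, ∀ X : L, ∃ c : ℝ, ⁅X, v⁆ - c • v ∈ N := by
  have : Nontrivial (L ⧸ N) := by
    have h := (Submodule.Quotient.nontrivial_iff (p := N.toSubmodule)).2 (by
      rwa [Ne, LieSubmodule.toSubmodule_eq_top])
    exact h
  have : Module.Finite ℝ (L ⧸ N) := inferInstanceAs (Module.Finite ℝ (L ⧸ N.toSubmodule))
  have : LieModule.IsTriangularizable ℝ L (L ⧸ N) := by
    refine ⟨fun X => ?_⟩
    have h1 := Module.End.iSup_maxGenEigenspace_eq_top_of_splits _ (hs X)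
    rw [eq_top_iff]
    intro w _
    obtain ⟨u, rfl⟩ := LieSubmodule.Quotient.surjective_mk' N w
    have h2 : (⊤ : Submodule ℝ L) ≤ (⨆ φ, Module.End.maxGenEigenspace
        (LieModule.toEnd ℝ L (L ⧸ N) X) φ).comap (LieSubmodule.Quotient.mk' N : L →ₗ[ℝ] L ⧸ N) := by
      rw [← h1]
      refine iSup_le fun φ v hv => ?_
      rw [Module.End.mem_maxGenEigenspace] at hv
      obtain ⟨k, hk⟩ := hv
      refine Submodule.mem_iSup_of_mem φ ?_
      rw [Module.End.mem_maxGenEigenspace]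
      refine ⟨k, ?_⟩
      have h3 : ∀ v : L, ((LieModule.toEnd ℝ L (L ⧸ N) X - φ • 1) ^ k)
          ((LieSubmodule.Quotient.mk' N : L →ₗ[ℝ] L ⧸ N) v)
          = (LieSubmodule.Quotient.mk' N : L →ₗ[ℝ] L ⧸ N)
            (((LieAlgebra.ad ℝ L X - φ • 1) ^ k) v) := by
        clear hk
        induction k with
        | zero => intro v; rfl
        | succ k ih =>
          intro v
          rw [pow_succ, pow_succ, Module.End.mul_apply, Module.End.mul_apply, ← ih]
          congr 1
      rw [h3, hk, map_zero]
    exact h2 (Submodule.mem_top (x := u))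
  obtain ⟨χ, hχ⟩ := LieModule.exists_nontrivial_weightSpace_of_isSolvable ℝ L (L ⧸ N)
  obtain ⟨⟨w, hw⟩, hw0⟩ := exists_ne (0 : LieModule.weightSpace (L ⧸ N) χ)
  obtain ⟨v, rfl⟩ := LieSubmodule.Quotient.surjective_mk' N w
  rw [LieModule.mem_weightSpace] at hw
  refine ⟨v, fun hv => hw0 ?_, fun X => ⟨χ X, ?_⟩⟩
  · ext
    exact (LieSubmodule.Quotient.mk_eq_zero' ).2 hv
  · have h4 := hw X
    rw [← LieSubmodule.Quotient.mk_eq_zero']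
    have h5 : (LieSubmodule.Quotient.mk (⁅X, v⁆ - χ X • v) : L ⧸ N)
      = ⁅X, (LieSubmodule.Quotient.mk' N v : L ⧸ N)⁆ - χ X • (LieSubmodule.Quotient.mk' N v) := rfl
    rw [h5, h4, sub_self]

end SplitSolvable

/-! ### Open orbits of triangular groups are contractible -/

section TriangularOrbit

open Filter Set
open scoped Topology

/-- An open subset of the line on which increasing affine bijections act transitively is convex: its
components are permuted transitively, an increasing affine map preserving a bounded component fixes
its end points, hence is the identity, and no increasing map exchanges two unbounded components. -/
theorem Real.convex_of_affine_transitive {U : Set ℝ} (hU : IsOpen U)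
    (h : ∀ s ∈ U, ∀ t ∈ U, ∃ c d : ℝ, 0 < c ∧ c * s + d = t ∧ ∀ u, c * u + d ∈ U ↔ u ∈ U) :
    Convex ℝ U := by
  have hoc : U.OrdConnected := by
    refine ⟨fun s hs t ht r hr => ?_⟩
    by_contra hrU
    have hsr : s < r := lt_of_le_of_ne hr.1 (by rintro rfl; exact hrU hs)
    have hrt : r < t := lt_of_le_of_ne hr.2 (by rintro rfl; exact hrU ht)
    -- `q` is the right end of the component of `s`
    obtain ⟨q, hq, hsq, hqr, hqU⟩ : ∃ q, q ∉ U ∧ s < q ∧ q ≤ r ∧ ∀ x, s ≤ x → x < q → x ∈ U := by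
      have hcl : IsClosed (Ici s ∩ Uᶜ) := isClosed_Ici.inter hU.isClosed_compl
      have hbd : BddBelow (Ici s ∩ Uᶜ) := ⟨s, fun x hx => hx.1⟩
      have hm := hcl.csInf_mem ⟨r, hsr.le, hrU⟩ hbd
      refine ⟨sInf (Ici s ∩ Uᶜ), hm.2, lt_of_le_of_ne hm.1 fun h => hm.2 (h ▸ hs),
        csInf_le hbd ⟨hsr.le, hrU⟩, fun x hx hxq => ?_⟩
      by_contra hxU
      exact absurd (csInf_le hbd ⟨hx, hxU⟩) (not_le.2 hxq)
    by_cases hB : ∃ p' < s, p' ∉ U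
    · obtain ⟨p', hp's, hp'U⟩ := hB
      obtain ⟨p, hp, hps, hpU⟩ : ∃ p, p ∉ U ∧ p < s ∧ ∀ x, p < x → x ≤ s → x ∈ U := by
        have hcl : IsClosed (Iic s ∩ Uᶜ) := isClosed_Iic.inter hU.isClosed_compl
        have hbd : BddAbove (Iic s ∩ Uᶜ) := ⟨s, fun x hx => hx.1⟩
        have hm := hcl.csSup_mem ⟨p', hp's.le, hp'U⟩ hbd
        refine ⟨sSup (Iic s ∩ Uᶜ), hm.2, lt_of_le_of_ne hm.1 fun h => hm.2 (h.symm ▸ hs),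
          fun x hx hxq => ?_⟩
        by_contra hxU
        exact absurd (le_csSup hbd ⟨hxq, hxU⟩) (not_le.2 hx)
      have hpq : ∀ x, p < x → x < q → x ∈ U := fun x h1 h2 =>
        (le_total x s).elim (hpU x h1) fun h3 => hqU x h3 h2
      obtain ⟨c, d, hc, hcs, hcU⟩ := h s hs ((s + q) / 2) (hqU _ (by linarith) (by linarith))
      have hinv : ∀ x, c * ((x - d) / c) + d = x := fun x => by field_simp; ring
      have h1 : q ≤ c * q + d := by
        by_contra hlt
        push Not at hlt
        exact hq ((hcU q).1 (hpq _ (by nlinarith) hlt))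
      have h2 : q ≤ (q - d) / c := by
        by_contra hlt
        push Not at hlt
        have h3 : s < (q - d) / c := by rw [lt_div_iff₀ hc]; linarith
        have h4 := (hcU _).2 (hpq _ (by linarith) hlt)
        rw [hinv] at h4
        exact hq h4
      have h3 : c * p + d ≤ p := by
        by_contra hlt
        push Not at hlt
        exact hp ((hcU p).1 (hpq _ hlt (by nlinarith)))
      have h4 : (p - d) / c ≤ p := by
        by_contra hlt
        push Not at hlt
        have h3 : (p - d) / c < s := by rw [div_lt_iff₀ hc]; linarith
        have h4 := (hcU _).2 (hpq _ hlt (by linarith))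
        rw [hinv] at h4
        exact hp h4
      rw [le_div_iff₀ hc] at h2
      rw [div_le_iff₀ hc] at h4
      have h5 : (c - 1) * (q - p) = 0 := by linarith
      rcases mul_eq_zero.1 h5 with h6 | h6
      · have h7 : c = 1 := by linarith
        subst h7
        linarith
      · linarith
    · push Not at hB
      obtain ⟨c, d, hc, hcs, hcU⟩ := h s hs t ht
      have h1 : (q - d) / c < s := by rw [div_lt_iff₀ hc]; linarith
      have h2 := (hcU _).2 (hB _ h1)
      rw [show c * ((q - d) / c) + d = q by field_simp; ring] at h2
      exact hq h2
  exact hoc.convex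

/-- An open set whose fibres under a linear projection are convex is contractible if its image
is: a partition of unity provides a section, and the fibres retract onto it. -/
theorem contractibleSpace_of_image_of_convex_fibers {F F' : Type*} [NormedAddCommGroup F]
    [NormedSpace ℝ F] [NormedAddCommGroup F'] [NormedSpace ℝ F'] {A : Set F} (hA : IsOpen A)
    (p : F →L[ℝ] F') (e : F' →L[ℝ] F) (he : ∀ x, p (e x) = x)
    (hconv : ∀ x, Convex ℝ (A ∩ p ⁻¹' {x})) (hc : ContractibleSpace (p '' A)) :
    ContractibleSpace A := by
  obtain ⟨k, hk⟩ := exists_continuous_forall_mem_convex_of_local_const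
    (X := p '' A) (E := F) (t := fun x => {k | e x + k ∈ A ∧ p k = 0})
    (fun x k₁ h₁ k₂ h₂ a b ha hb hab => by
      have h3 := hconv x ⟨h₁.1, by simp [he, h₁.2]⟩ ⟨h₂.1, by simp [he, h₂.2]⟩ ha hb hab
      refine ⟨?_, by simp [h₁.2, h₂.2]⟩
      have h4 : a • (e (x : F') + k₁) + b • (e (x : F') + k₂) = e x + (a • k₁ + b • k₂) := by
        rw [smul_add, smul_add, add_add_add_comm, ← add_smul, hab, one_smul]
      exact h4 ▸ h3.1)
    (fun x => by
      obtain ⟨y, hy, hyx⟩ := x.2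
      refine ⟨y - e x, ?_⟩
      have hcont : Continuous fun z : p '' A => e (z : F') + (y - e x) := by fun_prop
      filter_upwards [hcont.continuousAt.eventually_mem (hA.mem_nhds (by simpa using hy))] with z hz
      exact ⟨hz, by simp [he, hyx]⟩)
  let toF : C(A, p '' A) := ⟨fun y => ⟨p y, mem_image_of_mem p y.2⟩, by fun_prop⟩
  let invF : C(p '' A, A) := ⟨fun x => ⟨e x + k x, (hk x).1⟩, by fun_prop⟩
  have hmem : ∀ (t : unitInterval) (y : A),
      (1 - (t : ℝ)) • (e (p y) + k (toF y)) + (t : ℝ) • (y : F) ∈ A := by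
    intro t y
    refine (hconv (p y) ⟨(hk (toF y)).1, ?_⟩ ⟨y.2, rfl⟩ (sub_nonneg.2 t.2.2) t.2.1
      (sub_add_cancel _ _)).1
    change p (e (p y) + k (toF y)) = p y
    simp [he, (hk (toF y)).2]
  let eqv : ContinuousMap.HomotopyEquiv A (p '' A) :=
    { toFun := toF
      invFun := invF
      left_inv := ⟨{
        toFun := fun q => ⟨_, hmem q.1 q.2⟩
        continuous_toFun := by fun_prop
        map_zero_left := fun y => by
          ext1
          simp [toF, invF]
        map_one_left := fun y => by
          ext1
          simp }⟩
      right_inv := by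
        have h1 : toF.comp invF = ContinuousMap.id _ := by
          ext x
          change p (e x + k x) = x
          simp [he, (hk x).2]
        rw [h1] }
  exact eqv.contractibleSpace

variable {E : Type*} [NormedAddCommGroup E] [NormedSpace ℝ E] [FiniteDimensional ℝ E]

/-- Restriction of linear forms to a subspace. -/
noncomputable def restrictForm (N : Submodule ℝ E) : (E →L[ℝ] ℝ) →L[ℝ] (N →L[ℝ] ℝ) :=
  (ContinuousLinearMap.compL ℝ N E ℝ).flip N.subtypeL

omit [FiniteDimensional ℝ E] in
theorem restrictForm_apply (N : Submodule ℝ E) (ξ : E →L[ℝ] ℝ) (w : N) :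
    restrictForm N ξ w = ξ w := rfl

theorem exists_rightInverse_restrictForm (N : Submodule ℝ E) :
    ∃ e : (N →L[ℝ] ℝ) →L[ℝ] (E →L[ℝ] ℝ), ∀ η, restrictForm N (e η) = η := by
  obtain ⟨f, hf⟩ := Submodule.ClosedComplemented.of_finiteDimensional N
  refine ⟨(ContinuousLinearMap.compL ℝ E N ℝ).flip f, fun η => ?_⟩
  ext w
  change η (f w) = η w
  rw [hf]

theorem isOpenMap_restrictForm (N : Submodule ℝ E) : IsOpenMap (restrictForm N) := by
  obtain ⟨e, he⟩ := exists_rightInverse_restrictForm N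
  refine IsOpenMap.of_sections fun ξ => ⟨fun η => ξ + e (η - restrictForm N ξ), ?_, ?_, fun η => ?_⟩
  · fun_prop
  · simp
  · rw [map_add, he, add_sub_cancel]

/-- The fibres of the restriction to `N ⊂ N'` are convex on the restrictions to `N'` of an open
orbit, if the group acts on `N' / N` by positive scalars. -/
theorem convex_fiber_of_orbit {Γ : Type*} [Group Γ] {τ : Γ →* (E →L[ℝ] E)} {O : Set (E →L[ℝ] ℝ)}
    (hO : IsOpen O) (hinv : ∀ ξ ∈ O, ∀ g, ξ.comp (τ g) ∈ O)
    (htrans : ∀ ξ ∈ O, ∀ η ∈ O, ∃ g, ξ.comp (τ g) = η) {N N' : Submodule ℝ E}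
    (hN' : ∀ g, ∀ w ∈ N', τ g w ∈ N')
    (hc : ∀ g, ∃ c : ℝ, 0 < c ∧ ∀ w ∈ N', τ g w - c • w ∈ N)
    {a b : E →L[ℝ] ℝ} (ha : a ∈ O) (hb : b ∈ O) (hab : ∀ w ∈ N, a w = b w) :
    ∀ u ∈ Icc (0 : ℝ) 1, ∃ ζ ∈ O, ∀ w ∈ N', ζ w = a w + u * (b w - a w) := by
  set U : Set ℝ := {u | ∃ ζ ∈ O, ∀ w ∈ N', ζ w = a w + u * (b w - a w)} with hU
  have hUo : IsOpen U := by
    have h1 : Continuous fun u : ℝ => restrictForm N' (a + u • (b - a)) := by fun_prop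
    have h2 : U = (fun u : ℝ => restrictForm N' (a + u • (b - a))) ⁻¹' (restrictForm N' '' O) := by
      ext u
      constructor
      · rintro ⟨ζ, hζ, h⟩
        refine ⟨ζ, hζ, ?_⟩
        ext w
        simpa [restrictForm_apply] using h w w.2
      · rintro ⟨ζ, hζ, h⟩
        refine ⟨ζ, hζ, fun w hw => ?_⟩
        simpa [restrictForm_apply] using DFunLike.congr_fun h ⟨w, hw⟩
    rw [h2]
    exact (isOpenMap_restrictForm N' O hO).preimage h1
  have hconv : Convex ℝ U := by
    refine Real.convex_of_affine_transitive hUo ?_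
    rintro s ⟨ξ, hξ, hξs⟩ t ⟨η, hη, hηt⟩
    obtain ⟨g, rfl⟩ := htrans ξ hξ η hη
    obtain ⟨c, hc0, hcg⟩ := hc g
    have hscale : ∀ w ∈ N', b (τ g w) - a (τ g w) = c * (b w - a w) := by
      intro w hw
      have := hab _ (hcg w hw)
      simp only [map_sub, map_smul, smul_eq_mul] at this
      linarith
    have hrel : ∀ w ∈ N', a (τ g w) + s * (b (τ g w) - a (τ g w)) = a w + t * (b w - a w) := by
      intro w hw
      rw [← hξs _ (hN' g w hw), ← hηt w hw]
      rfl
    refine ⟨c, t - c * s, hc0, by ring, fun u => ⟨?_, ?_⟩⟩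
    · rintro ⟨ζ, hζ, h⟩
      refine ⟨_, hinv ζ hζ g⁻¹, fun w hw => ?_⟩
      have hw' := hN' g⁻¹ w hw
      have hgw : τ g (τ g⁻¹ w) = w := by
        rw [← mul_apply_eq_comp, ← map_mul, mul_inv_cancel, map_one]; rfl
      have h1 := hrel _ hw'
      have h2 := hscale _ hw'
      rw [hgw] at h1 h2
      rw [ContinuousLinearMap.comp_apply, h _ hw']
      linear_combination (s - u) * h2 - h1
    · rintro ⟨ζ, hζ, h⟩
      refine ⟨_, hinv ζ hζ g, fun w hw => ?_⟩
      have h1 := hrel _ hw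
      have h2 := hscale _ hw
      rw [ContinuousLinearMap.comp_apply, h _ (hN' g w hw)]
      linear_combination (u - s) * h2 + h1
  have h0 : (0 : ℝ) ∈ U := ⟨a, ha, by simp⟩
  have h1 : (1 : ℝ) ∈ U := ⟨b, hb, by simp⟩
  intro u hu
  exact hconv.ordConnected.out h0 h1 hu

/-- An open orbit, in the dual of `E`, of a group that is triangular on `E` with positive diagonal
entries is contractible. -/
theorem contractibleSpace_of_triangular_orbit {Γ : Type*} [Group Γ] {τ : Γ →* (E →L[ℝ] E)}
    {O : Set (E →L[ℝ] ℝ)} (hO : IsOpen O) (hne : O.Nonempty)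
    (hinv : ∀ ξ ∈ O, ∀ g, ξ.comp (τ g) ∈ O)
    (htrans : ∀ ξ ∈ O, ∀ η ∈ O, ∃ g, ξ.comp (τ g) = η)
    (hflag : ∀ N : Submodule ℝ E, (∀ g, ∀ w ∈ N, τ g w ∈ N) → N ≠ ⊤ →
      ∃ v ∉ N, ∀ g, ∃ c : ℝ, 0 < c ∧ τ g v - c • v ∈ N) :
    ContractibleSpace O := by
  have key : ∀ N : Submodule ℝ E, (∀ g, ∀ w ∈ N, τ g w ∈ N) →
      ContractibleSpace (restrictForm N '' O) →
      ContractibleSpace (restrictForm (⊤ : Submodule ℝ E) '' O) := by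
    intro N
    induction N using WellFoundedGT.induction with
    | ind N ih =>
    intro hN hcon
    by_cases htop : N = ⊤
    · subst htop; exact hcon
    obtain ⟨v, hv, hvc⟩ := hflag N hN htop
    set N' : Submodule ℝ E := N ⊔ Submodule.span ℝ {v} with hN'def
    have hle : N ≤ N' := le_sup_left
    have hlt : N < N' := lt_of_le_of_ne hle fun h => hv (by
      rw [h]; exact Submodule.mem_sup_right (Submodule.mem_span_singleton_self v))
    have hscale : ∀ g, ∃ c : ℝ, 0 < c ∧ ∀ w ∈ N', τ g w - c • w ∈ N := by
      intro g
      obtain ⟨c, hc, hcv⟩ := hvc g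
      refine ⟨c, hc, fun w hw => ?_⟩
      obtain ⟨n, hn, y, hy, rfl⟩ := Submodule.mem_sup.1 hw
      obtain ⟨a, rfl⟩ := Submodule.mem_span_singleton.1 hy
      have h1 : τ g (n + a • v) - c • (n + a • v)
          = (τ g n - c • n) + a • (τ g v - c • v) := by
        rw [map_add, map_smul, smul_add, smul_sub, smul_comm c a v]
        abel
      rw [h1]
      exact N.add_mem (N.sub_mem (hN g n hn) (N.smul_mem c hn)) (N.smul_mem a hcv)
    have hN' : ∀ g, ∀ w ∈ N', τ g w ∈ N' := by
      intro g w hw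
      obtain ⟨c, -, hcw⟩ := hscale g
      have := N'.add_mem (hle (hcw w hw)) (N'.smul_mem c hw)
      rwa [sub_add_cancel] at this
    refine ih N' hlt hN' ?_
    -- restriction from `N'` to `N`, with a right inverse
    let p : (N' →L[ℝ] ℝ) →L[ℝ] (N →L[ℝ] ℝ) := (ContinuousLinearMap.compL ℝ N N' ℝ).flip
      (LinearMap.toContinuousLinearMap (Submodule.inclusion hle))
    obtain ⟨e, he⟩ := exists_rightInverse_restrictForm N
    have hp : ∀ ξ, p (restrictForm N' ξ) = restrictForm N ξ := fun ξ => rfl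
    refine contractibleSpace_of_image_of_convex_fibers (F := N' →L[ℝ] ℝ) (F' := N →L[ℝ] ℝ)
      (isOpenMap_restrictForm N' O hO) p ((restrictForm N').comp e)
      (fun x => (hp (e x)).trans (he x)) ?_ ?_
    · rintro x _ ⟨⟨a, ha, rfl⟩, hax⟩ _ ⟨⟨b, hb, rfl⟩, hbx⟩ α β hα hβ hαβ
      have hab : ∀ w ∈ N, a w = b w := by
        intro w hw
        have : p (restrictForm N' a) = p (restrictForm N' b) := hax.trans hbx.symm
        exact DFunLike.congr_fun this ⟨w, hw⟩
      obtain ⟨ζ, hζ, hζw⟩ := convex_fiber_of_orbit hO hinv htrans hN' hscale ha hb hab β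
        ⟨hβ, by linarith⟩
      refine ⟨⟨ζ, hζ, ?_⟩, ?_⟩
      · ext w
        simp only [restrictForm_apply, hζw w w.2, add_apply, smul_apply, smul_eq_mul]
        rw [← sub_eq_of_eq_add hαβ.symm]
        ring
      · rw [mem_preimage, map_add, map_smul, map_smul, show p (restrictForm N' a) = x from hax,
          show p (restrictForm N' b) = x from hbx, ← add_smul, hαβ, one_smul, mem_singleton_iff]
    · rw [image_image]
      exact hcon
  have hbot : ContractibleSpace (restrictForm (⊥ : Submodule ℝ E) '' O) := by
    obtain ⟨ξ, hξ⟩ := hne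
    have hsub : Subsingleton ((⊥ : Submodule ℝ E) →L[ℝ] ℝ) := ⟨fun f g => by
      ext w
      rw [Subsingleton.elim w 0, map_zero, map_zero]⟩
    have : Unique (restrictForm (⊥ : Submodule ℝ E) '' O) :=
      { default := ⟨_, mem_image_of_mem _ hξ⟩
        uniq := fun y => Subtype.ext (Subsingleton.elim _ _) }
    infer_instance
  have htop := key ⊥ (fun g w hw => by
    rw [Submodule.mem_bot] at hw ⊢
    rw [hw, map_zero]) hbot
  obtain ⟨e, he⟩ := exists_rightInverse_restrictForm (⊤ : Submodule ℝ E)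
  refine contractibleSpace_of_image_of_convex_fibers (F := E →L[ℝ] ℝ)
    (F' := (⊤ : Submodule ℝ E) →L[ℝ] ℝ) hO _ e he (fun x => ?_) htop
  refine Set.Subsingleton.convex fun a ha b hb => ?_
  ext w
  have : restrictForm ⊤ a = restrictForm ⊤ b := ha.2.trans hb.2.symm
  exact DFunLike.congr_fun this ⟨w, Submodule.mem_top⟩

end TriangularOrbit

/-! ### Stabilizers in the coadjoint representation of a split solvable group -/

section Stabilizer

open Filter Set
open scoped Topology

variable {E : Type*} [NormedAddCommGroup E] [NormedSpace ℝ E] [FiniteDimensional ℝ E]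
  {H : Type*} [TopologicalSpace H] {I : ModelWithCorners ℝ E H} [I.Boundaryless]
  {G : Type*} [TopologicalSpace G] [ChartedSpace H G] [Group G] [LieGroup I ∞ G]

/-- An eigenvector of `ad` modulo an invariant subspace is an eigenvector of `Ad` with positive
eigenvalues, for a connected group. -/
theorem exists_pos_lieAd_sub_smul_mem [PreconnectedSpace G] {N : Submodule ℝ E}
    (hN : ∀ X : E, ∀ w ∈ N, adDeriv I G X w ∈ N) {v : E} (hv : v ∉ N)
    (hvN : ∀ X : E, ∃ c : ℝ, adDeriv I G X v - c • v ∈ N) (g : G) :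
    ∃ c : ℝ, 0 < c ∧ lieAd I g v - c • v ∈ N := by
  set N' : Submodule ℝ E := N ⊔ Submodule.span ℝ {v} with hN'def
  have hle : N ≤ N' := le_sup_left
  have hvN' : v ∈ N' := Submodule.mem_sup_right (Submodule.mem_span_singleton_self v)
  have hN' : ∀ X : E, ∀ w ∈ N', adDeriv I G X w ∈ N' := by
    intro X w hw
    obtain ⟨n, hn, y, hy, rfl⟩ := Submodule.mem_sup.1 hw
    obtain ⟨a, rfl⟩ := Submodule.mem_span_singleton.1 hy
    obtain ⟨c, hc⟩ := hvN X
    rw [map_add, map_smul]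
    refine N'.add_mem (hle (hN X n hn)) (N'.smul_mem a ?_)
    have := N'.add_mem (hle hc) (N'.smul_mem c hvN')
    rwa [sub_add_cancel] at this
  obtain ⟨f, hfv, hfN⟩ := Submodule.exists_dual_map_eq_bot_of_notMem hv inferInstance
  have hfN' : ∀ n ∈ N, f n = 0 := fun n hn => by
    have : f n ∈ N.map f := Submodule.mem_map_of_mem hn
    rwa [hfN, Submodule.mem_bot] at this
  set ℓ : E →L[ℝ] ℝ := (f v)⁻¹ • LinearMap.toContinuousLinearMap f with hℓ
  have hℓv : ℓ v = 1 := by simp [hℓ, hfv]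
  have hℓN : ∀ n ∈ N, ℓ n = 0 := fun n hn => by simp [hℓ, hfN' n hn]
  have hmem : ∀ g : G, lieAd I g v - ℓ (lieAd I g v) • v ∈ N := by
    intro g
    obtain ⟨n, hn, y, hy, hsum⟩ := Submodule.mem_sup.1
      (lieAd_mem_of_forall_adDeriv_mem hN' g hvN')
    obtain ⟨a, rfl⟩ := Submodule.mem_span_singleton.1 hy
    rw [← hsum, map_add, map_smul, hℓv, hℓN n hn]
    simpa using hn
  have hcont : Continuous fun g : G => ℓ (lieAd I g v) :=
    ℓ.continuous.comp (((ContinuousLinearMap.apply ℝ E) v).continuous.comp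
      contMDiff_lieAd.continuous)
  have hne : ∀ g : G, ℓ (lieAd I g v) ≠ 0 := by
    intro g h0
    have h1 := hmem g
    rw [h0, zero_smul, sub_zero] at h1
    have h2 := lieAd_mem_of_forall_adDeriv_mem hN g⁻¹ h1
    rw [lieAd_inv_apply] at h2
    exact hv h2
  refine ⟨ℓ (lieAd I g v), ?_, hmem g⟩
  by_contra hle0
  obtain ⟨k, hk⟩ := mem_range_of_exists_le_of_exists_ge hcont ⟨g, not_lt.1 hle0⟩
    ⟨1, by rw [lieAd_one]; simp [hℓv]⟩
  exact hne k hk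

/-- In a connected group whose Lie algebra is split solvable, the stabilizer of a linear form with
an open orbit is trivial: the orbit map is a covering of the orbit, which is contractible. -/
theorem NondegenerateAt.eq_one_of_coAd_eq [PathConnectedSpace G] {ξ : E →L[ℝ] ℝ}
    (hξ : NondegenerateAt I G ξ)
    (hlie : ∀ N : Submodule ℝ E, (∀ X : E, ∀ w ∈ N, adDeriv I G X w ∈ N) → N ≠ ⊤ →
      ∃ v ∉ N, ∀ X : E, ∃ c : ℝ, adDeriv I G X v - c • v ∈ N)
    {g : G} (hg : coAd I g ξ = ξ) : g = 1 := by
  have : IsTopologicalGroup G := topologicalGroup_of_lieGroup I ∞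
  set O := coadjointOrbit I G ξ with hO
  have hcon : ContractibleSpace O := by
    refine contractibleSpace_of_triangular_orbit (τ := adRep I G) hξ.isOpen_coadjointOrbit
      ⟨_, mem_range_self 1⟩ ?_ ?_ ?_
    · rintro _ ⟨k, rfl⟩ g
      refine ⟨g⁻¹ * k, ?_⟩
      change coAd I (g⁻¹ * k) ξ = (coAd I k ξ).comp (lieAd I g)
      rw [coAd_mul]
      ext X
      simp [coAd_apply]
    · rintro _ ⟨k, rfl⟩ _ ⟨l, rfl⟩
      refine ⟨k * l⁻¹, ?_⟩
      change (coAd I k ξ).comp (lieAd I (k * l⁻¹)) = coAd I l ξ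
      ext X
      simp [coAd_apply, lieAd_mul, lieAd_inv_apply]
    · intro N hN htop
      have hN' : ∀ X : E, ∀ w ∈ N, adDeriv I G X w ∈ N := fun X w hw =>
        adDeriv_mem_of_forall_lieAd_mem N.closed_of_finiteDimensional hN X hw
      obtain ⟨v, hv, hvN⟩ := hlie N hN' htop
      exact ⟨v, hv, exists_pos_lieAd_sub_smul_mem hN' hv hvN⟩
  let S : Subgroup G :=
    { carrier := {g | coAd I g ξ = ξ}
      one_mem' := coAd_one ξ
      mul_mem' := fun {a b} ha hb => by
        change coAd I (a * b) ξ = ξ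
        rw [coAd_mul, show coAd I b ξ = ξ from hb, show coAd I a ξ = ξ from ha]
      inv_mem' := fun {a} ha => by
        have h1 : coAd I a ξ = ξ := ha
        have h2 := coAd_inv_coAd (I := I) a ξ
        rwa [h1] at h2 }
  have hS : IsDiscrete (S : Set G) := by
    refine isDiscrete_iff_discreteTopology.2 ?_
    refine discreteTopology_of_isOpen_singleton_one (G := S) ?_
    rw [isOpen_singleton_iff_nhds_eq_pure, ← Filter.principal_singleton]
    refine le_antisymm ?_ ?_
    · rw [Filter.le_principal_iff]
      have h1 := (continuous_subtype_val (p := fun g => g ∈ S)).tendsto (1 : S)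
      filter_upwards [h1.eventually hξ.eventually_eq_one] with k hk
      exact Subtype.ext (hk k.2)
    · rw [Filter.principal_singleton]; exact pure_le_nhds _
  let f : G → O := fun g => ⟨coAd I g ξ, mem_range_self g⟩
  have hcont : Continuous f := (contMDiff_coAd (I := I) ξ).continuous.subtype_mk _
  have hopen : IsOpenMap f := hξ.isOpenMap.subtype_mk _
  have hsurj : Function.Surjective f := by
    rintro ⟨_, k, rfl⟩
    exact ⟨k, rfl⟩
  have hq : IsQuotientCoveringMap f S.op := by
    refine (hopen.isQuotientMap hcont hsurj).isQuotientCoveringMap_of_subgroupOp S hS ?_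
    intro k l
    rw [Subtype.ext_iff]
    change coAd I k ξ = coAd I l ξ ↔ coAd I (k⁻¹ * l) ξ = ξ
    rw [coAd_mul]
    constructor
    · intro h
      rw [← h, coAd_inv_coAd]
    · intro h
      rw [← h, ← coAd_mul, mul_inv_cancel, coAd_one, h]
  have hsc : SimplyConnectedSpace O := inferInstance
  have h3 := hq.fundamentalGroupToMulOpposite_surjective (x := f 1) ⟨1, rfl⟩
  have h4 : Subsingleton (S.op)ᵐᵒᵖ := h3.subsingleton
  have h5 : (⟨MulOpposite.op g, hg⟩ : S.op) = 1 :=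
    MulOpposite.op_injective (Subsingleton.elim _ _)
  have h6 := congrArg Subtype.val h5
  exact MulOpposite.op_injective h6

/-- The linear form of a normal `j`-algebra has an open coadjoint orbit, on which the group acts
simply transitively. -/
theorem IsNormalJGroup.exists_isOpen_coadjointOrbit (hG : IsNormalJGroup I G) :
    ∃ ξ : E →L[ℝ] ℝ, IsOpen (coadjointOrbit I G ξ) ∧
      CoadjointSimplyTransitiveOn I G (coadjointOrbit I G ξ) := by
  have : CompleteSpace E := FiniteDimensional.complete ℝ E
  have : LieGroup I (minSmoothness ℝ 3) G :=
    LieGroup.of_le (n := ∞) (by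
      rw [minSmoothness_of_isRCLikeNormedField]
      exact ENat.LEInfty.out)
  have hfin : Module.Finite ℝ (GroupLieAlgebra I G) := inferInstanceAs (Module.Finite ℝ E)
  obtain ⟨hsc, α, j, hαj⟩ := hG
  set ξ : E →L[ℝ] ℝ := LinearMap.toContinuousLinearMap (show E →ₗ[ℝ] ℝ from α) with hξ
  have hα : ∀ X : GroupLieAlgebra I G, ξ X = α X := fun X => rfl
  have had : ∀ X Y : GroupLieAlgebra I G, adDeriv I G X Y = ⁅X, Y⁆ := adDeriv_apply
  have hnd : NondegenerateAt I G ξ := by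
    have h : ∀ X : GroupLieAlgebra I G, (∀ Y : GroupLieAlgebra I G, α ⁅X, Y⁆ = 0) → X = 0 := by
      intro X hX
      by_contra hX0
      have h1 := hαj.pos X hX0
      rw [← lie_skew, map_neg, hX, neg_zero] at h1
      exact lt_irrefl _ h1
    exact fun X hX => h X fun Y => (congrArg α (had X Y)).symm.trans (hX Y)
  have hlie : ∀ N : Submodule ℝ E, (∀ X : E, ∀ w ∈ N, adDeriv I G X w ∈ N) → N ≠ ⊤ →
      ∃ v ∉ N, ∀ X : E, ∃ c : ℝ, adDeriv I G X v - c • v ∈ N := by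
    intro N hN htop
    have := hαj.solvable
    let K : LieIdeal ℝ (GroupLieAlgebra I G) :=
      { (show Submodule ℝ (GroupLieAlgebra I G) from N) with
        lie_mem := fun {X w} hw => by
          exact (congrArg (· ∈ N) (had X w)).mp (hN X w hw) }
    have hK : K ≠ ⊤ := fun h => htop (congrArg LieSubmodule.toSubmodule h)
    obtain ⟨v, hv, hvc⟩ := K.exists_notMem_forall_lie_sub_smul_mem hαj.split hK
    refine ⟨v, hv, fun X => ?_⟩
    obtain ⟨c, hc⟩ := hvc X
    refine ⟨c, ?_⟩
    exact (congrArg (fun w : E => w - c • (show E from v) ∈ N) (had X v)).mpr hc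
  refine ⟨ξ, hnd.isOpen_coadjointOrbit, ?_⟩
  rintro _ ⟨k, rfl⟩ _ ⟨l, rfl⟩
  refine ⟨l * k⁻¹, ?_, fun g hg => ?_⟩
  · change coAd I (l * k⁻¹) (coAd I k ξ) = coAd I l ξ
    rw [← coAd_mul, inv_mul_cancel_right]
  · have h1 : coAd I (l⁻¹ * (g * k)) ξ = ξ := by
      have h2 : coAd I g (coAd I k ξ) = coAd I l ξ := hg
      rw [coAd_mul, coAd_mul, h2, coAd_inv_coAd]
    have h3 := hnd.eq_one_of_coAd_eq hlie h1
    rw [eq_mul_inv_iff_mul_eq, ← inv_mul_eq_one, ← inv_eq_one, ← h3]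
    group

end Stabilizer

/-! ### Open orbits are nondegenerate -/

section Sard

open Filter Set MeasureTheory
open scoped Topology

variable {E : Type*} [NormedAddCommGroup E] [NormedSpace ℝ E] [FiniteDimensional ℝ E]
  {H : Type*} [TopologicalSpace H] {I : ModelWithCorners ℝ E H}
  {G : Type*} [TopologicalSpace G] [ChartedSpace H G] [Group G] [LieGroup I ∞ G]
  [I.Boundaryless]

/-- If `ξ` is degenerate, then the map `g ↦ ξ ∘ Ad_g` has no regular point in the chart at `1`. -/
theorem exists_hasFDerivAt_comp_lieAd_det_eq_zero {ξ : E →L[ℝ] ℝ} (h : ¬ NondegenerateAt I G ξ)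
    (e : (E →L[ℝ] ℝ) ≃L[ℝ] E) {y : E} (hy : y ∈ (extChartAt I (1 : G)).target) :
    ∃ D : E →L[ℝ] E, HasFDerivAt
      (fun z => e (ξ.comp (lieAd I ((extChartAt I (1 : G)).symm z)))) D y ∧ D.det = 0 := by
  obtain ⟨Θ, hΘ⟩ := exists_hasFDerivAt_lieAd_extChartAt_symm (I := I) hy
  set g : G := (extChartAt I (1 : G)).symm y with hg
  have h1 := (e : (E →L[ℝ] ℝ) →L[ℝ] E).hasFDerivAt.comp y
    ((ContinuousLinearMap.compL ℝ E E ℝ ξ).hasFDerivAt.comp y hΘ)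
  refine ⟨_, h1, ?_⟩
  set D : E →L[ℝ] E := _ with hD
  change LinearMap.det (D : E →ₗ[ℝ] E) = 0
  by_contra hdet
  refine h fun X hX => ?_
  have hinj : Function.Injective D :=
    ((D : E →ₗ[ℝ] E).equivOfDetNeZero hdet).injective
  have hDa : ∀ Z, D Z = e ((-coadDeriv I G ξ (lieAd I g (Θ Z))).comp (lieAd I g)) := by
    intro Z
    refine congrArg e (ContinuousLinearMap.ext fun Y => ?_)
    change ξ (lieAd I g (adDeriv I G (Θ Z) Y))
      = -coadDeriv I G ξ (lieAd I g (Θ Z)) (lieAd I g Y)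
    rw [coadDeriv_apply, adDeriv_lieAd, lieAd_inv_apply, neg_neg]
  have hinj' : Function.Injective ((lieAd I g).comp Θ : E →ₗ[ℝ] E) := by
    rw [injective_iff_map_eq_zero]
    intro Z hZ
    have hZ' : lieAd I g (Θ Z) = 0 := hZ
    refine hinj ?_
    rw [hDa, hZ']
    simp
  obtain ⟨Z, hZ⟩ := LinearMap.injective_iff_surjective.1 hinj' X
  have hZ' : lieAd I g (Θ Z) = X := hZ
  have hX' : coadDeriv I G ξ X = 0 := by
    ext Y
    rw [coadDeriv_apply, hX]
    simp
  have hZ0 : Z = 0 := hinj (by rw [hDa, hZ', hX']; simp)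
  rw [← hZ', hZ0, map_zero, map_zero]

/-- By Sard's lemma, a form with an open coadjoint orbit is nondegenerate. -/
theorem NondegenerateAt.of_isOpen_coadjointOrbit [SecondCountableTopology G] {ξ : E →L[ℝ] ℝ}
    (hopen : IsOpen (coadjointOrbit I G ξ)) : NondegenerateAt I G ξ := by
  by_contra h
  have : IsTopologicalGroup G := topologicalGroup_of_lieGroup I ∞
  have hdim : Module.finrank ℝ (E →L[ℝ] ℝ) = Module.finrank ℝ E := by
    rw [← (LinearMap.toContinuousLinearMap : (E →ₗ[ℝ] ℝ) ≃ₗ[ℝ] E →L[ℝ] ℝ).finrank_eq]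
    exact Subspace.dual_finrank_eq (K := ℝ) (V := E)
  let e : (E →L[ℝ] ℝ) ≃L[ℝ] E := ContinuousLinearEquiv.ofFinrankEq hdim
  let _ : MeasurableSpace E := borel E
  have : BorelSpace E := ⟨rfl⟩
  let μ : Measure E := Measure.addHaar
  let f : G → E := fun g => e (ξ.comp (lieAd I g))
  set U : Set G := (extChartAt I (1 : G)).source with hU
  have hfU : μ (f '' U) = 0 := by
    choose! D hD hdet using fun y (hy : y ∈ (extChartAt I (1 : G)).target) =>
      exists_hasFDerivAt_comp_lieAd_det_eq_zero h e hy
    have h1 := addHaar_image_eq_zero_of_det_fderivWithin_eq_zero μ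
      (fun y hy => (hD y hy).hasFDerivWithinAt) hdet
    refine measure_mono_null ?_ h1
    rintro _ ⟨g, hg, rfl⟩
    refine ⟨extChartAt I (1 : G) g, (extChartAt I (1 : G)).map_source hg, ?_⟩
    change f ((extChartAt I (1 : G)).symm _) = f g
    rw [(extChartAt I (1 : G)).left_inv hg]
  -- translates of `U` have null images, and countably many of them cover `G`
  have hfk : ∀ k : G, μ (f '' ((fun g => g * k) '' U)) = 0 := by
    intro k
    let R : E →L[ℝ] E := (e : (E →L[ℝ] ℝ) →L[ℝ] E).comp
      (((ContinuousLinearMap.compL ℝ E E ℝ).flip (lieAd I k)).comp (e.symm : E →L[ℝ] E →L[ℝ] ℝ))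
    have h1 : f '' ((fun g => g * k) '' U) = R '' (f '' U) := by
      rw [image_image, image_image]
      refine image_congr fun g _ => ?_
      change e (ξ.comp (lieAd I (g * k))) = e ((e.symm (e (ξ.comp (lieAd I g)))).comp (lieAd I k))
      rw [e.symm_apply_apply, lieAd_mul]
      rfl
    rw [h1, Measure.addHaar_image_continuousLinearMap, hfU, mul_zero]
  have hUo : IsOpen U := isOpen_extChartAt_source (1 : G)
  obtain ⟨T, hT, hTU⟩ := TopologicalSpace.isOpen_iUnion_countable
    (fun k : G => (fun g => g * k) '' U) fun k => isOpenMap_mul_right k U hUo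
  have hcov : ⋃ k ∈ T, (fun g => g * k) '' U = univ := by
    rw [hTU, eq_univ_iff_forall]
    intro k
    exact mem_iUnion.2 ⟨k, 1, mem_extChartAt_source 1, one_mul k⟩
  have hnull : μ (f '' univ) = 0 := by
    rw [← hcov, image_iUnion₂]
    exact (measure_biUnion_null_iff hT).2 fun k _ => hfk k
  have horb : f '' univ = e '' coadjointOrbit I G ξ := by
    ext x
    constructor
    · rintro ⟨g, -, rfl⟩
      exact ⟨_, ⟨g⁻¹, rfl⟩, by simp [f, coAd]⟩
    · rintro ⟨_, ⟨g, rfl⟩, rfl⟩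
      exact ⟨g⁻¹, mem_univ _, rfl⟩
  rw [horb] at hnull
  have hO : IsOpen (e '' coadjointOrbit I G ξ) := e.toHomeomorph.isOpenMap _ hopen
  exact (hO.measure_pos μ ⟨_, _, ⟨1, rfl⟩, rfl⟩).ne' hnull

end Sard

/-! ### The coadjoint action on the linear form `♭E` -/

section Explicit

open Filter Set
open scoped Topology

variable {E₁ : Type*} [NormedAddCommGroup E₁] [NormedSpace ℝ E₁]
  {H₁ : Type*} [TopologicalSpace H₁] {I₁ : ModelWithCorners ℝ E₁ H₁}
  {G₁ : Type*} [TopologicalSpace G₁] [ChartedSpace H₁ G₁] [Group G₁]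
  {V : Type*} [NormedAddCommGroup V] [NormedSpace ℝ V] {Ω : SymplecticForm V}

theorem SymplecticForm.neg_form (Ω : SymplecticForm V) (x y : V) : -Ω.form x y = Ω.form y x := by
  have h := Ω.alt (x + y)
  simp only [map_add, add_apply, Ω.alt] at h
  linarith

namespace ElementaryGroup

/-- The last coordinate of `s h T(s⁻¹)`, as a function of the linear map `T`, acting on the middle
coordinate, and of `h` (see `ElementaryGroup.twistedConj_last`). -/
noncomputable def twistedConjLast (s : ElementaryGroup Ω) (p : (V →L[ℝ] V) × (ℝ × V × ℝ)) : ℝ :=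
  Real.exp (2 * s.1) * ((Real.exp (-2 * p.2.1) - 1) * s.2.2 + p.2.2.2
    + 1 / 2 * Real.exp (-p.2.1) * Ω.form s.2.1 (p.2.2.1 - p.1 s.2.1)
    - 1 / 2 * Ω.form p.2.2.1 (p.1 s.2.1))

/-- The linear form `(b, y, m) ↦ e^{2a} (m - 2 ℓ b + Ω (x, y))` attached to `s = (a, x, ℓ)`. It is
`♭E ∘ Ad_s` (see `ElementaryGroup.flatE_comp_lieAd`). -/
noncomputable def conjForm (s : ElementaryGroup Ω) : (ℝ × V × ℝ) →L[ℝ] ℝ :=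
  Real.exp (2 * s.1) • ContinuousLinearMap.coprod ((-2 * s.2.2) • ContinuousLinearMap.id ℝ ℝ)
    ((Ω.form s.2.1).coprod (ContinuousLinearMap.id ℝ ℝ))

theorem conjForm_apply (s : ElementaryGroup Ω) (b : ℝ) (y : V) (m : ℝ) :
    s.conjForm (b, y, m) = Real.exp (2 * s.1) * (-2 * s.2.2 * b + (Ω.form s.2.1 y + m)) := by
  simp [conjForm]

/-- The linear form `S ↦ e^{2a} Ω (x, S x) / 2` on endomorphisms attached to `s = (a, x, ℓ)`. With
`S = dρ(X)` it is the term by which the coadjoint action of `G₁ ⋉ S₂` mixes the two factors. -/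
noncomputable def quadForm (s : ElementaryGroup Ω) : (V →L[ℝ] V) →L[ℝ] ℝ :=
  (Real.exp (2 * s.1) / 2) • (Ω.form s.2.1).comp (ContinuousLinearMap.apply ℝ V s.2.1)

theorem hasFDerivAt_twistedConjLast (s : ElementaryGroup Ω) :
    HasFDerivAt s.twistedConjLast ((-s.quadForm).coprod s.conjForm)
      (ContinuousLinearMap.id ℝ V, ((0 : ℝ), (0 : V), (0 : ℝ))) := by
  have hd : Differentiable ℝ s.twistedConjLast := by
    unfold twistedConjLast
    fun_prop
  refine (hd _).hasFDerivAt.congr_fderiv ?_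
  refine ContinuousLinearMap.ext fun ⟨S, b, y, m⟩ => ?_
  -- compare the derivatives along a line
  have h1 : HasDerivAt (fun t : ℝ => s.twistedConjLast
      ((ContinuousLinearMap.id ℝ V, ((0 : ℝ), (0 : V), (0 : ℝ))) + t • (S, b, y, m)))
      (fderiv ℝ s.twistedConjLast (ContinuousLinearMap.id ℝ V, ((0 : ℝ), (0 : V), (0 : ℝ)))
        (S, b, y, m)) 0 := by
    have h2 : HasDerivAt (fun t : ℝ =>
        ((ContinuousLinearMap.id ℝ V, ((0 : ℝ), (0 : V), (0 : ℝ))) + t • (S, b, y, m)))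
        (S, b, y, m) 0 := by
      simpa using ((hasDerivAt_id (0 : ℝ)).smul_const (S, b, y, m)).const_add
        ((ContinuousLinearMap.id ℝ V, ((0 : ℝ), (0 : V), (0 : ℝ))))
    have h3 := (hd ((ContinuousLinearMap.id ℝ V, ((0 : ℝ), (0 : V), (0 : ℝ)))
      + (0 : ℝ) • (S, b, y, m))).hasFDerivAt.comp_hasDerivAt (0 : ℝ) h2
    rwa [zero_smul, add_zero] at h3
  have h3 : (fun t : ℝ => s.twistedConjLast
      ((ContinuousLinearMap.id ℝ V, ((0 : ℝ), (0 : V), (0 : ℝ))) + t • (S, b, y, m)))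
      = fun t => Real.exp (2 * s.1) * ((Real.exp (-2 * (t * b)) - 1) * s.2.2 + t * m
        + 1 / 2 * Real.exp (-(t * b)) * (t * (Ω.form s.2.1 y - Ω.form s.2.1 (S s.2.1)))
        + 1 / 2 * (t * (Ω.form s.2.1 y - t * Ω.form y (S s.2.1)))) := by
    ext t
    simp only [twistedConjLast, Prod.smul_mk, Prod.mk_add_mk, zero_add, smul_eq_mul, add_apply,
      smul_apply, ContinuousLinearMap.id_apply, map_sub, map_add, map_smul, Ω.alt,
      ← Ω.neg_form y s.2.1]
    ring
  have h4 : HasDerivAt (fun t => Real.exp (2 * s.1) * ((Real.exp (-2 * (t * b)) - 1) * s.2.2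
        + t * m
        + 1 / 2 * Real.exp (-(t * b)) * (t * (Ω.form s.2.1 y - Ω.form s.2.1 (S s.2.1)))
        + 1 / 2 * (t * (Ω.form s.2.1 y - t * Ω.form y (S s.2.1)))))
      (Real.exp (2 * s.1) * (-2 * b * s.2.2 + m
        + 1 / 2 * (Ω.form s.2.1 y - Ω.form s.2.1 (S s.2.1)) + 1 / 2 * Ω.form s.2.1 y)) 0 := by
    have ht := hasDerivAt_id (0 : ℝ)
    have h5 := (((((((ht.mul_const b).const_mul (-2)).exp.sub_const 1).mul_const s.2.2).add
      (ht.mul_const m)).add ((((ht.mul_const b).neg.exp).const_mul (1 / 2)).mul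
      (ht.mul_const (Ω.form s.2.1 y - Ω.form s.2.1 (S s.2.1))))).add
      ((ht.mul ((ht.mul_const (Ω.form y (S s.2.1))).const_sub (Ω.form s.2.1 y))).const_mul
        (1 / 2))).const_mul (Real.exp (2 * s.1))
    refine h5.congr_deriv ?_
    simp
  rw [h3] at h1
  rw [h1.unique h4]
  simp [conjForm, quadForm]
  ring

end ElementaryGroup

theorem ElementaryGroup.twistedConj_last (s h : ElementaryGroup Ω) (T : V →L[ℝ] V) :
    (s * h * (show ElementaryGroup Ω from (s⁻¹.1, T s⁻¹.2.1, s⁻¹.2.2))).2.2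
      = s.twistedConjLast (T, h) := by
  obtain ⟨a, x, l⟩ := s
  obtain ⟨b, y, m⟩ := h
  have h2 : Real.exp (2 * a) = Real.exp a ^ 2 := by
    rw [← Real.exp_nat_mul]; norm_num
  change Real.exp (-2 * -a) * (Real.exp (-2 * b) * l + m + 1 / 2 * Real.exp (-b) * Ω.form x y)
      + -(Real.exp (2 * a) * l)
      + 1 / 2 * Real.exp (- -a) * Ω.form (Real.exp (-b) • x + y) (T (-(Real.exp a • x)))
    = Real.exp (2 * a) * ((Real.exp (-2 * b) - 1) * l + m
    + 1 / 2 * Real.exp (-b) * Ω.form x (y - T x) - 1 / 2 * Ω.form y (T x))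
  simp only [neg_mul_neg, neg_neg, h2, map_neg, map_smul, map_add, map_sub, add_apply,
    smul_apply, smul_eq_mul]
  ring

theorem SymplecticRep.act_inv (ρ : SymplecticRep I₁ G₁ Ω) (g : G₁) (s : ElementaryGroup Ω) :
    ρ.act g s⁻¹ = (ρ.act g s)⁻¹ := by
  refine Prod.ext rfl (Prod.ext ?_ rfl)
  change ρ.hom g (-(Real.exp s.1 • s.2.1)) = -(Real.exp s.1 • ρ.hom g s.2.1)
  rw [map_neg, map_smul]

/-- The last coordinate of a conjugate by the inverse of `(g₁, g₂)`. It does not depend on `g₁`, as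
`ρ(g₁)` preserves last coordinates. -/
theorem SemidirectGroup.conj_last {ρ : SymplecticRep I₁ G₁ Ω} (g₁ : G₁) (g₂ : ElementaryGroup Ω)
    (h : SemidirectGroup ρ) :
    ((SemidirectGroup.mk ρ g₁ g₂)⁻¹ * h * (SemidirectGroup.mk ρ g₁ g₂)⁻¹⁻¹).2.2.2
      = g₂⁻¹.twistedConjLast ((ρ.hom h.1 : V →L[ℝ] V), h.2) := by
  rw [← ElementaryGroup.twistedConj_last, inv_inv, inv_inv]
  have h1 : ((SemidirectGroup.mk ρ g₁ g₂)⁻¹ * h * (SemidirectGroup.mk ρ g₁ g₂)).2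
      = ρ.act g₁⁻¹ (g₂⁻¹ * h.2 * ρ.act h.1 g₂) := by
    change ρ.act g₁⁻¹ g₂⁻¹ * ρ.act g₁⁻¹ h.2 * ρ.act (g₁⁻¹ * h.1) g₂ = _
    rw [ρ.act_mul, ρ.act_map_mul, ρ.act_map_mul]
  rw [h1]
  rfl

theorem ElementaryGroup.flatE_comp_lieAd (s : ElementaryGroup Ω) :
    (flatE V).comp (lieAd 𝓘(ℝ, ℝ × V × ℝ) s) = s.conjForm := by
  have h1 : HasMFDerivAt 𝓘(ℝ, ℝ × V × ℝ) 𝓘(ℝ, ℝ)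
      ((flatE V : ℝ × V × ℝ → ℝ) ∘ fun h : ElementaryGroup Ω => s * h * s⁻¹) 1
      ((flatE V).comp (lieAd 𝓘(ℝ, ℝ × V × ℝ) s) :) :=
    HasMFDerivAt.comp (1 : ElementaryGroup Ω) (I' := 𝓘(ℝ, ℝ × V × ℝ))
      (M' := ElementaryGroup Ω) (flatE V).hasFDerivAt.hasMFDerivAt (hasMFDerivAt_conj s)
  have h2 : HasFDerivAt (fun h : ℝ × V × ℝ => s.twistedConjLast (ContinuousLinearMap.id ℝ V, h))
      s.conjForm ((0 : ℝ), (0 : V), (0 : ℝ)) := by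
    refine (s.hasFDerivAt_twistedConjLast.comp _ (hasFDerivAt_prodMk_right _ _)).congr_fderiv ?_
    refine ContinuousLinearMap.ext fun Z => ?_
    simp
  have h3 : HasMFDerivAt 𝓘(ℝ, ℝ × V × ℝ) 𝓘(ℝ, ℝ)
      (fun h : ElementaryGroup Ω => s.twistedConjLast (ContinuousLinearMap.id ℝ V, h)) 1
      (s.conjForm :) := h2.hasMFDerivAt
  have h4 : ((flatE V : ℝ × V × ℝ → ℝ) ∘ fun h : ElementaryGroup Ω => s * h * s⁻¹)
      = fun h : ElementaryGroup Ω => s.twistedConjLast (ContinuousLinearMap.id ℝ V, h) :=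
    funext fun h => s.twistedConj_last h (ContinuousLinearMap.id ℝ V)
  rw [h4] at h1
  exact hasMFDerivAt_unique h1 h3

theorem ElementaryGroup.coAd_flatE (s : ElementaryGroup Ω) :
    coAd 𝓘(ℝ, ℝ × V × ℝ) s (flatE V) = s⁻¹.conjForm :=
  flatE_comp_lieAd s⁻¹

variable (ρ : SymplecticRep I₁ G₁ Ω)

/-- The derivative at `1` of the representation `ρ`. -/
noncomputable def SymplecticRep.deriv : E₁ →L[ℝ] V →L[ℝ] V :=
  mfderiv I₁ 𝓘(ℝ, V →L[ℝ] V) (fun g : G₁ => (ρ.hom g : V →L[ℝ] V)) 1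

theorem SymplecticRep.hasMFDerivAt_one :
    HasMFDerivAt I₁ 𝓘(ℝ, V →L[ℝ] V) (fun g : G₁ => (ρ.hom g : V →L[ℝ] V)) 1 (ρ.deriv :) :=
  (ρ.smooth.mdifferentiableAt (by simp)).hasMFDerivAt

variable [LieGroup I₁ ∞ G₁] {ρ}

theorem SemidirectGroup.fst_comp_lieAd (k : SemidirectGroup ρ) :
    (ContinuousLinearMap.fst ℝ E₁ (ℝ × V × ℝ)).comp (lieAd (I₁.prod 𝓘(ℝ, ℝ × V × ℝ)) k)
      = (lieAd I₁ k.1).comp (ContinuousLinearMap.fst ℝ E₁ (ℝ × V × ℝ)) := by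
  have h1 : HasMFDerivAt (I₁.prod 𝓘(ℝ, ℝ × V × ℝ)) I₁
      ((fun h : SemidirectGroup ρ => h.1) ∘ fun h : SemidirectGroup ρ => k * h * k⁻¹) 1
      ((ContinuousLinearMap.fst ℝ E₁ (ℝ × V × ℝ)).comp
        (lieAd (I₁.prod 𝓘(ℝ, ℝ × V × ℝ)) k) :) :=
    HasMFDerivAt.comp (1 : SemidirectGroup ρ) (I' := I₁.prod 𝓘(ℝ, ℝ × V × ℝ))
      (M' := SemidirectGroup ρ) (hasMFDerivAt_fst (M := G₁) (M' := ElementaryGroup Ω) _)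
      (hasMFDerivAt_conj k)
  have h2 : HasMFDerivAt (I₁.prod 𝓘(ℝ, ℝ × V × ℝ)) I₁
      ((fun g : G₁ => k.1 * g * k.1⁻¹) ∘ fun h : SemidirectGroup ρ => h.1) 1
      ((lieAd I₁ k.1).comp (ContinuousLinearMap.fst ℝ E₁ (ℝ × V × ℝ)) :) :=
    HasMFDerivAt.comp (1 : SemidirectGroup ρ) (I' := I₁)
      (M' := G₁) (hasMFDerivAt_conj k.1) (hasMFDerivAt_fst (M := G₁) (M' := ElementaryGroup Ω) _)
  exact hasMFDerivAt_unique h1 h2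

theorem SemidirectGroup.flatE_comp_lieAd (g₁ : G₁) (g₂ : ElementaryGroup Ω) :
    ((flatE V).comp (ContinuousLinearMap.snd ℝ E₁ (ℝ × V × ℝ))).comp
        (lieAd (I₁.prod 𝓘(ℝ, ℝ × V × ℝ)) (SemidirectGroup.mk ρ g₁ g₂)⁻¹)
      = (-(g₂⁻¹.quadForm.comp ρ.deriv)).coprod g₂⁻¹.conjForm := by
  set k := (SemidirectGroup.mk ρ g₁ g₂)⁻¹ with hk
  have h0 : ∀ h : SemidirectGroup ρ, HasMFDerivAt (I₁.prod 𝓘(ℝ, ℝ × V × ℝ)) 𝓘(ℝ, ℝ × V × ℝ)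
      (fun h : SemidirectGroup ρ => (h.2 : ℝ × V × ℝ)) h
      (ContinuousLinearMap.snd ℝ E₁ (ℝ × V × ℝ) :) := fun h =>
    hasMFDerivAt_snd (M := G₁) (M' := ElementaryGroup Ω) _
  have h1 : HasMFDerivAt (I₁.prod 𝓘(ℝ, ℝ × V × ℝ)) 𝓘(ℝ, ℝ)
      ((fun h : SemidirectGroup ρ => flatE V h.2) ∘ fun h : SemidirectGroup ρ => k * h * k⁻¹) 1
      (((flatE V).comp (ContinuousLinearMap.snd ℝ E₁ (ℝ × V × ℝ))).comp
        (lieAd (I₁.prod 𝓘(ℝ, ℝ × V × ℝ)) k) :) :=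
    HasMFDerivAt.comp (1 : SemidirectGroup ρ) (I' := I₁.prod 𝓘(ℝ, ℝ × V × ℝ))
      (M' := SemidirectGroup ρ)
      (HasMFDerivAt.comp (I' := 𝓘(ℝ, ℝ × V × ℝ)) (M' := ℝ × V × ℝ) _
        (flatE V).hasFDerivAt.hasMFDerivAt (h0 _))
      (hasMFDerivAt_conj k)
  have h2 : HasMFDerivAt (I₁.prod 𝓘(ℝ, ℝ × V × ℝ)) 𝓘(ℝ, V →L[ℝ] V)
      (fun h : SemidirectGroup ρ => (ρ.hom h.1 : V →L[ℝ] V)) 1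
      (ρ.deriv.comp (ContinuousLinearMap.fst ℝ E₁ (ℝ × V × ℝ)) :) :=
    HasMFDerivAt.comp (1 : SemidirectGroup ρ) (I' := I₁)
      (M' := G₁) ρ.hasMFDerivAt_one (hasMFDerivAt_fst (M := G₁) (M' := ElementaryGroup Ω) _)
  let F : SemidirectGroup ρ → (V →L[ℝ] V) × (ℝ × V × ℝ) := fun h => ((ρ.hom h.1 : V →L[ℝ] V), h.2)
  have h3 : HasMFDerivAt (I₁.prod 𝓘(ℝ, ℝ × V × ℝ)) 𝓘(ℝ, (V →L[ℝ] V) × (ℝ × V × ℝ)) F 1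
      ((ρ.deriv.comp (ContinuousLinearMap.fst ℝ E₁ (ℝ × V × ℝ))).prod
        (ContinuousLinearMap.snd ℝ E₁ (ℝ × V × ℝ)) :) :=
    ⟨h2.1.prodMk (h0 1).1, h2.2.prodMk (h0 1).2⟩
  have hF : F 1 = (ContinuousLinearMap.id ℝ V, ((0 : ℝ), (0 : V), (0 : ℝ))) := by
    change ((ρ.hom (1 : G₁) : V →L[ℝ] V), ((0 : ℝ), (0 : V), (0 : ℝ))) = _
    rw [map_one]
    rfl
  have h4 : HasMFDerivAt 𝓘(ℝ, (V →L[ℝ] V) × (ℝ × V × ℝ)) 𝓘(ℝ, ℝ) g₂⁻¹.twistedConjLast (F 1)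
      ((-g₂⁻¹.quadForm).coprod g₂⁻¹.conjForm :) := by
    rw [hF]
    exact g₂⁻¹.hasFDerivAt_twistedConjLast.hasMFDerivAt
  have h5 := h4.comp (1 : SemidirectGroup ρ) h3
  have h6 : ((fun h : SemidirectGroup ρ => flatE V h.2) ∘
        fun h : SemidirectGroup ρ => k * h * k⁻¹)
      = g₂⁻¹.twistedConjLast ∘ F :=
    funext fun h => SemidirectGroup.conj_last g₁ g₂ h
  rw [h6] at h1
  refine (hasMFDerivAt_unique h1 h5).trans (ContinuousLinearMap.ext fun Z => ?_)
  rfl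

/-- The orbit of `ξ + ε ♭E` under the semidirect product. -/
theorem SemidirectGroup.coAd_coprod (g₁ : G₁) (g₂ : ElementaryGroup Ω) (ξ : E₁ →L[ℝ] ℝ) (ε : ℝ) :
    coAd (I₁.prod 𝓘(ℝ, ℝ × V × ℝ)) (SemidirectGroup.mk ρ g₁ g₂) (ξ.coprod (ε • flatE V))
      = (coAd I₁ g₁ ξ - ε • g₂⁻¹.quadForm.comp ρ.deriv).coprod
        (coAd 𝓘(ℝ, ℝ × V × ℝ) g₂ (ε • flatE V)) := by
  have h1 := SemidirectGroup.fst_comp_lieAd (SemidirectGroup.mk ρ g₁ g₂)⁻¹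
  have h2 := SemidirectGroup.flatE_comp_lieAd (ρ := ρ) g₁ g₂
  have h3 := g₂.coAd_flatE
  refine ContinuousLinearMap.ext fun Z => ?_
  have h4 : (lieAd (I₁.prod 𝓘(ℝ, ℝ × V × ℝ)) (SemidirectGroup.mk ρ g₁ g₂)⁻¹ Z).1
      = lieAd I₁ g₁⁻¹ Z.1 := DFunLike.congr_fun h1 Z
  have h5 : flatE V (lieAd (I₁.prod 𝓘(ℝ, ℝ × V × ℝ)) (SemidirectGroup.mk ρ g₁ g₂)⁻¹ Z).2
      = -g₂⁻¹.quadForm (ρ.deriv Z.1) + g₂⁻¹.conjForm Z.2 := DFunLike.congr_fun h2 Z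
  have h6 : flatE V (lieAd 𝓘(ℝ, ℝ × V × ℝ) g₂⁻¹ Z.2) = g₂⁻¹.conjForm Z.2 :=
    DFunLike.congr_fun h3 Z.2
  change ξ (lieAd (I₁.prod 𝓘(ℝ, ℝ × V × ℝ)) (SemidirectGroup.mk ρ g₁ g₂)⁻¹ Z).1
      + ε * flatE V (lieAd (I₁.prod 𝓘(ℝ, ℝ × V × ℝ)) (SemidirectGroup.mk ρ g₁ g₂)⁻¹ Z).2
    = ξ (lieAd I₁ g₁⁻¹ Z.1) - ε * g₂⁻¹.quadForm (ρ.deriv Z.1)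
      + ε * flatE V (lieAd 𝓘(ℝ, ℝ × V × ℝ) g₂⁻¹ Z.2)
  rw [h4, h5, h6]
  ring

end Explicit

/-! ### Invariance of the Kirillov-Kostant-Souriau form -/

section Invariance

variable {E : Type*} [NormedAddCommGroup E] [NormedSpace ℝ E]
  {H : Type*} [TopologicalSpace H] {I : ModelWithCorners ℝ E H}
  {G : Type*} [TopologicalSpace G] [ChartedSpace H G] [Group G] [LieGroup I ∞ G]
  [I.Boundaryless]

/-- The coadjoint action of `g`, as a linear map. -/
noncomputable def coAdL (I : ModelWithCorners ℝ E H) (g : G) : (E →L[ℝ] ℝ) →L[ℝ] (E →L[ℝ] ℝ) :=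
  (ContinuousLinearMap.compL ℝ E E ℝ).flip (lieAd I g⁻¹)

omit [I.Boundaryless] in
theorem coAd_coadDeriv (g : G) (ξ : E →L[ℝ] ℝ) (X : E) :
    coAd I g (coadDeriv I G ξ X) = coadDeriv I G (coAd I g ξ) (lieAd I g X) := by
  ext Y
  change -ξ (adDeriv I G X (lieAd I g⁻¹ Y)) = -ξ (lieAd I g⁻¹ (adDeriv I G (lieAd I g X) Y))
  rw [adDeriv_lieAd, lieAd_inv_apply]

theorem kksForm_coAd (g : G) (ξ : E →L[ℝ] ℝ) (X Y : E) :
    kksForm I G (coAd I g ξ) (coAd I g (coadDeriv I G ξ X)) (coAd I g (coadDeriv I G ξ Y))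
      = ξ (adDeriv I G X Y) := by
  rw [coAd_coadDeriv, coAd_coadDeriv, kksForm_coadDeriv, coAd_apply, adDeriv_lieAd,
    lieAd_inv_apply, lieAd_inv_apply]

omit [I.Boundaryless] in
theorem NondegenerateAt.exists_coAd_coadDeriv_eq [FiniteDimensional ℝ E] {ξ : E →L[ℝ] ℝ}
    (h : NondegenerateAt I G ξ) (g : G) (u : E →L[ℝ] ℝ) :
    ∃ X : E, coAd I g (coadDeriv I G ξ X) = u := by
  obtain ⟨e, he⟩ := h.exists_equiv
  refine ⟨e.symm (coAd I g⁻¹ u), ?_⟩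
  rw [← he]
  change coAd I g (e (e.symm (coAd I g⁻¹ u))) = u
  rw [e.apply_symm_apply, ← coAd_mul, mul_inv_cancel, coAd_one]

end Invariance

/-! ### The map between the orbits -/

section OrbitMap

open Filter Set
open scoped Topology

variable {E₁ : Type*} [NormedAddCommGroup E₁] [NormedSpace ℝ E₁]
  {H₁ : Type*} [TopologicalSpace H₁] {I₁ : ModelWithCorners ℝ E₁ H₁}
  {G₁ : Type*} [TopologicalSpace G₁] [ChartedSpace H₁ G₁] [Group G₁]
  {V : Type*} [NormedAddCommGroup V] [NormedSpace ℝ V] [FiniteDimensional ℝ V]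
  {Ω : SymplecticForm V}

/-- The isomorphism `x ↦ Ω (x, ·)` of `V` with its dual. -/
noncomputable def SymplecticForm.toDual (Ω : SymplecticForm V) : V ≃L[ℝ] (V →L[ℝ] ℝ) :=
  (LinearEquiv.ofInjectiveOfFinrankEq (Ω.form : V →ₗ[ℝ] V →L[ℝ] ℝ)
    ((injective_iff_map_eq_zero _).2 fun x hx => Ω.nondegenerate x fun y => DFunLike.congr_fun hx y)
    (by
      rw [← (LinearMap.toContinuousLinearMap : (V →ₗ[ℝ] ℝ) ≃ₗ[ℝ] V →L[ℝ] ℝ).finrank_eq]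
      exact (Subspace.dual_finrank_eq (K := ℝ) (V := V)).symm)).toContinuousLinearEquiv

/-- The vector `w` of `V` such that `η = Ω (w, ·)` on `V`. -/
noncomputable def SymplecticForm.dualVector (Ω : SymplecticForm V) :
    ((ℝ × V × ℝ) →L[ℝ] ℝ) →L[ℝ] V :=
  (Ω.toDual.symm : (V →L[ℝ] ℝ) →L[ℝ] V).comp
    ((ContinuousLinearMap.compL ℝ V (ℝ × V × ℝ) ℝ).flip
      ((ContinuousLinearMap.inr ℝ ℝ (V × ℝ)).comp (ContinuousLinearMap.inl ℝ V ℝ)))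

theorem SymplecticForm.dualVector_conjForm (s : ElementaryGroup Ω) :
    Ω.dualVector s.conjForm = Real.exp (2 * s.1) • s.2.1 := by
  change Ω.toDual.symm _ = _
  rw [ContinuousLinearEquiv.symm_apply_eq]
  ext y
  change s.conjForm (0, y, 0) = Ω.form (Real.exp (2 * s.1) • s.2.1) y
  rw [s.conjForm_apply]
  simp

theorem SymplecticForm.dualVector_flatE (Ω : SymplecticForm V) : Ω.dualVector (flatE V) = 0 := by
  change Ω.toDual.symm _ = _
  rw [ContinuousLinearEquiv.symm_apply_eq, map_zero]
  ext y
  rfl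

variable (ρ : SymplecticRep I₁ G₁ Ω)

/-- The linear form `X ↦ Ω (w, dρ(X) w)`: up to a factor, the moment map of the symplectic
representation `ρ`. -/
noncomputable def SymplecticRep.moment (w : V) : E₁ →L[ℝ] ℝ :=
  (Ω.form w).comp ((ContinuousLinearMap.apply ℝ V w).comp ρ.deriv)

omit [FiniteDimensional ℝ V] in
theorem SymplecticRep.hasFDerivAt_moment_zero :
    HasFDerivAt ρ.moment (0 : V →L[ℝ] E₁ →L[ℝ] ℝ) 0 := by
  have h1 := Ω.form.hasFDerivAt (x := 0)
  have h2 := ((ContinuousLinearMap.compL ℝ E₁ (V →L[ℝ] V) V).flip ρ.deriv).hasFDerivAt.comp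
    (0 : V) (ContinuousLinearMap.apply ℝ V : V →L[ℝ] (V →L[ℝ] V) →L[ℝ] V).hasFDerivAt
  have h3 := HasFDerivAt.clm_comp h1 h2
  refine h3.congr_fderiv ?_
  ext w X
  simp

omit [FiniteDimensional ℝ V] in
theorem SymplecticRep.contDiff_moment : ContDiff ℝ ∞ ρ.moment := by
  unfold SymplecticRep.moment
  fun_prop

/-- The form `X ↦ Ω (w, dρ(X) w) / (2 τ)`, where `w` is the dual vector of `η` and `τ` the value of
`η` at `E`. It is a junk value if `τ = 0`, which does not happen on the orbits of `± ♭E`. -/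
noncomputable def SymplecticRep.shear (η : (ℝ × V × ℝ) →L[ℝ] ℝ) : E₁ →L[ℝ] ℝ :=
  (2 * η (0, 0, 1))⁻¹ • ρ.moment (Ω.dualVector η)

/-- On the orbit of `ε ♭E` one has `w = ε e^{2a} x` and `τ = ε e^{2a}`, where `(a, x, ℓ) = s⁻¹`. -/
theorem SymplecticRep.shear_coAd {ε : ℝ} (hε : ε ≠ 0) (s : ElementaryGroup Ω) :
    ρ.shear (coAd 𝓘(ℝ, ℝ × V × ℝ) s (ε • flatE V)) = ε • s⁻¹.quadForm.comp ρ.deriv := by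
  have h1 : coAd 𝓘(ℝ, ℝ × V × ℝ) s (ε • flatE V) = ε • s⁻¹.conjForm := by
    rw [← s.coAd_flatE]
    rfl
  ext X
  rw [h1, SymplecticRep.shear, map_smul, Ω.dualVector_conjForm]
  have hexp := (Real.exp_pos (2 * s⁻¹.1)).ne'
  simp only [SymplecticRep.moment, ElementaryGroup.quadForm, smul_apply,
    ContinuousLinearMap.comp_apply, s⁻¹.conjForm_apply, ContinuousLinearMap.apply_apply,
    map_smul, smul_eq_mul, map_zero, mul_zero, zero_add, mul_one]
  field_simp

theorem SymplecticRep.contDiffAt_shear {η : (ℝ × V × ℝ) →L[ℝ] ℝ} (hη : η (0, 0, 1) ≠ 0) :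
    ContDiffAt ℝ ∞ ρ.shear η := by
  have h1 : ContDiffAt ℝ ∞ (fun η : (ℝ × V × ℝ) →L[ℝ] ℝ => (2 * η (0, 0, 1))⁻¹) η :=
    ContDiffAt.inv (by fun_prop) (by simpa using hη)
  refine h1.smul ?_
  exact (ρ.contDiff_moment.comp Ω.dualVector.contDiff).contDiffAt

/-- The shear is quadratic in `w`, which vanishes at `ε ♭E`. -/
theorem SymplecticRep.hasFDerivAt_shear {ε : ℝ} (hε : ε ≠ 0) :
    HasFDerivAt ρ.shear (0 : ((ℝ × V × ℝ) →L[ℝ] ℝ) →L[ℝ] E₁ →L[ℝ] ℝ) (ε • flatE V) := by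
  have hw : Ω.dualVector (ε • flatE V) = 0 := by
    rw [map_smul, Ω.dualVector_flatE, smul_zero]
  have h1 : HasFDerivAt (fun η => ρ.moment (Ω.dualVector η))
      (0 : ((ℝ × V × ℝ) →L[ℝ] ℝ) →L[ℝ] E₁ →L[ℝ] ℝ) (ε • flatE V) := by
    have h2 : HasFDerivAt ρ.moment (0 : V →L[ℝ] E₁ →L[ℝ] ℝ) (Ω.dualVector (ε • flatE V)) := by
      rw [hw]; exact ρ.hasFDerivAt_moment_zero
    exact (h2.comp _ Ω.dualVector.hasFDerivAt).congr_fderiv (ContinuousLinearMap.zero_comp _)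
  have h3 : ContDiffAt ℝ ∞ (fun η : (ℝ × V × ℝ) →L[ℝ] ℝ => (2 * η (0, 0, 1))⁻¹) (ε • flatE V) :=
    ContDiffAt.inv (by fun_prop) (by simpa [flatE] using hε)
  have h4 := (h3.differentiableAt (by simp)).hasFDerivAt.smul h1
  refine h4.congr_fderiv ?_
  rw [hw]
  ext v X
  simp [SymplecticRep.moment]

/-- The map from the product of the orbits to the orbit of the semidirect product: a shear. -/
noncomputable def SymplecticRep.orbitMap (p : (E₁ →L[ℝ] ℝ) × ((ℝ × V × ℝ) →L[ℝ] ℝ)) :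
    (E₁ × (ℝ × V × ℝ)) →L[ℝ] ℝ :=
  (p.1 - ρ.shear p.2).coprod p.2

/-- The inverse of `SymplecticRep.orbitMap`: the opposite shear. -/
noncomputable def SymplecticRep.orbitMapInv (ζ : (E₁ × (ℝ × V × ℝ)) →L[ℝ] ℝ) :
    (E₁ →L[ℝ] ℝ) × ((ℝ × V × ℝ) →L[ℝ] ℝ) :=
  (ζ.comp (ContinuousLinearMap.inl ℝ E₁ (ℝ × V × ℝ))
    + ρ.shear (ζ.comp (ContinuousLinearMap.inr ℝ E₁ (ℝ × V × ℝ))),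
    ζ.comp (ContinuousLinearMap.inr ℝ E₁ (ℝ × V × ℝ)))

theorem SymplecticRep.orbitMapInv_orbitMap (p : (E₁ →L[ℝ] ℝ) × ((ℝ × V × ℝ) →L[ℝ] ℝ)) :
    ρ.orbitMapInv (ρ.orbitMap p) = p := by
  simp [orbitMapInv, orbitMap]

/-- The direct sum of two linear forms, as a continuous linear map: the derivative of
`SymplecticRep.orbitMap` at the base point. -/
noncomputable def coprodL (E F : Type*) [NormedAddCommGroup E] [NormedSpace ℝ E]
    [NormedAddCommGroup F] [NormedSpace ℝ F] :
    ((E →L[ℝ] ℝ) × (F →L[ℝ] ℝ)) →L[ℝ] ((E × F) →L[ℝ] ℝ) :=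
  ((ContinuousLinearMap.compL ℝ (E × F) E ℝ).flip (ContinuousLinearMap.fst ℝ E F)).coprod
    ((ContinuousLinearMap.compL ℝ (E × F) F ℝ).flip (ContinuousLinearMap.snd ℝ E F))

theorem coprodL_apply {E F : Type*} [NormedAddCommGroup E] [NormedSpace ℝ E]
    [NormedAddCommGroup F] [NormedSpace ℝ F] (p : (E →L[ℝ] ℝ) × (F →L[ℝ] ℝ)) :
    coprodL E F p = p.1.coprod p.2 := by
  ext <;> simp [coprodL]

theorem SymplecticRep.orbitMap_eq (p : (E₁ →L[ℝ] ℝ) × ((ℝ × V × ℝ) →L[ℝ] ℝ)) :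
    ρ.orbitMap p = coprodL E₁ (ℝ × V × ℝ) (p.1 - ρ.shear p.2, p.2) := by
  rw [coprodL_apply]; rfl

theorem SymplecticRep.contDiffAt_orbitMap {p : (E₁ →L[ℝ] ℝ) × ((ℝ × V × ℝ) →L[ℝ] ℝ)}
    (hp : p.2 (0, 0, 1) ≠ 0) : ContDiffAt ℝ ∞ ρ.orbitMap p := by
  have h1 : ContDiffAt ℝ ∞
      (fun p : (E₁ →L[ℝ] ℝ) × ((ℝ × V × ℝ) →L[ℝ] ℝ) => ρ.shear p.2) p :=
    ContDiffAt.comp p (ρ.contDiffAt_shear hp) contDiffAt_snd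
  rw [funext ρ.orbitMap_eq]
  exact (coprodL E₁ (ℝ × V × ℝ)).contDiff.contDiffAt.comp p
    ((contDiffAt_fst.sub h1).prodMk contDiffAt_snd)

theorem SymplecticRep.contDiffAt_orbitMapInv {ζ : (E₁ × (ℝ × V × ℝ)) →L[ℝ] ℝ}
    (hζ : ζ (0, 0, 0, 1) ≠ 0) : ContDiffAt ℝ ∞ ρ.orbitMapInv ζ := by
  have hl : ContDiff ℝ ∞ fun ζ : (E₁ × (ℝ × V × ℝ)) →L[ℝ] ℝ =>
      ζ.comp (ContinuousLinearMap.inl ℝ E₁ (ℝ × V × ℝ)) := by fun_prop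
  have hr : ContDiff ℝ ∞ fun ζ : (E₁ × (ℝ × V × ℝ)) →L[ℝ] ℝ =>
      ζ.comp (ContinuousLinearMap.inr ℝ E₁ (ℝ × V × ℝ)) := by fun_prop
  refine ContDiffAt.prodMk (hl.contDiffAt.add ?_) hr.contDiffAt
  exact ContDiffAt.comp ζ (ρ.contDiffAt_shear (by simpa using hζ)) hr.contDiffAt

theorem SymplecticRep.hasFDerivAt_orbitMap {ε : ℝ} (hε : ε ≠ 0) (ξ : E₁ →L[ℝ] ℝ) :
    HasFDerivAt ρ.orbitMap (coprodL E₁ (ℝ × V × ℝ)) (ξ, ε • flatE V) := by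
  have h1 := (ρ.hasFDerivAt_shear hε).comp (ξ, ε • flatE V)
    (hasFDerivAt_snd (𝕜 := ℝ) (E := E₁ →L[ℝ] ℝ))
  have h2 := (coprodL E₁ (ℝ × V × ℝ)).hasFDerivAt.comp (ξ, ε • flatE V)
    ((hasFDerivAt_fst.sub h1).prodMk (hasFDerivAt_snd (𝕜 := ℝ) (E := E₁ →L[ℝ] ℝ)))
  rw [funext ρ.orbitMap_eq]
  refine h2.congr_fderiv (ContinuousLinearMap.ext fun v => ?_)
  simp

variable {ρ} [LieGroup I₁ ∞ G₁]

theorem SymplecticRep.orbitMap_coAd {ε : ℝ} (hε : ε ≠ 0) (ξ : E₁ →L[ℝ] ℝ) (g₁ : G₁)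
    (g₂ : ElementaryGroup Ω) :
    ρ.orbitMap (coAd I₁ g₁ ξ, coAd 𝓘(ℝ, ℝ × V × ℝ) g₂ (ε • flatE V))
      = coAd (I₁.prod 𝓘(ℝ, ℝ × V × ℝ)) (SemidirectGroup.mk ρ g₁ g₂) (ξ.coprod (ε • flatE V)) := by
  rw [SemidirectGroup.coAd_coprod, ← ρ.shear_coAd hε]
  rfl

end OrbitMap

/-! ### The symplectomorphism -/

section Symplectomorphism

open Filter Set
open scoped Topology

variable {E₁ : Type*} [NormedAddCommGroup E₁] [NormedSpace ℝ E₁]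
  {H₁ : Type*} [TopologicalSpace H₁] {I₁ : ModelWithCorners ℝ E₁ H₁}
  {G₁ : Type*} [TopologicalSpace G₁] [ChartedSpace H₁ G₁] [Group G₁]
  {V : Type*} [NormedAddCommGroup V] [NormedSpace ℝ V]
  {Ω : SymplecticForm V}

/-- The form `♭E [X, Y]` on the Lie algebra of the elementary group. -/
theorem ElementaryGroup.flatE_adDeriv (X Y : ℝ × V × ℝ) :
    flatE V (adDeriv 𝓘(ℝ, ℝ × V × ℝ) (ElementaryGroup Ω) X Y)
      = 2 * X.1 * Y.2.2 - 2 * X.2.2 * Y.1 + Ω.form X.2.1 Y.2.1 := by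
  have h1 : HasMFDerivAt 𝓘(ℝ, ℝ × V × ℝ) 𝓘(ℝ, ℝ)
      (fun s : ElementaryGroup Ω => s.conjForm Y) 1
      (((flatE V).comp (ContinuousLinearMap.apply ℝ (ℝ × V × ℝ) Y)).comp
        (adDeriv 𝓘(ℝ, ℝ × V × ℝ) (ElementaryGroup Ω)) :) := by
    have h2 := HasMFDerivAt.comp (1 : ElementaryGroup Ω)
      ((flatE V).comp (ContinuousLinearMap.apply ℝ (ℝ × V × ℝ) Y)).hasFDerivAt.hasMFDerivAt
      (hasMFDerivAt_lieAd_one (I := 𝓘(ℝ, ℝ × V × ℝ)) (G := ElementaryGroup Ω))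
    have h3 : (fun s : ElementaryGroup Ω => s.conjForm Y)
        = ((flatE V).comp (ContinuousLinearMap.apply ℝ (ℝ × V × ℝ) Y)) ∘ lieAd 𝓘(ℝ, ℝ × V × ℝ) :=
      funext fun s => (DFunLike.congr_fun s.flatE_comp_lieAd Y).symm
    rw [h3]
    exact h2
  have h2 : HasFDerivAt (fun s : ℝ × V × ℝ => Real.exp (2 * s.1) *
      (-2 * s.2.2 * Y.1 + (Ω.form s.2.1 Y.2.1 + Y.2.2)))
      (((flatE V).comp (ContinuousLinearMap.apply ℝ (ℝ × V × ℝ) Y)).comp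
        (adDeriv 𝓘(ℝ, ℝ × V × ℝ) (ElementaryGroup Ω))) ((0 : ℝ), (0 : V), (0 : ℝ)) := by
    have h3 : (fun s : ElementaryGroup Ω => s.conjForm Y) = fun s : ElementaryGroup Ω =>
        Real.exp (2 * s.1) * (-2 * s.2.2 * Y.1 + (Ω.form s.2.1 Y.2.1 + Y.2.2)) :=
      funext fun s => s.conjForm_apply _ _ _
    rw [h3] at h1
    exact hasMFDerivAt_iff_hasFDerivAt.1 h1
  have h3 : HasDerivAt (fun t : ℝ => t • X) X 0 := by
    simpa using (hasDerivAt_id (0 : ℝ)).smul_const X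
  have h4 := HasFDerivAt.comp_hasDerivAt_of_eq (0 : ℝ) h2 h3 (by simp)
  have h5 : HasDerivAt (fun t : ℝ => Real.exp (2 * (t * X.1)) *
      (-2 * (t * X.2.2) * Y.1 + (t * Ω.form X.2.1 Y.2.1 + Y.2.2)))
      (2 * X.1 * Y.2.2 - 2 * X.2.2 * Y.1 + Ω.form X.2.1 Y.2.1) 0 := by
    have ht := hasDerivAt_id (0 : ℝ)
    have h6 := ((ht.mul_const X.1).const_mul 2).exp.mul
      ((((ht.mul_const X.2.2).const_mul (-2)).mul_const Y.1).add
        ((ht.mul_const (Ω.form X.2.1 Y.2.1)).add_const Y.2.2))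
    refine h6.congr_deriv ?_
    simp
    ring
  have h6 : ((fun s : ℝ × V × ℝ => Real.exp (2 * s.1) *
      (-2 * s.2.2 * Y.1 + (Ω.form s.2.1 Y.2.1 + Y.2.2))) ∘ fun t : ℝ => t • X)
      = fun t : ℝ => Real.exp (2 * (t * X.1)) *
      (-2 * (t * X.2.2) * Y.1 + (t * Ω.form X.2.1 Y.2.1 + Y.2.2)) := by
    ext t
    simp
  rw [h6] at h4
  exact h4.unique h5

theorem ElementaryGroup.nondegenerateAt_smul_flatE {ε : ℝ} (hε : ε ≠ 0) :
    NondegenerateAt 𝓘(ℝ, ℝ × V × ℝ) (ElementaryGroup Ω) (ε • flatE V) := by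
  intro X hX
  have h1 : ∀ Y : ℝ × V × ℝ, 2 * X.1 * Y.2.2 - 2 * X.2.2 * Y.1 + Ω.form X.2.1 Y.2.1 = 0 := by
    intro Y
    rw [← flatE_adDeriv]
    exact (mul_eq_zero.1 (hX Y)).resolve_left hε
  have ha := h1 (0, 0, 1)
  have hl := h1 (1, 0, 0)
  have hx : X.2.1 = 0 := Ω.nondegenerate _ fun y => by simpa using h1 (0, y, 0)
  simp only [mul_one, mul_zero, sub_zero, map_zero, add_zero, mul_eq_zero, OfNat.ofNat_ne_zero,
    false_or, zero_sub, neg_eq_zero] at ha hl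
  exact Prod.ext ha (Prod.ext hx hl)

theorem ElementaryGroup.apply_ne_zero_of_mem_orbit {ε : ℝ} (hε : ε ≠ 0)
    {η : (ℝ × V × ℝ) →L[ℝ] ℝ}
    (hη : η ∈ coadjointOrbit 𝓘(ℝ, ℝ × V × ℝ) (ElementaryGroup Ω) (ε • flatE V)) :
    η (0, 0, 1) ≠ 0 := by
  obtain ⟨s, rfl⟩ := hη
  have h1 : coAd 𝓘(ℝ, ℝ × V × ℝ) s (ε • flatE V) (0, 0, 1) = ε * Real.exp (2 * s⁻¹.1) := by
    have h2 := DFunLike.congr_fun s.coAd_flatE (0, 0, 1)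
    change ε * coAd 𝓘(ℝ, ℝ × V × ℝ) s (flatE V) (0, 0, 1) = _
    rw [h2, ElementaryGroup.conjForm_apply]
    simp
  change coAd 𝓘(ℝ, ℝ × V × ℝ) s (ε • flatE V) (0, 0, 1) ≠ 0
  rw [h1]
  exact mul_ne_zero hε (Real.exp_pos _).ne'

variable (ρ : SymplecticRep I₁ G₁ Ω)

/-- The action of `ρ(g)` on the Lie algebra of the elementary group. -/
noncomputable def SymplecticRep.lieAct (g : G₁) : (ℝ × V × ℝ) →L[ℝ] (ℝ × V × ℝ) :=
  (ContinuousLinearMap.id ℝ ℝ).prodMap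
    ((ρ.hom g : V →L[ℝ] V).prodMap (ContinuousLinearMap.id ℝ ℝ))

theorem SymplecticRep.coAd_comp_lieAct (ε : ℝ) (g : G₁) (s : ElementaryGroup Ω) :
    (coAd 𝓘(ℝ, ℝ × V × ℝ) s (ε • flatE V)).comp (ρ.lieAct g)
      = coAd 𝓘(ℝ, ℝ × V × ℝ) (ρ.act g⁻¹ s) (ε • flatE V) := by
  have h1 : ∀ s : ElementaryGroup Ω, coAd 𝓘(ℝ, ℝ × V × ℝ) s (ε • flatE V) = ε • s⁻¹.conjForm := by
    intro s
    rw [← s.coAd_flatE]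
    rfl
  have h2 : ∀ x y, Ω.form x (ρ.hom g y) = Ω.form (ρ.hom g⁻¹ x) y := by
    intro x y
    have h3 : ρ.hom g (ρ.hom g⁻¹ x) = x := by
      have := congrArg (fun T : V ≃L[ℝ] V => T x) (map_mul ρ.hom g g⁻¹)
      rw [mul_inv_cancel, map_one] at this
      exact this.symm
    rw [← ρ.symplectic g (ρ.hom g⁻¹ x) y, h3]
  rw [h1, h1, ← ρ.act_inv]
  refine ContinuousLinearMap.ext fun ⟨b, y, m⟩ => ?_
  change ε * s⁻¹.conjForm (b, ρ.hom g y, m) = ε * (ρ.act g⁻¹ s⁻¹).conjForm (b, y, m)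
  rw [ElementaryGroup.conjForm_apply, ElementaryGroup.conjForm_apply, h2]
  rfl

theorem SymplecticRep.flatE_adDeriv_lieAct (g : G₁) (X Y : ℝ × V × ℝ) :
    flatE V (adDeriv 𝓘(ℝ, ℝ × V × ℝ) (ElementaryGroup Ω) (ρ.lieAct g X) (ρ.lieAct g Y))
      = flatE V (adDeriv 𝓘(ℝ, ℝ × V × ℝ) (ElementaryGroup Ω) X Y) := by
  rw [ElementaryGroup.flatE_adDeriv, ElementaryGroup.flatE_adDeriv]
  change 2 * X.1 * Y.2.2 - 2 * X.2.2 * Y.1 + Ω.form (ρ.hom g X.2.1) (ρ.hom g Y.2.1) = _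
  rw [ρ.symplectic]

theorem SymplecticRep.coadDeriv_comp_lieAct (ε : ℝ) (g : G₁) (X : ℝ × V × ℝ) :
    (coadDeriv 𝓘(ℝ, ℝ × V × ℝ) (ElementaryGroup Ω) (ε • flatE V) X).comp (ρ.lieAct g)
      = coadDeriv 𝓘(ℝ, ℝ × V × ℝ) (ElementaryGroup Ω) (ε • flatE V) (ρ.lieAct g⁻¹ X) := by
  have h1 : ρ.lieAct g (ρ.lieAct g⁻¹ X) = X := by
    have := congrArg (fun T : V ≃L[ℝ] V => T X.2.1) (map_mul ρ.hom g g⁻¹)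
    rw [mul_inv_cancel, map_one] at this
    exact Prod.ext rfl (Prod.ext this.symm rfl)
  refine ContinuousLinearMap.ext fun Y => ?_
  change -(ε * flatE V (adDeriv _ _ X (ρ.lieAct g Y))) = -(ε * flatE V (adDeriv _ _ _ Y))
  rw [← ρ.flatE_adDeriv_lieAct g (ρ.lieAct g⁻¹ X), h1]

variable [FiniteDimensional ℝ V] [LieGroup I₁ ∞ G₁] [I₁.Boundaryless] {ρ}

/-- Differentiate at `1` the identity between the orbit map of `ξ + ε ♭E` and the shear of the orbit
maps of `ξ` and `ε ♭E`. -/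
theorem SymplecticRep.coadDeriv_coprod {ε : ℝ} (hε : ε ≠ 0) (ξ : E₁ →L[ℝ] ℝ)
    (X : E₁ × (ℝ × V × ℝ)) :
    coadDeriv (I₁.prod 𝓘(ℝ, ℝ × V × ℝ)) (SemidirectGroup ρ) (ξ.coprod (ε • flatE V)) X
      = (coadDeriv I₁ G₁ ξ X.1).coprod
        (coadDeriv 𝓘(ℝ, ℝ × V × ℝ) (ElementaryGroup Ω) (ε • flatE V) X.2) := by
  have h1 := hasMFDerivAt_coAd_one (I := I₁.prod 𝓘(ℝ, ℝ × V × ℝ)) (G := SemidirectGroup ρ)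
    (ξ.coprod (ε • flatE V))
  let F : SemidirectGroup ρ → (E₁ →L[ℝ] ℝ) × ((ℝ × V × ℝ) →L[ℝ] ℝ) := fun h =>
    (coAd I₁ h.1 ξ, coAd 𝓘(ℝ, ℝ × V × ℝ) h.2 (ε • flatE V))
  have hF1 : F 1 = (ξ, ε • flatE V) := Prod.ext (coAd_one ξ) (coAd_one _)
  have h2 : HasMFDerivAt (I₁.prod 𝓘(ℝ, ℝ × V × ℝ)) 𝓘(ℝ, E₁ →L[ℝ] ℝ)
      (fun h : SemidirectGroup ρ => coAd I₁ h.1 ξ) 1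
      ((coadDeriv I₁ G₁ ξ).comp (ContinuousLinearMap.fst ℝ E₁ (ℝ × V × ℝ)) :) :=
    HasMFDerivAt.comp (1 : SemidirectGroup ρ) (I' := I₁) (M' := G₁) (hasMFDerivAt_coAd_one ξ)
      (hasMFDerivAt_fst (M := G₁) (M' := ElementaryGroup Ω) _)
  have h3 : HasMFDerivAt (I₁.prod 𝓘(ℝ, ℝ × V × ℝ)) 𝓘(ℝ, (ℝ × V × ℝ) →L[ℝ] ℝ)
      (fun h : SemidirectGroup ρ => coAd 𝓘(ℝ, ℝ × V × ℝ) h.2 (ε • flatE V)) 1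
      ((coadDeriv 𝓘(ℝ, ℝ × V × ℝ) (ElementaryGroup Ω) (ε • flatE V)).comp
        (ContinuousLinearMap.snd ℝ E₁ (ℝ × V × ℝ)) :) :=
    HasMFDerivAt.comp (1 : SemidirectGroup ρ) (I' := 𝓘(ℝ, ℝ × V × ℝ)) (M' := ElementaryGroup Ω)
      (hasMFDerivAt_coAd_one _) (hasMFDerivAt_snd (M := G₁) (M' := ElementaryGroup Ω) _)
  have h4 : HasMFDerivAt (I₁.prod 𝓘(ℝ, ℝ × V × ℝ))
      𝓘(ℝ, (E₁ →L[ℝ] ℝ) × ((ℝ × V × ℝ) →L[ℝ] ℝ)) F 1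
      (((coadDeriv I₁ G₁ ξ).comp (ContinuousLinearMap.fst ℝ E₁ (ℝ × V × ℝ))).prod
        ((coadDeriv 𝓘(ℝ, ℝ × V × ℝ) (ElementaryGroup Ω) (ε • flatE V)).comp
        (ContinuousLinearMap.snd ℝ E₁ (ℝ × V × ℝ))) :) :=
    ⟨h2.1.prodMk h3.1, h2.2.prodMk h3.2⟩
  have h5 : HasMFDerivAt 𝓘(ℝ, (E₁ →L[ℝ] ℝ) × ((ℝ × V × ℝ) →L[ℝ] ℝ))
      𝓘(ℝ, (E₁ × (ℝ × V × ℝ)) →L[ℝ] ℝ) ρ.orbitMap (F 1) (coprodL E₁ (ℝ × V × ℝ) :) := by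
    rw [hF1]
    exact (ρ.hasFDerivAt_orbitMap hε ξ).hasMFDerivAt
  have h6 := h5.comp (1 : SemidirectGroup ρ) h4
  have h7 : (fun g : SemidirectGroup ρ =>
      coAd (I₁.prod 𝓘(ℝ, ℝ × V × ℝ)) g (ξ.coprod (ε • flatE V))) = ρ.orbitMap ∘ F :=
    funext fun g => (ρ.orbitMap_coAd hε ξ g.1 g.2).symm
  rw [h7] at h1
  refine (DFunLike.congr_fun (hasMFDerivAt_unique h1 h6) X).trans ?_
  exact coprodL_apply _

/-- The two factors are orthogonal for the form `o [X, Y]`, where `o = ξ + ε ♭E`. -/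
theorem SymplecticRep.coprod_adDeriv {ε : ℝ} (hε : ε ≠ 0) (ξ : E₁ →L[ℝ] ℝ)
    (X Y : E₁ × (ℝ × V × ℝ)) :
    ξ.coprod (ε • flatE V)
        (adDeriv (I₁.prod 𝓘(ℝ, ℝ × V × ℝ)) (SemidirectGroup ρ) X Y)
      = ξ (adDeriv I₁ G₁ X.1 Y.1)
        + ε * flatE V (adDeriv 𝓘(ℝ, ℝ × V × ℝ) (ElementaryGroup Ω) X.2 Y.2) := by
  have h1 := DFunLike.congr_fun (SymplecticRep.coadDeriv_coprod (ρ := ρ) hε ξ X) Y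
  have h2 : -(ξ.coprod (ε • flatE V)
        (adDeriv (I₁.prod 𝓘(ℝ, ℝ × V × ℝ)) (SemidirectGroup ρ) X Y))
      = -ξ (adDeriv I₁ G₁ X.1 Y.1)
        + -(ε * flatE V (adDeriv 𝓘(ℝ, ℝ × V × ℝ) (ElementaryGroup Ω) X.2 Y.2)) := h1
  linarith

theorem NondegenerateAt.coprod {ε : ℝ} (hε : ε ≠ 0) {ξ : E₁ →L[ℝ] ℝ}
    (hξ : NondegenerateAt I₁ G₁ ξ) :
    NondegenerateAt (I₁.prod 𝓘(ℝ, ℝ × V × ℝ)) (SemidirectGroup ρ) (ξ.coprod (ε • flatE V)) := by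
  intro X hX
  refine Prod.ext (hξ _ fun Y => ?_)
    (ElementaryGroup.nondegenerateAt_smul_flatE (Ω := Ω) hε _ fun Y => ?_)
  · have h1 := hX (Y, 0)
    rw [SymplecticRep.coprod_adDeriv (ρ := ρ) hε] at h1
    simpa using h1
  · have h1 := hX (0, Y)
    rw [SymplecticRep.coprod_adDeriv (ρ := ρ) hε] at h1
    simpa using h1

variable [FiniteDimensional ℝ E₁]

/-- The derivative of `SymplecticRep.orbitMap` at a point of the product of the orbits is determined
by the one at the base point: `(g₁, g₂) (h₁, ρ(g₁)⁻¹ h₂) = (g₁ h₁, g₂ h₂)`, so that the map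
intertwines the actions up to the automorphism `ρ(g₁)` of the second factor. -/
theorem SymplecticRep.fderiv_orbitMap_coAd {ε : ℝ} (hε : ε ≠ 0) {ξ : E₁ →L[ℝ] ℝ}
    (hξ : NondegenerateAt I₁ G₁ ξ) (g₁ : G₁) (g₂ : ElementaryGroup Ω) (u : E₁ →L[ℝ] ℝ)
    (v : (ℝ × V × ℝ) →L[ℝ] ℝ) :
    fderiv ℝ ρ.orbitMap (coAd I₁ g₁ ξ, coAd 𝓘(ℝ, ℝ × V × ℝ) g₂ (ε • flatE V))
        (coAd I₁ g₁ u, coAd 𝓘(ℝ, ℝ × V × ℝ) g₂ v)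
      = coAd (I₁.prod 𝓘(ℝ, ℝ × V × ℝ)) (SemidirectGroup.mk ρ g₁ g₂)
        (u.coprod (v.comp (ρ.lieAct g₁))) := by
  let A := (coAdL I₁ g₁).prodMap (coAdL 𝓘(ℝ, ℝ × V × ℝ) g₂)
  let T := (ContinuousLinearMap.id ℝ (E₁ →L[ℝ] ℝ)).prodMap
    ((ContinuousLinearMap.compL ℝ (ℝ × V × ℝ) (ℝ × V × ℝ) ℝ).flip (ρ.lieAct g₁))
  let B := coAdL (I₁.prod 𝓘(ℝ, ℝ × V × ℝ)) (SemidirectGroup.mk ρ g₁ g₂)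
  have hmem : coAd 𝓘(ℝ, ℝ × V × ℝ) g₂ (ε • flatE V)
    ∈ coadjointOrbit 𝓘(ℝ, ℝ × V × ℝ) (ElementaryGroup Ω) (ε • flatE V) := ⟨g₂, rfl⟩
  have h1 : HasFDerivAt (ρ.orbitMap ∘ A)
      ((fderiv ℝ ρ.orbitMap (A (ξ, ε • flatE V))).comp A) (ξ, ε • flatE V) :=
    ((ρ.contDiffAt_orbitMap (p := A (ξ, ε • flatE V))
      (ElementaryGroup.apply_ne_zero_of_mem_orbit hε hmem)).differentiableAt
        (by simp)).hasFDerivAt.comp _ A.hasFDerivAt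
  have hT : T (ξ, ε • flatE V) = (ξ, ε • flatE V) := Prod.ext rfl rfl
  have h2 : HasFDerivAt (B ∘ ρ.orbitMap ∘ T)
      (B.comp ((coprodL E₁ (ℝ × V × ℝ)).comp T)) (ξ, ε • flatE V) := by
    refine B.hasFDerivAt.comp _ (HasFDerivAt.comp _ ?_ T.hasFDerivAt)
    rw [hT]
    exact ρ.hasFDerivAt_orbitMap hε ξ
  have hO : coadjointOrbit I₁ G₁ ξ ×ˢ
      coadjointOrbit 𝓘(ℝ, ℝ × V × ℝ) (ElementaryGroup Ω) (ε • flatE V) ∈ 𝓝 (ξ, ε • flatE V) :=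
    (hξ.isOpen_coadjointOrbit.prod
      (ElementaryGroup.nondegenerateAt_smul_flatE hε).isOpen_coadjointOrbit).mem_nhds
      ⟨⟨1, coAd_one ξ⟩, ⟨1, coAd_one _⟩⟩
  have h3 : ρ.orbitMap ∘ A =ᶠ[𝓝 (ξ, ε • flatE V)] B ∘ ρ.orbitMap ∘ T := by
    filter_upwards [hO]
    rintro ⟨_, _⟩ ⟨⟨h₁, rfl⟩, ⟨h₂, rfl⟩⟩
    change ρ.orbitMap (coAd I₁ g₁ (coAd I₁ h₁ ξ),
        coAd 𝓘(ℝ, ℝ × V × ℝ) g₂ (coAd 𝓘(ℝ, ℝ × V × ℝ) h₂ (ε • flatE V)))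
      = coAd (I₁.prod 𝓘(ℝ, ℝ × V × ℝ)) (SemidirectGroup.mk ρ g₁ g₂)
        (ρ.orbitMap (coAd I₁ h₁ ξ,
          (coAd 𝓘(ℝ, ℝ × V × ℝ) h₂ (ε • flatE V)).comp (ρ.lieAct g₁)))
    rw [ρ.coAd_comp_lieAct, ρ.orbitMap_coAd hε, ← coAd_mul, ← coAd_mul, ← coAd_mul,
      ρ.orbitMap_coAd hε]
    congr 1
    refine Prod.ext rfl ?_
    change g₂ * h₂ = g₂ * ρ.act g₁ (ρ.act g₁⁻¹ h₂)
    rw [← ρ.act_mul, mul_inv_cancel, ρ.act_one]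
  have h4 := DFunLike.congr_fun (h1.unique (h2.congr_of_eventuallyEq h3)) (u, v)
  refine h4.trans ?_
  change B (coprodL E₁ (ℝ × V × ℝ) (u, v.comp (ρ.lieAct g₁))) = _
  rw [coprodL_apply]
  rfl

theorem SymplecticRep.kksForm_fderiv_orbitMap {ε : ℝ} (hε : ε ≠ 0) {ξ : E₁ →L[ℝ] ℝ}
    (hξ : NondegenerateAt I₁ G₁ ξ) (g₁ : G₁) (g₂ : ElementaryGroup Ω)
    (u v : (E₁ →L[ℝ] ℝ) × ((ℝ × V × ℝ) →L[ℝ] ℝ)) :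
    kksForm (I₁.prod 𝓘(ℝ, ℝ × V × ℝ)) (SemidirectGroup ρ)
        (ρ.orbitMap (coAd I₁ g₁ ξ, coAd 𝓘(ℝ, ℝ × V × ℝ) g₂ (ε • flatE V)))
        (fderiv ℝ ρ.orbitMap (coAd I₁ g₁ ξ, coAd 𝓘(ℝ, ℝ × V × ℝ) g₂ (ε • flatE V)) u)
        (fderiv ℝ ρ.orbitMap (coAd I₁ g₁ ξ, coAd 𝓘(ℝ, ℝ × V × ℝ) g₂ (ε • flatE V)) v)
      = kksForm I₁ G₁ (coAd I₁ g₁ ξ) u.1 v.1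
        + kksForm 𝓘(ℝ, ℝ × V × ℝ) (ElementaryGroup Ω)
          (coAd 𝓘(ℝ, ℝ × V × ℝ) g₂ (ε • flatE V)) u.2 v.2 := by
  have hη := ElementaryGroup.nondegenerateAt_smul_flatE (Ω := Ω) hε
  obtain ⟨u₁, u₂⟩ := u
  obtain ⟨v₁, v₂⟩ := v
  obtain ⟨X₁, rfl⟩ := hξ.exists_coAd_coadDeriv_eq g₁ u₁
  obtain ⟨Y₁, rfl⟩ := hξ.exists_coAd_coadDeriv_eq g₁ v₁
  obtain ⟨X₂, rfl⟩ := hη.exists_coAd_coadDeriv_eq g₂ u₂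
  obtain ⟨Y₂, rfl⟩ := hη.exists_coAd_coadDeriv_eq g₂ v₂
  have h1 : ∀ (X : E₁) (Z : ℝ × V × ℝ), (coadDeriv I₁ G₁ ξ X).coprod
      (coadDeriv 𝓘(ℝ, ℝ × V × ℝ) (ElementaryGroup Ω) (ε • flatE V) Z)
      = coadDeriv (I₁.prod 𝓘(ℝ, ℝ × V × ℝ)) (SemidirectGroup ρ) (ξ.coprod (ε • flatE V))
        (X, Z) := fun X Z => (SymplecticRep.coadDeriv_coprod (ρ := ρ) hε ξ (X, Z)).symm
  rw [ρ.fderiv_orbitMap_coAd hε hξ, ρ.fderiv_orbitMap_coAd hε hξ, ρ.coadDeriv_comp_lieAct,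
    ρ.coadDeriv_comp_lieAct, h1, h1, ρ.orbitMap_coAd hε, kksForm_coAd, kksForm_coAd, kksForm_coAd,
    SymplecticRep.coprod_adDeriv (ρ := ρ) hε, ρ.flatE_adDeriv_lieAct]
  rfl

theorem SymplecticRep.isSymplectomorphismOn_orbitMap {ε : ℝ} (hε : ε ≠ 0) {ξ : E₁ →L[ℝ] ℝ}
    (hξ : NondegenerateAt I₁ G₁ ξ) :
    IsSymplectomorphismOn
      (coadjointOrbit I₁ G₁ ξ ×ˢ
        coadjointOrbit 𝓘(ℝ, ℝ × V × ℝ) (ElementaryGroup Ω) (ε • flatE V))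
      (coadjointOrbit (I₁.prod 𝓘(ℝ, ℝ × V × ℝ)) (SemidirectGroup ρ) (ξ.coprod (ε • flatE V)))
      (fun ζ u v => kksForm I₁ G₁ ζ.1 u.1 v.1 +
        kksForm 𝓘(ℝ, ℝ × V × ℝ) (ElementaryGroup Ω) ζ.2 u.2 v.2)
      (kksForm (I₁.prod 𝓘(ℝ, ℝ × V × ℝ)) (SemidirectGroup ρ)) ρ.orbitMap := by
  set A := coadjointOrbit I₁ G₁ ξ ×ˢ
    coadjointOrbit 𝓘(ℝ, ℝ × V × ℝ) (ElementaryGroup Ω) (ε • flatE V) with hA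
  set B := coadjointOrbit (I₁.prod 𝓘(ℝ, ℝ × V × ℝ)) (SemidirectGroup ρ)
    (ξ.coprod (ε • flatE V)) with hB
  have hinj : InjOn ρ.orbitMap A := (Function.LeftInverse.injective ρ.orbitMapInv_orbitMap).injOn
  have hbij : BijOn ρ.orbitMap A B := by
    refine ⟨?_, hinj, ?_⟩
    · rintro ⟨_, _⟩ ⟨⟨h₁, rfl⟩, ⟨h₂, rfl⟩⟩
      exact ⟨SemidirectGroup.mk ρ h₁ h₂, (ρ.orbitMap_coAd hε ξ h₁ h₂).symm⟩
    · rintro _ ⟨h, rfl⟩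
      exact ⟨_, ⟨⟨h.1, rfl⟩, ⟨h.2, rfl⟩⟩, ρ.orbitMap_coAd hε ξ h.1 h.2⟩
  have hinv : ∀ ζ ∈ B, Function.invFunOn ρ.orbitMap A ζ = ρ.orbitMapInv ζ := by
    intro ζ hζ
    obtain ⟨p, hp, rfl⟩ := hbij.surjOn hζ
    rw [hinj.leftInvOn_invFunOn hp, ρ.orbitMapInv_orbitMap]
  refine ⟨?_, (hξ.coprod hε).isOpen_coadjointOrbit, hbij, ?_, ?_, ?_⟩
  · exact hξ.isOpen_coadjointOrbit.prod
      (ElementaryGroup.nondegenerateAt_smul_flatE hε).isOpen_coadjointOrbit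
  · exact fun p hp =>
      (ρ.contDiffAt_orbitMap (ElementaryGroup.apply_ne_zero_of_mem_orbit hε hp.2)).contDiffWithinAt
  · refine ContDiffOn.congr (fun ζ hζ => ?_) hinv
    obtain ⟨p, hp, rfl⟩ := hbij.surjOn hζ
    refine (ρ.contDiffAt_orbitMapInv ?_).contDiffWithinAt
    have h1 : ρ.orbitMap p (0, 0, 0, 1) = p.2 (0, 0, 1) := by
      simp [SymplecticRep.orbitMap]
    rw [h1]
    exact ElementaryGroup.apply_ne_zero_of_mem_orbit hε hp.2
  · rintro ⟨_, _⟩ ⟨⟨h₁, rfl⟩, ⟨h₂, rfl⟩⟩ u v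
    exact ρ.kksForm_fderiv_orbitMap hε hξ h₁ h₂ u v

end Symplectomorphism

theorem mainTheorem10
    {E₁ : Type*} [NormedAddCommGroup E₁] [NormedSpace ℝ E₁] [FiniteDimensional ℝ E₁]
    {G₁ : Type*} [TopologicalSpace G₁] [T2Space G₁] [SecondCountableTopology G₁]
    [ChartedSpace E₁ G₁] [Group G₁] [LieGroup 𝓘(ℝ, E₁) ∞ G₁]
    (hG₁ : IsNormalJGroup 𝓘(ℝ, E₁) G₁)
    {V₂ : Type*} [NormedAddCommGroup V₂] [NormedSpace ℝ V₂] [FiniteDimensional ℝ V₂]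
    (ω₀ : SymplecticForm V₂) (ρ : SymplecticRep 𝓘(ℝ, E₁) G₁ ω₀) :
    -- an open coadjoint orbit of `G₁`, with a simply transitive action
    (∃ o₁ : E₁ →L[ℝ] ℝ, IsOpen (coadjointOrbit 𝓘(ℝ, E₁) G₁ o₁) ∧
      CoadjointSimplyTransitiveOn 𝓘(ℝ, E₁) G₁ (coadjointOrbit 𝓘(ℝ, E₁) G₁ o₁)) ∧
    -- for every such orbit and every sign
    ∀ o₁ : E₁ →L[ℝ] ℝ, IsOpen (coadjointOrbit 𝓘(ℝ, E₁) G₁ o₁) →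
      CoadjointSimplyTransitiveOn 𝓘(ℝ, E₁) G₁ (coadjointOrbit 𝓘(ℝ, E₁) G₁ o₁) →
      ∀ ε₂ : ℝ, (ε₂ = 1 ∨ ε₂ = -1) →
        -- the orbit of `G` through `o = o₁ + ε₂ ♭E₂` is open
        IsOpen (coadjointOrbit (𝓘(ℝ, E₁).prod 𝓘(ℝ, ℝ × V₂ × ℝ)) (SemidirectGroup ρ)
          (o₁.coprod (ε₂ • flatE V₂))) ∧
        -- the map `φ` is well defined and is a symplectomorphism
        ∃ φ : (E₁ →L[ℝ] ℝ) × ((ℝ × V₂ × ℝ) →L[ℝ] ℝ) → ((E₁ × (ℝ × V₂ × ℝ)) →L[ℝ] ℝ),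
          (∀ (g₁ : G₁) (g₂ : ElementaryGroup ω₀),
            φ (coAd 𝓘(ℝ, E₁) g₁ o₁, coAd 𝓘(ℝ, ℝ × V₂ × ℝ) g₂ (ε₂ • flatE V₂)) =
              coAd (𝓘(ℝ, E₁).prod 𝓘(ℝ, ℝ × V₂ × ℝ)) (SemidirectGroup.mk ρ g₁ g₂)
                (o₁.coprod (ε₂ • flatE V₂))) ∧
          IsSymplectomorphismOn
            (coadjointOrbit 𝓘(ℝ, E₁) G₁ o₁ ×ˢ
              coadjointOrbit 𝓘(ℝ, ℝ × V₂ × ℝ) (ElementaryGroup ω₀) (ε₂ • flatE V₂))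
            (coadjointOrbit (𝓘(ℝ, E₁).prod 𝓘(ℝ, ℝ × V₂ × ℝ)) (SemidirectGroup ρ)
              (o₁.coprod (ε₂ • flatE V₂)))
            (fun ξ u v => kksForm 𝓘(ℝ, E₁) G₁ ξ.1 u.1 v.1 +
              kksForm 𝓘(ℝ, ℝ × V₂ × ℝ) (ElementaryGroup ω₀) ξ.2 u.2 v.2)
            (kksForm (𝓘(ℝ, E₁).prod 𝓘(ℝ, ℝ × V₂ × ℝ)) (SemidirectGroup ρ))
            φ := by
  refine ⟨hG₁.exists_isOpen_coadjointOrbit, fun o₁ hO _ ε₂ hε => ?_⟩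
  have hε0 : ε₂ ≠ 0 := by rcases hε with rfl | rfl <;> norm_num
  have hnd := NondegenerateAt.of_isOpen_coadjointOrbit hO
  exact ⟨(hnd.coprod hε0).isOpen_coadjointOrbit, ρ.orbitMap, ρ.orbitMap_coAd hε0 o₁,
    ρ.isSymplectomorphismOn_orbitMap hε0 hnd⟩
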